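/- There is a polynomial-time algorithm that, given a finite simple graph $G=(V,E)$ and a vertex weight function $w\colon V\to\mathbb{Q}_{\ge 0}$, computes a vertex cover $X$ of $G$ of weight $$w(X)\;\le\;\mathrm{OPT}_{\mathrm{WVC}}(G,w)+\mathrm{OPT}_{\mathrm{FVS}}(G,w).$$ Here $w(X)=\sum_{v\in X}w(v)$; a vertex cover is a set $X\subseteq V$ such that $G-X$ has no edges, and a feedback vertex set is a set $X\subseteq V$ such that $G-X$ is acyclic; $\mathrm{OPT}_{\mathrm{WVC}}(G,w)$ and $\mathrm{OPT}_{\mathrm{FVS}}(G,w)$ are the minimum of $w(X)$ over all vertex covers and over all feedback vertex sets $X$ of $G$, respectively. Polynomial time means that the bit (logarithmic) cost of the algorithm on a random access machine is bounded by a polynomial in the bit length of the input, which consists of the number of vertices, the adjacency matrix, and the numerators and denominators of the (reduced) rational weights. -/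

import Mathlib

/-! ### A random access machine with logarithmic cost

Programs of the machine are while-programs over a fixed finite number of arrays of natural numbers
(the arrays that occur in the program) with indirect addressing and integer arithmetic.  Every
operation is charged the bit lengths of the numbers it touches. -/

namespace RAM

/-- A memory: cell `i` of array `a` holds the natural number `s a i`. -/
abbrev State : Type := ℕ → ℕ → ℕ

/-- Arithmetic expressions; `read a e` is the content of the cell of array `a` at address `e`. -/
inductive Expr : Type
  | const (k : ℕ)
  | read (a : ℕ) (e : Expr)
  | add (e₁ e₂ : Expr)
  | sub (e₁ e₂ : Expr)
  | mul (e₁ e₂ : Expr)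
  | div (e₁ e₂ : Expr)

namespace Expr

/-- The value of an expression (subtraction is truncated at `0`, division is rounded down and
division by `0` gives `0`). -/
def eval (s : State) : Expr → ℕ
  | const k => k
  | read a e => s a (e.eval s)
  | add e₁ e₂ => e₁.eval s + e₂.eval s
  | sub e₁ e₂ => e₁.eval s - e₂.eval s
  | mul e₁ e₂ => e₁.eval s * e₂.eval s
  | div e₁ e₂ => e₁.eval s / e₂.eval s

/-- The logarithmic cost of evaluating an expression: every node of the expression costs `1` plus
the bit length of its value, so that an operation pays for its operands and for its result. -/
def cost (s : State) : Expr → ℕ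
  | const k => 1 + k.size
  | read a e => e.cost s + (1 + (eval s (read a e)).size)
  | add e₁ e₂ => e₁.cost s + e₂.cost s + (1 + (eval s (add e₁ e₂)).size)
  | sub e₁ e₂ => e₁.cost s + e₂.cost s + (1 + (eval s (sub e₁ e₂)).size)
  | mul e₁ e₂ => e₁.cost s + e₂.cost s + (1 + (eval s (mul e₁ e₂)).size)
  | div e₁ e₂ => e₁.cost s + e₂.cost s + (1 + (eval s (div e₁ e₂)).size)

end Expr

/-- Programs. `assign a i e` stores the value of `e` in the cell of array `a` at address `i`; a
condition is true when its value is not `0`. -/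
inductive Cmd : Type
  | skip
  | assign (a : ℕ) (i e : Expr)
  | seq (c₁ c₂ : Cmd)
  | ite (e : Expr) (c₁ c₂ : Cmd)
  | loop (e : Expr) (c : Cmd)

/-- The memory `s` after the number `v` has been stored in cell `i` of array `a`. -/
def State.store (s : State) (a i v : ℕ) : State :=
  Function.update s a (Function.update (s a) i v)

/-- `Exec c s s' t`: started with memory `s`, the program `c` halts with memory `s'`, and the total
cost of the run is `t`. -/
inductive Exec : Cmd → State → State → ℕ → Prop
  | skip (s : State) : Exec .skip s s 1
  | assign (a : ℕ) (i e : Expr) (s : State) :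
      Exec (.assign a i e) s (s.store a (i.eval s) (e.eval s)) (1 + i.cost s + e.cost s)
  | seq {c₁ c₂ : Cmd} {s s' s'' : State} {t₁ t₂ : ℕ} :
      Exec c₁ s s' t₁ → Exec c₂ s' s'' t₂ → Exec (.seq c₁ c₂) s s'' (t₁ + t₂)
  | ite_true {e : Expr} {c₁ c₂ : Cmd} {s s' : State} {t : ℕ} :
      e.eval s ≠ 0 → Exec c₁ s s' t → Exec (.ite e c₁ c₂) s s' (1 + e.cost s + t)
  | ite_false {e : Expr} {c₁ c₂ : Cmd} {s s' : State} {t : ℕ} :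
      e.eval s = 0 → Exec c₂ s s' t → Exec (.ite e c₁ c₂) s s' (1 + e.cost s + t)
  | loop_true {e : Expr} {c : Cmd} {s s' s'' : State} {t₁ t₂ : ℕ} :
      e.eval s ≠ 0 → Exec c s s' t₁ → Exec (.loop e c) s' s'' t₂ →
        Exec (.loop e c) s s'' (1 + e.cost s + t₁ + t₂)
  | loop_false {e : Expr} {c : Cmd} {s : State} :
      e.eval s = 0 → Exec (.loop e c) s s (1 + e.cost s)

/-- The initial memory on input `x`: the word `x` stands in array `0`, all other cells are `0`. -/
def initState (x : List ℕ) : State :=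
  fun a i => if a = 0 then x.getD i 0 else 0

/-- The bit length of a word of natural numbers (with one separator per entry). -/
def bitLength (x : List ℕ) : ℕ :=
  (x.map fun k => k.size + 1).sum

/-- On input `x`, the program `c` halts with total cost at most `t`, and then the word `y` stands
in array `1` (followed by zeros). -/
def OutputsWithin (c : Cmd) (x y : List ℕ) (t : ℕ) : Prop :=
  ∃ (s : State) (t' : ℕ), Exec c (initState x) s t' ∧ t' ≤ t ∧ ∀ i, s 1 i = y.getD i 0

end RAM

/-! ### Weighted graphs -/

/-- The weight `w(X)` of a vertex set. -/
def weight {V : Type*} (w : V → NNRat) (X : Finset V) : NNRat :=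
  ∑ v ∈ X, w v

/-- A feedback vertex set: deleting it leaves an acyclic graph. -/
def IsFeedbackVertexSet {V : Type*} (G : SimpleGraph V) (X : Set V) : Prop :=
  (G.induce Xᶜ).IsAcyclic

theorem isFeedbackVertexSet_univ {V : Type*} (G : SimpleGraph V) :
    IsFeedbackVertexSet G Set.univ :=
  fun v => absurd (Set.mem_univ v.1) v.2

open Classical in
/-- The minimum weight of a vertex cover. -/
noncomputable def optWVC {V : Type*} [Fintype V] (G : SimpleGraph V) (w : V → NNRat) : NNRat :=
  ({X : Finset V | G.IsVertexCover (X : Set V)} : Finset (Finset V)).inf'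
    ⟨Finset.univ, by simp⟩ (weight w)

open Classical in
/-- The minimum weight of a feedback vertex set. -/
noncomputable def optFVS {V : Type*} [Fintype V] (G : SimpleGraph V) (w : V → NNRat) : NNRat :=
  ({X : Finset V | IsFeedbackVertexSet G (X : Set V)} : Finset (Finset V)).inf'
    ⟨Finset.univ, by simpa using isFeedbackVertexSet_univ G⟩ (weight w)

open Classical in
/-- A weighted graph with vertices `0, …, n - 1` as a word: the number of vertices, the rows of the
adjacency matrix, the numerators of the weights and the denominators of the weights. -/
noncomputable def encodeWeightedGraph {n : ℕ} (G : SimpleGraph (Fin n)) (w : Fin n → NNRat) :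
    List ℕ :=
  [n] ++ (List.ofFn fun u : Fin n => List.ofFn fun v : Fin n => if G.Adj u v then 1 else 0).flatten
    ++ (List.ofFn fun v : Fin n => (w v).num) ++ (List.ofFn fun v : Fin n => (w v).den)

/-- A vertex set as a word: its characteristic vector. -/
def encodeVertexSet {n : ℕ} (X : Finset (Fin n)) : List ℕ :=
  List.ofFn fun v : Fin n => if v ∈ X then 1 else 0

/-! ### Step counts and logarithmic cost -/

namespace RAM

/-! The cover is obtained by rounding a half-integral optimum of the vertex cover relaxation. A
minimum weight vertex cover of the bipartite double cover of $G$ gives every vertex a value $0$,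
$1/2$ or $1$. Each edge receives total value at least $1$, and the fractional weight is at most
$\mathrm{OPT}_{\mathrm{WVC}}$, because a vertex cover of $G$ taken on both sides covers the double
cover (`le_two_mul_of_isCover`). Let $R$ be a vertex set inducing a forest whose complement weighs
at most $2\,\mathrm{OPT}_{\mathrm{FVS}}$, and colour it properly with two colours. Take the vertices
of value $1$, those of value $1/2$ outside $R$, and, among those of value $1/2$ in $R$, the lighter
colour class. An edge could be missed only between two equally coloured vertices of $R$
(`IsChosen.or`). Compared with the fractional weight, the lighter class costs nothing extra, and the
vertices outside $R$ cost at most half their weight, which is at most $\mathrm{OPT}_{\mathrm{FVS}}$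
(`two_mul_sum_isChosen_le`).

The forest comes from a local ratio $2$-approximation for feedback vertex sets in multigraphs.
Vertices of degree at most one are dropped, multiple edges are paid for by equal weights at both
ends, and adjacent vertices of degree two are contracted. When none of these applies, a multiple of
degree minus one is subtracted from the weights. For that weight every maximal forest has a
$2$-approximate complement, by counting edges (`IsForest.card_add_le_sum_degIn`,
`IsForest.sum_degIn_le_of_sdiff`). Undoing the removals in reverse order keeps a maximal forest with
the guarantee (`Step.isGood`).

The cover of the double cover is dual to a maximum flow, found by capacity scaling with unit
augmentations. Halving the unit raises the optimum by at most $2n$ above the doubled flow, so few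
augmentations are needed in each phase. Optimality is certified by the stamps of the last search
(`IsFlow.value_le`, `IsFlow.value_eq`).

For the running time, programs are first analysed by step counts (`Run`). Stored values may be
multiplied only by numbers bounded by an input entry. Each step therefore adds only polynomially
many bits, and a polynomial step count gives a polynomial logarithmic cost (`Steps.exec`). -/

instance (k : ℕ) : OfNat Expr k := ⟨.const k⟩
instance : Add Expr := ⟨.add⟩
instance : Sub Expr := ⟨.sub⟩
instance : Mul Expr := ⟨.mul⟩
instance : Div Expr := ⟨.div⟩

/-- The content of the first cell of an array. -/
def var (a : ℕ) : Expr := .read a (.const 0)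

infixr:60 " ;; " => Cmd.seq

namespace Expr

@[simp] theorem eval_const (s : State) (k : ℕ) : (const k).eval s = k := rfl
@[simp] theorem eval_zero (s : State) : (0 : Expr).eval s = 0 := rfl
@[simp] theorem eval_one (s : State) : (1 : Expr).eval s = 1 := rfl
@[simp] theorem eval_two (s : State) : (2 : Expr).eval s = 2 := rfl
@[simp] theorem eval_read (s : State) (a : ℕ) (e : Expr) : (read a e).eval s = s a (e.eval s) := rfl
@[simp] theorem eval_var (s : State) (a : ℕ) : (var a).eval s = s a 0 := rfl
@[simp] theorem eval_add (s : State) (x y : Expr) : (x + y).eval s = x.eval s + y.eval s := rfl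
@[simp] theorem eval_sub (s : State) (x y : Expr) : (x - y).eval s = x.eval s - y.eval s := rfl
@[simp] theorem eval_mul (s : State) (x y : Expr) : (x * y).eval s = x.eval s * y.eval s := rfl
@[simp] theorem eval_div (s : State) (x y : Expr) : (x / y).eval s = x.eval s / y.eval s := rfl

/-- A syntactic weight that bounds the growth of values and the cost of an evaluation. -/
def wt : Expr → ℕ
  | const k => k.size + 2
  | read _ e => e.wt + 2
  | add x y => x.wt + y.wt + 2
  | sub x y => x.wt + y.wt + 2
  | mul x y => x.wt + y.wt + 2
  | div x y => x.wt + y.wt + 2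

/-- Bit lengths add under multiplication and grow by at most one under addition. The bound serves
only to price evaluations, where arbitrary products are allowed. Iterated over a run it would be
exponential, since it multiplies `B`. -/
theorem eval_lt_of_forall_lt {s : State} {B : ℕ} (hs : ∀ a i, s a i < 2 ^ B) (e : Expr) :
    e.eval s < 2 ^ (e.wt * (B + 1)) := by
  have mono : ∀ {x m m' : ℕ}, x < 2 ^ m → m ≤ m' → x < 2 ^ m' := fun h h' =>
    h.trans_le (Nat.pow_le_pow_right (by norm_num) h')
  induction e with
  | const k => exact mono (Nat.lt_size_self k) (by simp only [wt]; nlinarith)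
  | read a e _ => exact mono (hs _ _) (by simp only [wt]; nlinarith)
  | add x y hx hy =>
    refine mono (m := x.wt * (B + 1) + y.wt * (B + 1) + 1) ?_ (by simp only [wt]; nlinarith)
    have h1 := mono (m' := x.wt * (B + 1) + y.wt * (B + 1)) hx (by omega)
    have h2 := mono (m' := x.wt * (B + 1) + y.wt * (B + 1)) hy (by omega)
    simp only [eval]; rw [pow_succ]; omega
  | sub x y hx hy =>
    exact (Nat.sub_le _ _).trans_lt (mono hx (by simp only [wt]; nlinarith))
  | mul x y hx hy =>
    refine mono (m := x.wt * (B + 1) + y.wt * (B + 1)) ?_ (by simp only [wt]; nlinarith)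
    rw [pow_add]; exact Nat.mul_lt_mul'' hx hy
  | div x y hx hy =>
    exact (Nat.div_le_self _ _).trans_lt (mono hx (by simp only [wt]; nlinarith))

theorem cost_le_of_forall_lt {s : State} {B : ℕ} (hs : ∀ a i, s a i < 2 ^ B) (e : Expr) {M : ℕ}
    (hM : e.wt * (B + 1) ≤ M) : e.cost s ≤ e.wt * (1 + M) := by
  have key : ∀ e : Expr, e.wt * (B + 1) ≤ M → (e.eval s).size ≤ M := fun e he =>
    (Nat.size_le.2 (eval_lt_of_forall_lt hs e)).trans he
  induction e with
  | const k => simp only [cost, wt] at *; nlinarith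
  | read a e h =>
    have h1 := key _ hM
    simp only [cost, wt] at *
    have := h (by nlinarith)
    nlinarith
  | add x y hx hy | sub x y hx hy | mul x y hx hy | div x y hx hy =>
    have h1 := key _ hM
    simp only [cost, wt] at *
    have := hx (by nlinarith)
    have := hy (by nlinarith)
    nlinarith

/-- Expressions whose value never exceeds some entry of the input array `0`. -/
def inputBounded : Expr → Bool
  | read 0 _ => true
  | sub x _ => x.inputBounded
  | _ => false

/-- Expressions whose value has at most a bounded number of bits more than the largest number in
memory and the largest number in the input. -/
def tame : Expr → Bool
  | const _ => true
  | read _ _ => true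
  | add x y => x.tame && y.tame
  | sub x _ => x.tame
  | mul x y => x.tame && y.inputBounded
  | div x _ => x.tame

theorem eval_lt_of_inputBounded {s : State} {L : ℕ} (hs : ∀ i, s 0 i < 2 ^ L) :
    ∀ e : Expr, e.inputBounded = true → e.eval s < 2 ^ L
  | read 0 e, _ => hs _
  | sub x _, h => (Nat.sub_le _ _).trans_lt
      (eval_lt_of_inputBounded hs x (by simpa [inputBounded] using h))

/-- One factor of every product is bounded by an input entry and adds at most `L` bits, so the bound
is additive in `B`. This additivity keeps numbers of polynomial length over polynomially many steps.
-/
theorem eval_lt_of_tame {s : State} {B L : ℕ} (hs : ∀ a i, s a i < 2 ^ B)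
    (h0 : ∀ i, s 0 i < 2 ^ L) (e : Expr) (he : e.tame = true) :
    e.eval s < 2 ^ (B + e.wt * (L + 1)) := by
  have mono : ∀ {x m m' : ℕ}, x < 2 ^ m → m ≤ m' → x < 2 ^ m' := fun h h' =>
    h.trans_le (Nat.pow_le_pow_right (by norm_num) h')
  induction e with
  | const k => exact mono (Nat.lt_size_self k) (by simp only [wt]; nlinarith)
  | read a e _ => exact mono (hs _ _) (by simp only [wt]; nlinarith)
  | add x y hx hy =>
    simp only [tame, Bool.and_eq_true] at he
    refine mono (m := B + x.wt * (L + 1) + y.wt * (L + 1) + 1) ?_ (by simp only [wt]; nlinarith)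
    have h1 := mono (m' := B + x.wt * (L + 1) + y.wt * (L + 1)) (hx he.1) (by omega)
    have h2 := mono (m' := B + x.wt * (L + 1) + y.wt * (L + 1)) (hy he.2) (by omega)
    simp only [eval]; rw [pow_succ]; omega
  | sub x y hx hy =>
    exact (Nat.sub_le _ _).trans_lt (mono (hx he) (by simp only [wt]; nlinarith))
  | mul x y hx hy =>
    simp only [tame, Bool.and_eq_true] at he
    refine mono (m := B + x.wt * (L + 1) + L) ?_ (by simp only [wt]; nlinarith)
    rw [pow_add]
    exact Nat.mul_lt_mul'' (hx he.1) (eval_lt_of_inputBounded h0 y he.2)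
  | div x y hx hy =>
    exact (Nat.div_le_self _ _).trans_lt (mono (hx he) (by simp only [wt]; nlinarith))

end Expr

namespace Cmd

/-- The array `b` is a target of an assignment in the program. -/
def writes : Cmd → ℕ → Bool
  | skip, _ => false
  | assign a _ _, b => a == b
  | seq c₁ c₂, b => c₁.writes b || c₂.writes b
  | ite _ c₁ c₂, b => c₁.writes b || c₂.writes b
  | loop _ c, b => c.writes b

/-- All stored values are tame and the input array is never written. -/
def tame : Cmd → Bool
  | skip => true
  | assign a _ e => a != 0 && e.tame
  | seq c₁ c₂ => c₁.tame && c₂.tame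
  | ite _ c₁ c₂ => c₁.tame && c₂.tame
  | loop _ c => c.tame

/-- The sum of the weights of the expressions of a program. -/
def wt : Cmd → ℕ
  | skip => 1
  | assign _ i e => i.wt + e.wt + 1
  | seq c₁ c₂ => c₁.wt + c₂.wt
  | ite e c₁ c₂ => e.wt + c₁.wt + c₂.wt + 1
  | loop e c => e.wt + c.wt + 1

/-- The exponent of the step bound when every loop makes at most `b ^ 3` iterations. -/
def deg : Cmd → ℕ
  | skip => 0
  | assign _ _ _ => 0
  | seq c₁ c₂ => max c₁.deg c₂.deg + 1
  | ite _ c₁ c₂ => max c₁.deg c₂.deg + 1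
  | loop _ c => c.deg + 5

end Cmd

/-- `Steps c s s' t`: the program `c` leads from `s` to `s'` in `t` elementary steps. -/
inductive Steps : Cmd → State → State → ℕ → Prop
  | skip (s : State) : Steps .skip s s 1
  | assign (a : ℕ) (i e : Expr) (s : State) :
      Steps (.assign a i e) s (s.store a (i.eval s) (e.eval s)) 1
  | seq {c₁ c₂ : Cmd} {s s' s'' : State} {t₁ t₂ : ℕ} :
      Steps c₁ s s' t₁ → Steps c₂ s' s'' t₂ → Steps (.seq c₁ c₂) s s'' (t₁ + t₂)
  | ite_true {e : Expr} {c₁ c₂ : Cmd} {s s' : State} {t : ℕ} :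
      e.eval s ≠ 0 → Steps c₁ s s' t → Steps (.ite e c₁ c₂) s s' (1 + t)
  | ite_false {e : Expr} {c₁ c₂ : Cmd} {s s' : State} {t : ℕ} :
      e.eval s = 0 → Steps c₂ s s' t → Steps (.ite e c₁ c₂) s s' (1 + t)
  | loop_true {e : Expr} {c : Cmd} {s s' s'' : State} {t₁ t₂ : ℕ} :
      e.eval s ≠ 0 → Steps c s s' t₁ → Steps (.loop e c) s' s'' t₂ →
        Steps (.loop e c) s s'' (1 + t₁ + t₂)
  | loop_false {e : Expr} {c : Cmd} {s : State} :
      e.eval s = 0 → Steps (.loop e c) s s 1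

@[simp] theorem State.store_ne (s : State) {a b : ℕ} (i v : ℕ) (h : b ≠ a) :
    s.store a i v b = s b := by
  simp [State.store, h]

@[simp] theorem State.store_self (s : State) (a i v j : ℕ) :
    s.store a i v a j = if j = i then v else s a j := by
  simp [State.store, Function.update_apply]

theorem Steps.frame {c : Cmd} {s s' : State} {t : ℕ} (h : Steps c s s' t) {a : ℕ}
    (ha : c.writes a = false) : s' a = s a := by
  induction h with
  | skip s => rfl
  | assign b i e s =>
    have : a ≠ b := by rintro rfl; simp [Cmd.writes] at ha
    simp [this]
  | seq _ _ h₁ h₂ =>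
    simp only [Cmd.writes, Bool.or_eq_false_iff] at ha
    rw [h₂ ha.2, h₁ ha.1]
  | ite_true _ _ h₁ =>
    simp only [Cmd.writes, Bool.or_eq_false_iff] at ha
    exact h₁ ha.1
  | ite_false _ _ h₁ =>
    simp only [Cmd.writes, Bool.or_eq_false_iff] at ha
    exact h₁ ha.2
  | loop_true _ _ _ h₁ h₂ => rw [h₂ ha, h₁ ha]
  | loop_false _ => rfl

/-- The cost of a run of a tame program is polynomial in its number of steps. -/
theorem Steps.exec {c : Cmd} {s s' : State} {T : ℕ} (h : Steps c s s' T) {B L W : ℕ}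
    (hs : ∀ a i, s a i < 2 ^ B) (h0 : ∀ i, s 0 i < 2 ^ L) (hc : c.tame = true) (hW : c.wt ≤ W)
    {M : ℕ} (hM : B + T * (W * (L + 1)) ≤ M) :
    (∃ t, Exec c s s' t ∧ t ≤ T * (W * (2 + W * (M + 1)))) ∧
      (∀ a i, s' a i < 2 ^ (B + T * (W * (L + 1)))) ∧ ∀ i, s' 0 i < 2 ^ L := by
  have mono : ∀ {x m m' : ℕ}, x < 2 ^ m → m ≤ m' → x < 2 ^ m' := fun h h' =>
    h.trans_le (Nat.pow_le_pow_right (by norm_num) h')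
  -- `M` dominates the bit length of the memory at every moment of the run, so a single price covers
  -- all evaluations.
  have ecost : ∀ {s : State} {B : ℕ}, (∀ a i, s a i < 2 ^ B) → B ≤ M → ∀ e : Expr, e.wt ≤ W →
      e.cost s ≤ e.wt * (1 + W * (M + 1)) := fun hs hB e he =>
    Expr.cost_le_of_forall_lt hs e (Nat.mul_le_mul he (by omega))
  induction h generalizing B with
  | skip s =>
    simp only [Cmd.wt] at hW
    refine ⟨⟨1, .skip s, ?_⟩, fun a i => mono (hs a i) (by omega), h0⟩
    nlinarith [Nat.zero_le (W * (M + 1)), Nat.zero_le (W * (W * (M + 1)))]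
  | assign a i e s =>
    simp only [Cmd.wt] at hW
    simp only [Cmd.tame, Bool.and_eq_true, bne_iff_ne, ne_eq] at hc
    refine ⟨⟨_, .assign a i e s, ?_⟩, ?_, ?_⟩
    · have h1 := ecost hs (by omega) i (by omega)
      have h2 := ecost hs (by omega) e (by omega)
      have h3 := Nat.mul_le_mul_right (1 + W * (M + 1)) (show i.wt + e.wt + 1 ≤ W from hW)
      nlinarith
    · intro b j
      by_cases hb : b = a
      · subst hb
        rw [State.store_self]
        split_ifs
        · exact mono (Expr.eval_lt_of_tame hs h0 e hc.2) (by
            have := Nat.mul_le_mul_right (L + 1) (show e.wt ≤ W by omega)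
            omega)
        · exact mono (hs _ _) (by omega)
      · rw [State.store_ne _ _ _ hb]; exact mono (hs _ _) (by omega)
    · rw [State.store_ne _ _ _ (Ne.symm hc.1)]; exact h0
  | @seq c₁ c₂ s s' s'' t₁ t₂ _ _ ih₁ ih₂ =>
    simp only [Cmd.wt] at hW
    simp only [Cmd.tame, Bool.and_eq_true] at hc
    rw [add_mul] at hM
    obtain ⟨⟨u₁, e₁, l₁⟩, b₁, z₁⟩ := ih₁ hs h0 hc.1 (by omega) (by omega)
    obtain ⟨⟨u₂, e₂, l₂⟩, b₂, z₂⟩ := ih₂ b₁ z₁ hc.2 (by omega) (by omega)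
    refine ⟨⟨_, .seq e₁ e₂, ?_⟩, fun a i => mono (b₂ a i) (by nlinarith), z₂⟩
    rw [add_mul]; omega
  | @ite_true e c₁ c₂ s s' t he _ ih₁ =>
    simp only [Cmd.wt] at hW
    simp only [Cmd.tame, Bool.and_eq_true] at hc
    obtain ⟨⟨u₁, e₁, l₁⟩, b₁, z₁⟩ := ih₁ hs h0 hc.1 (by omega) (by nlinarith)
    refine ⟨⟨_, .ite_true he e₁, ?_⟩, fun a i => mono (b₁ a i) (by nlinarith), z₁⟩
    have h1 := ecost hs (by omega) e (by omega)
    have h3 := Nat.mul_le_mul_right (1 + W * (M + 1)) (show e.wt + 1 ≤ W by omega)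
    nlinarith
  | @ite_false e c₁ c₂ s s' t he _ ih₁ =>
    simp only [Cmd.wt] at hW
    simp only [Cmd.tame, Bool.and_eq_true] at hc
    obtain ⟨⟨u₁, e₁, l₁⟩, b₁, z₁⟩ := ih₁ hs h0 hc.2 (by omega) (by nlinarith)
    refine ⟨⟨_, .ite_false he e₁, ?_⟩, fun a i => mono (b₁ a i) (by nlinarith), z₁⟩
    have h1 := ecost hs (by omega) e (by omega)
    have h3 := Nat.mul_le_mul_right (1 + W * (M + 1)) (show e.wt + 1 ≤ W by omega)
    nlinarith
  | @loop_true e c s s' s'' t₁ t₂ he _ _ ih₁ ih₂ =>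
    have hW' := hW
    simp only [Cmd.wt] at hW
    rw [add_mul, add_mul] at hM
    obtain ⟨⟨u₁, e₁, l₁⟩, b₁, z₁⟩ := ih₁ hs h0 hc (by omega) (by omega)
    obtain ⟨⟨u₂, e₂, l₂⟩, b₂, z₂⟩ := ih₂ b₁ z₁ hc hW' (by omega)
    refine ⟨⟨_, .loop_true he e₁ e₂, ?_⟩, fun a i => mono (b₂ a i) (by nlinarith), z₂⟩
    have h1 := ecost hs (by omega) e (by omega)
    have h3 := Nat.mul_le_mul_right (1 + W * (M + 1)) (show e.wt + 1 ≤ W by omega)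
    nlinarith
  | @loop_false e c s he =>
    simp only [Cmd.wt] at hW
    refine ⟨⟨_, .loop_false he, ?_⟩, fun a i => mono (hs a i) (by omega), h0⟩
    have h1 := ecost hs (by omega) e (by omega)
    have h3 := Nat.mul_le_mul_right (1 + W * (M + 1)) (show e.wt + 1 ≤ W by omega)
    nlinarith

/-! ### A program logic for total correctness in polynomially many steps -/

/-- Started in `s`, the program `c` halts after at most `b ^ c.deg` steps in a memory that
satisfies `Q`. -/
def Run (b : ℕ) (c : Cmd) (s : State) (Q : State → Prop) : Prop :=
  ∃ s' t, Steps c s s' t ∧ t ≤ b ^ c.deg ∧ Q s'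

/-- The memories `s` and `s'` agree on the arrays that `c` does not write. -/
def Frame (c : Cmd) (s s' : State) : Prop := ∀ a, c.writes a = false → s' a = s a

variable {b : ℕ} {c c₁ c₂ : Cmd} {s : State} {Q P : State → Prop}

theorem Run.conseq (h : Run b c s P) (hQ : ∀ s', P s' → Frame c s s' → Q s') : Run b c s Q := by
  obtain ⟨s', t, h, ht, hP⟩ := h
  exact ⟨s', t, h, ht, hQ s' hP fun a => h.frame⟩

theorem Run.skip (h : Q s) : Run b .skip s Q := ⟨s, 1, .skip s, by simp [Cmd.deg], h⟩

theorem Run.assign {a : ℕ} {i e : Expr} (h : Q (s.store a (i.eval s) (e.eval s))) :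
    Run b (.assign a i e) s Q :=
  ⟨_, 1, .assign a i e s, by simp [Cmd.deg], h⟩

theorem Run.seq (hb : 2 ≤ b) (h₁ : Run b c₁ s P)
    (h₂ : ∀ s', P s' → Frame c₁ s s' → Run b c₂ s' Q) : Run b (c₁ ;; c₂) s Q := by
  obtain ⟨s', t, h, ht, hP⟩ := h₁
  obtain ⟨s'', t', h', ht', hQ⟩ := h₂ s' hP fun a => h.frame
  refine ⟨s'', _, .seq h h', ?_, hQ⟩
  have e1 := Nat.pow_le_pow_right (show 0 < b by omega) (le_max_left c₁.deg c₂.deg)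
  have e2 := Nat.pow_le_pow_right (show 0 < b by omega) (le_max_right c₁.deg c₂.deg)
  simp only [Cmd.deg, pow_succ]
  nlinarith

theorem Run.seq_assign (hb : 2 ≤ b) {a : ℕ} {i e : Expr}
    (h : Run b c (s.store a (i.eval s) (e.eval s)) Q) : Run b (.assign a i e ;; c) s Q :=
  Run.seq hb (P := fun s' => s' = s.store a (i.eval s) (e.eval s)) (Run.assign rfl)
    (by rintro _ rfl _; exact h)

theorem Run.ite (hb : 2 ≤ b) {e : Expr} (h₁ : e.eval s ≠ 0 → Run b c₁ s Q)
    (h₂ : e.eval s = 0 → Run b c₂ s Q) : Run b (.ite e c₁ c₂) s Q := by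
  have e1 := Nat.pow_le_pow_right (show 0 < b by omega) (le_max_left c₁.deg c₂.deg)
  have e2 := Nat.pow_le_pow_right (show 0 < b by omega) (le_max_right c₁.deg c₂.deg)
  have e3 : 0 < b ^ max c₁.deg c₂.deg := Nat.pow_pos (by omega)
  by_cases he : e.eval s = 0
  · obtain ⟨s', t, h, ht, hP⟩ := h₂ he
    refine ⟨s', _, .ite_false he h, ?_, hP⟩
    simp only [Cmd.deg, pow_succ]
    nlinarith
  · obtain ⟨s', t, h, ht, hP⟩ := h₁ he
    refine ⟨s', _, .ite_true he h, ?_, hP⟩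
    simp only [Cmd.deg, pow_succ]
    nlinarith

/-- The variant `μ` allows at most `b ^ 3` iterations of at most `b ^ c.deg` steps each. The
remaining factor `b ^ 2 ≥ 4` of `b ^ (c.deg + 5)` absorbs the tests and the exit. -/
theorem Run.loop (hb : 2 ≤ b) {e : Expr} (I : State → Prop) (μ : State → ℕ) (h0 : I s)
    (hμ : μ s ≤ b ^ 3)
    (hbody : ∀ s', I s' → e.eval s' ≠ 0 → Frame c s s' →
      Run b c s' fun s'' => I s'' ∧ μ s'' < μ s')
    (hQ : ∀ s', I s' → e.eval s' = 0 → Frame c s s' → Q s') : Run b (.loop e c) s Q := by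
  have key : ∀ m s', μ s' ≤ m → I s' → Frame c s s' →
      ∃ s'' t, Steps (.loop e c) s' s'' t ∧ t ≤ m * (1 + b ^ c.deg) + 1 ∧ Q s'' := by
    intro m
    induction m with
    | zero =>
      intro s' hm hI hF
      by_cases he : e.eval s' = 0
      · exact ⟨s', 1, .loop_false he, by simp, hQ s' hI he hF⟩
      · obtain ⟨s'', t, h, ht, hI', hlt⟩ := hbody s' hI he hF
        omega
    | succ m ih =>
      intro s' hm hI hF
      by_cases he : e.eval s' = 0
      · exact ⟨s', 1, .loop_false he, by simp, hQ s' hI he hF⟩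
      · obtain ⟨s'', t, h, ht, hI', hlt⟩ := hbody s' hI he hF
        obtain ⟨s₃, t', h', ht', hQ'⟩ := ih s'' (by omega) hI'
          (fun a ha => (h.frame ha).trans (hF a ha))
        exact ⟨s₃, _, .loop_true he h h', by nlinarith, hQ'⟩
  obtain ⟨s', t, h, ht, hQ'⟩ := key _ s le_rfl h0 fun _ _ => rfl
  refine ⟨s', t, h, ?_, hQ'⟩
  have e1 : 0 < b ^ c.deg := Nat.pow_pos (by omega)
  have e2 : 0 < b ^ 3 := Nat.pow_pos (by omega)
  have e3 : μ s * (1 + b ^ c.deg) ≤ b ^ 3 * (2 * b ^ c.deg) :=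
    Nat.mul_le_mul hμ (by omega)
  have e4 : b ^ (c.deg + 5) = b ^ 3 * b ^ c.deg * (b * b) := by ring
  have e5 : 4 ≤ b * b := by nlinarith
  have e6 : 0 < b ^ 3 * b ^ c.deg := Nat.mul_pos e2 e1
  simp only [Cmd.deg, e4]
  nlinarith

/-- `for iv < N do c`. -/
def forC (iv : ℕ) (N : Expr) (c : Cmd) : Cmd :=
  .assign iv 0 0 ;; .loop (N - var iv) (c ;; .assign iv 0 (var iv + 1))

/-- The counter is increased after the body, so the invariant for `k + 1` is required of every
memory that differs from the result of the body only in the counter array. The limit is evaluated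
anew in every round and may therefore depend only on the input array. -/
theorem Run.forC (hb : 2 ≤ b) {iv n : ℕ} {N : Expr} (I : ℕ → State → Prop)
    (hiv : c.writes iv = false) (hn : n ≤ b ^ 3)
    (hN : ∀ s', s' 0 = s 0 → N.eval s' = n) (hc : c.writes 0 = false) (hiv0 : iv ≠ 0)
    (h0 : ∀ s', s' iv 0 = 0 → (∀ a ≠ iv, s' a = s a) → I 0 s')
    (hstep : ∀ k < n, ∀ s', s' iv 0 = k → (∀ a ≠ iv, c.writes a = false → s' a = s a) → I k s' →
      Run b c s' fun s'' => ∀ s₃, s₃ iv 0 = k + 1 → (∀ a ≠ iv, s₃ a = s'' a) → I (k + 1) s₃)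
    (hQ : ∀ s', (∀ a ≠ iv, c.writes a = false → s' a = s a) → I n s' → Q s') :
    Run b (forC iv N c) s Q := by
  refine Run.seq_assign hb ?_
  set s₁ := s.store iv ((0 : Expr).eval s) ((0 : Expr).eval s) with hs₁
  have hs₁0 : s₁ iv 0 = 0 := by simp [hs₁]
  have hs₁a : ∀ a ≠ iv, s₁ a = s a := fun a ha => by simp [hs₁, ha]
  have hF : ∀ s', Frame (c ;; Cmd.assign iv 0 (var iv + 1)) s₁ s' →
      ∀ a ≠ iv, c.writes a = false → s' a = s a := fun s' h a ha hca =>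
    (h a (by simp [Cmd.writes, hca, Ne.symm ha])).trans (hs₁a a ha)
  refine Run.loop hb (fun s' => s' iv 0 ≤ n ∧ I (s' iv 0) s') (fun s' => n - s' iv 0)
    ⟨by omega, by rw [hs₁0]; exact h0 s₁ hs₁0 hs₁a⟩ (by omega) ?_ ?_
  · rintro s' ⟨hle, hI⟩ he hF'
    have hagree := hF s' hF'
    have hNn : N.eval s' = n := hN s' (hagree 0 (Ne.symm hiv0) hc)
    simp only [Expr.eval_sub, Expr.eval_var, hNn] at he
    refine Run.seq hb (hstep (s' iv 0) (by omega) s' rfl hagree hI) fun s'' h'' hF'' => ?_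
    have hiv'' : s'' iv 0 = s' iv 0 := by rw [hF'' iv hiv]
    refine Run.assign ?_
    simp only [Expr.eval_add, Expr.eval_var, Expr.eval_zero, Expr.eval_one, State.store_self, if_true, hiv'']
    refine ⟨⟨by omega, h'' _ (by simp) fun a ha => by simp [ha]⟩, by omega⟩
  · rintro s' ⟨hle, hI⟩ he hF'
    have hagree := hF s' hF'
    have hNn : N.eval s' = n := hN s' (hagree 0 (Ne.symm hiv0) hc)
    simp only [Expr.eval_sub, Expr.eval_var, hNn] at he
    have : s' iv 0 = n := by omega
    exact hQ s' hagree (this ▸ hI)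

/-- `x := ∑ iv < N, e`. -/
def sumC (x iv : ℕ) (N e : Expr) : Cmd :=
  .assign x 0 0 ;; forC iv N (.assign x 0 (var x + e))

theorem Run.sumC (hb : 2 ≤ b) {x iv n : ℕ} {N e : Expr} (f : ℕ → ℕ) (hx : x ≠ 0) (hiv : iv ≠ 0)
    (hxi : x ≠ iv) (hn : n ≤ b ^ 3) (hN : ∀ s', s' 0 = s 0 → N.eval s' = n)
    (he : ∀ k < n, ∀ s', s' iv 0 = k → (∀ a, a ≠ x → a ≠ iv → s' a = s a) → e.eval s' = f k)
    (hQ : ∀ s', (∀ a, a ≠ x → a ≠ iv → s' a = s a) → s' x 0 = ∑ k ∈ Finset.range n, f k → Q s') :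
    Run b (sumC x iv N e) s Q := by
  refine Run.seq_assign hb ?_
  refine Run.forC hb (n := n) (fun k s' => s' x 0 = ∑ j ∈ Finset.range k, f j)
    (by simpa [Cmd.writes] using hxi) hn (fun s' h => hN s' (by rw [h]; simp [Ne.symm hx]))
    (by simpa [Cmd.writes] using hx) hiv ?_ ?_ ?_
  · intro s' _ h
    rw [h x hxi]; simp
  · intro k hk s' hk' hF hI
    refine Run.assign fun s₃ _ h => ?_
    rw [h x hxi]
    have hs' : ∀ a, a ≠ x → a ≠ iv → s' a = s a := fun a ha ha' => by
      rw [hF a ha' (by simpa [Cmd.writes] using Ne.symm ha)]; simp [ha]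
    simp [hI, he k hk s' hk' hs', Finset.sum_range_succ]
  · intro s' hF hI
    refine hQ s' (fun a ha ha' => ?_) hI
    rw [hF a ha' (by simpa [Cmd.writes] using Ne.symm ha)]; simp [ha]

/-- `r` becomes `iv + 1` for the last `iv < N` with `e ≠ 0`, and `0` if there is none. -/
def findC (r iv : ℕ) (N e : Expr) : Cmd :=
  .assign r 0 0 ;; forC iv N (.ite e (.assign r 0 (var iv + 1)) .skip)

theorem Run.findC (hb : 2 ≤ b) {r iv n : ℕ} {N e : Expr} (p : ℕ → Prop) (hr : r ≠ 0)
    (hiv : iv ≠ 0) (hri : r ≠ iv) (hn : n ≤ b ^ 3) (hN : ∀ s', s' 0 = s 0 → N.eval s' = n)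
    (he : ∀ k < n, ∀ s', s' iv 0 = k → (∀ a, a ≠ r → a ≠ iv → s' a = s a) →
      (e.eval s' ≠ 0 ↔ p k))
    (hQ : ∀ s', (∀ a, a ≠ r → a ≠ iv → s' a = s a) →
      ((s' r 0 = 0 ∧ ∀ k < n, ¬ p k) ∨ ∃ k < n, s' r 0 = k + 1 ∧ p k) → Q s') :
    Run b (findC r iv N e) s Q := by
  refine Run.seq_assign hb ?_
  have hw : ∀ a, (Cmd.ite e (.assign r 0 (var iv + 1)) .skip).writes a = (r == a) := by
    simp [Cmd.writes]
  refine Run.forC hb (n := n)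
    (fun k s' => (s' r 0 = 0 ∧ ∀ j < k, ¬ p j) ∨ ∃ j < k, s' r 0 = j + 1 ∧ p j)
    (by simpa [hw] using hri) hn (fun s' h => hN s' (by rw [h]; simp [Ne.symm hr]))
    (by simpa [hw] using hr) hiv ?_ ?_ ?_
  · intro s' _ h
    left
    rw [h r hri]; simp
  · intro k hk s' hk' hF hI
    have hs' : ∀ a, a ≠ r → a ≠ iv → s' a = s a := fun a ha ha' => by
      rw [hF a ha' (by simpa [hw] using Ne.symm ha)]; simp [ha]
    refine Run.ite hb (fun h1 => Run.assign ?_) (fun h1 => Run.skip ?_)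
    · intro s₃ _ h
      right
      rw [h r hri]
      exact ⟨k, by omega, by simp [hk'], (he k hk s' hk' hs').1 h1⟩
    · intro s₃ _ h
      rw [h r hri]
      have hk2 : ¬ p k := fun hp => (he k hk s' hk' hs').2 hp h1
      rcases hI with ⟨h2, h3⟩ | ⟨j, hj, h2⟩
      · refine .inl ⟨h2, fun j hj => ?_⟩
        rcases Nat.lt_succ_iff_lt_or_eq.1 hj with h | rfl
        · exact h3 j h
        · exact hk2
      · exact .inr ⟨j, by omega, h2⟩
  · intro s' hF hI
    refine hQ s' (fun a ha ha' => ?_) hI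
    rw [hF a ha' (by simpa [hw] using Ne.symm ha)]; simp [ha]

/-- `dst[o + iv] := e` for all `iv < N`. -/
def tabC (dst iv : ℕ) (o N e : Expr) : Cmd :=
  forC iv N (.assign dst (o + var iv) e)

/-- In round `k` the cells of `dst` before `o'` and from `o' + k` on still have their old content.
This permits updates in place and copies from an earlier block of the same array. -/
theorem Run.tabC (hb : 2 ≤ b) {dst iv n o' : ℕ} {o N e : Expr} (f : ℕ → ℕ) (hd : dst ≠ 0)
    (hiv : iv ≠ 0) (hdi : dst ≠ iv) (hn : n ≤ b ^ 3) (hN : ∀ s', s' 0 = s 0 → N.eval s' = n)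
    (ho : ∀ s', (∀ a, a ≠ dst → a ≠ iv → s' a = s a) → o.eval s' = o')
    (he : ∀ k < n, ∀ s', s' iv 0 = k → (∀ a, a ≠ dst → a ≠ iv → s' a = s a) →
      (∀ i, (i < o' ∨ o' + k ≤ i) → s' dst i = s dst i) → e.eval s' = f k)
    (hQ : ∀ s', (∀ a, a ≠ dst → a ≠ iv → s' a = s a) → (∀ k < n, s' dst (o' + k) = f k) →
      (∀ i, (i < o' ∨ o' + n ≤ i) → s' dst i = s dst i) → Q s') :
    Run b (tabC dst iv o N e) s Q := by
  refine Run.forC hb (n := n)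
    (fun k s' => (∀ j < k, s' dst (o' + j) = f j) ∧
      ∀ i, (i < o' ∨ o' + k ≤ i) → s' dst i = s dst i)
    (by simpa [Cmd.writes] using hdi) hn hN
    (by simpa [Cmd.writes] using hd) hiv ?_ ?_ ?_
  · intro s' _ h
    rw [h dst hdi]; simp
  · intro k hk s' hk' hF hI
    have hs' : ∀ a, a ≠ dst → a ≠ iv → s' a = s a := fun a ha ha' =>
      hF a ha' (by simpa [Cmd.writes] using Ne.symm ha)
    refine Run.assign fun s₃ _ h => ?_
    rw [h dst hdi]
    simp only [State.store_self, Expr.eval_add, Expr.eval_var, ho s' hs', hk',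
      he k hk s' hk' hs' hI.2]
    refine ⟨fun j hj => ?_, fun i hi => ?_⟩
    · rcases Nat.lt_succ_iff_lt_or_eq.1 hj with h | rfl
      · rw [if_neg (by omega)]; exact hI.1 j h
      · simp
    · rw [if_neg (by omega)]; exact hI.2 i (by omega)
  · intro s' hF hI
    exact hQ s' (fun a ha ha' => hF a ha' (by simpa [Cmd.writes] using Ne.symm ha)) hI.1 hI.2

/-- `dst[iv] := ∑ jv < N, e` for all `iv < N`, with accumulator `x`. -/
def tabSumC (dst x iv jv : ℕ) (N e : Expr) : Cmd :=
  forC iv N (sumC x jv N e ;; .assign dst (var iv) (var x))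

theorem Run.tabSumC (hb : 2 ≤ b) {dst x iv jv n : ℕ} {N e : Expr} (f : ℕ → ℕ → ℕ)
    (hne : [0, dst, x, iv, jv].Nodup) (hn : n ≤ b ^ 3)
    (hN : ∀ s', s' 0 = s 0 → N.eval s' = n)
    (he : ∀ k < n, ∀ j < n, ∀ s', s' iv 0 = k → s' jv 0 = j →
      (∀ a, a ≠ dst → a ≠ x → a ≠ iv → a ≠ jv → s' a = s a) → e.eval s' = f k j)
    (hQ : ∀ s', (∀ a, a ≠ dst → a ≠ x → a ≠ iv → a ≠ jv → s' a = s a) →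
      (∀ k < n, s' dst k = ∑ j ∈ Finset.range n, f k j) →
      (∀ i, n ≤ i → s' dst i = s dst i) → Q s') :
    Run b (tabSumC dst x iv jv N e) s Q := by
  simp only [List.nodup_cons, List.mem_cons, List.not_mem_nil, not_or, or_false] at hne
  obtain ⟨⟨n1, n2, n3, n4⟩, ⟨n5, n6, n7⟩, ⟨n8, n9⟩, n10, -⟩ := hne
  have hw : ∀ a, (RAM.sumC x jv N e ;; .assign dst (var iv) (var x)).writes a =
      (x == a || (jv == a || x == a || jv == a) || dst == a) := by
    intro a
    simp [Cmd.writes, RAM.sumC, RAM.forC]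
    grind
  refine Run.forC hb (n := n)
    (fun k s' => (∀ i < k, s' dst i = ∑ j ∈ Finset.range n, f i j) ∧
      (∀ i, k ≤ i → s' dst i = s dst i))
    (by rw [hw]; grind) hn hN (by rw [hw]; grind) (by grind) ?_ ?_ ?_
  · intro s' _ h
    rw [h dst (by grind)]; simp
  · intro k hk s' hk' hF hI
    have hs' : ∀ a, a ≠ dst → a ≠ x → a ≠ iv → a ≠ jv → s' a = s a := fun a h1 h2 h3 h4 =>
      hF a h3 (by rw [hw]; grind)
    refine Run.seq hb (P := fun s'' => s'' x 0 = ∑ j ∈ Finset.range n, f k j ∧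
      ∀ a, a ≠ x → a ≠ jv → s'' a = s' a) ?_ ?_
    · refine Run.sumC hb (n := n) (f k) (by grind) (by grind) (by grind) hn
        (fun s'' h => hN s'' (h.trans (hs' 0 (by grind) (by grind) (by grind) (by grind)))) ?_ ?_
      · intro j hj s'' hj' h
        refine he k hk j hj s'' (by rw [h iv (by grind) (by grind), hk']) hj' fun a h1 h2 h3 h4 => ?_
        rw [h a h2 h4, hs' a h1 h2 h3 h4]
      · intro s'' h h'
        exact ⟨h', h⟩
    · rintro s'' ⟨hx, hs''⟩ -
      refine Run.assign fun s₃ _ h => ?_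
      rw [h dst (by grind)]
      simp only [State.store_self, Expr.eval_var, hx, hs'' iv (by grind) (by grind), hk']
      rw [hs'' dst (by grind) (by grind)]
      refine ⟨fun i hi => ?_, fun i hi => ?_⟩
      · split_ifs with h
        · rw [h]
        · exact hI.1 i (by omega)
      · rw [if_neg (by omega)]; exact hI.2 i (by omega)
  · intro s' hF hI
    exact hQ s' (fun a h1 h2 h3 h4 => hF a h3 (by rw [hw]; grind)) hI.1 hI.2

end RAM

/-! ### Forests in multigraphs -/

namespace FVS

open Finset

variable {V : Type*}

/-- The number of edges from `p` to `U` in the multigraph with adjacency matrix `A`. -/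
def degIn (A : V → V → ℕ) (U : Finset V) (p : V) : ℕ := ∑ q ∈ U, A p q

/-- Every nonempty subset of `R` has a vertex of degree at most one. -/
def IsForest (A : V → V → ℕ) (R : Finset V) : Prop :=
  ∀ U ⊆ R, U.Nonempty → ∃ p ∈ U, degIn A U p ≤ 1

variable {A A' : V → V → ℕ} {R S U : Finset V} {u v y : V}

theorem degIn_mono (h : U ⊆ R) (p : V) : degIn A U p ≤ degIn A R p :=
  sum_le_sum_of_subset h

theorem IsForest.mono (h : IsForest A R) (hU : U ⊆ R) : IsForest A U :=
  fun W hW => h W (hW.trans hU)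

theorem IsForest.of_le (h : IsForest A' R) (hA : ∀ p ∈ R, ∀ q ∈ R, A p q ≤ A' p q) :
    IsForest A R := fun W hW hne => by
  obtain ⟨p, hp, hd⟩ := h W hW hne
  exact ⟨p, hp, (sum_le_sum fun q hq => hA p (hW hp) q (hW hq)).trans hd⟩

theorem isForest_empty : IsForest A ∅ := fun U hU hne => by
  simp [subset_empty.1 hU] at hne

variable [DecidableEq V]

theorem degIn_insert (h : v ∉ U) (p : V) : degIn A (insert v U) p = A p v + degIn A U p :=
  sum_insert h

theorem degIn_erase_add (h : v ∈ U) (p : V) : degIn A (U.erase v) p + A p v = degIn A U p :=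
  sum_erase_add _ _ h

/-- In a subset that contains `v`, the vertex `v` itself has low degree; all other subsets lie in
`R`. -/
theorem IsForest.insert_of_degIn_le (h : IsForest A R) (hv : degIn A R v ≤ 1) (hvv : A v v = 0) :
    IsForest A (insert v R) := by
  intro U hU hne
  by_cases hvU : v ∈ U
  · refine ⟨v, hvU, ?_⟩
    rw [← degIn_erase_add hvU, hvv]
    exact (degIn_mono (by rw [← subset_insert_iff]; exact hU) v).trans hv
  · exact h U ((subset_insert_iff_of_notMem hvU).1 hU) hne

/-- A forest splits into trees: classes without edges between them, the number of edges in each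
of which is one less than the number of vertices. -/
theorem IsForest.exists_trees (hs : ∀ p q, A p q = A q p) (hd : ∀ p, A p p = 0)
    (h : IsForest A R) : ∃ ℓ : V → V, (∀ x ∈ R, ℓ x ∈ R) ∧
      (∀ x ∈ R, ∀ z ∈ R, A x z ≠ 0 → ℓ x = ℓ z) ∧
      ∀ x ∈ R, ∑ p ∈ R with ℓ p = ℓ x, degIn A {q ∈ R | ℓ q = ℓ x} p + 2 =
        2 * #{p ∈ R | ℓ p = ℓ x} := by
  induction hn : #R generalizing R with
  | zero =>
    rw [card_eq_zero] at hn
    subst hn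
    exact ⟨id, by simp⟩
  | succ m ih =>
    obtain ⟨p, hp, hpd⟩ := h R Subset.rfl (card_pos.1 (by omega))
    obtain ⟨ℓ, h1, h2, h3⟩ := ih (h.mono (erase_subset p R)) (by rw [card_erase_of_mem hp]; omega)
    -- Putting `p` back into a class counts each of its edges twice, once at either end.
    have key : ∀ (T : Finset V), p ∉ T →
        ∑ x ∈ insert p T, degIn A (insert p T) x = ∑ x ∈ T, degIn A T x + 2 * degIn A T p := by
      intro T hT
      rw [sum_insert hT, degIn_insert hT, hd, sum_congr rfl fun x _ => degIn_insert hT x,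
        sum_add_distrib]
      have : ∑ x ∈ T, A x p = degIn A T p := sum_congr rfl fun x _ => hs x p
      omega
    by_cases hz : ∃ z ∈ R, A p z ≠ 0
    · obtain ⟨z, hzR, hz⟩ := hz
      have hzp : z ≠ p := by rintro rfl; exact hz (hd z)
      have hzE : z ∈ R.erase p := mem_erase.2 ⟨hzp, hzR⟩
      have honly : ∀ x ∈ R, A p x ≠ 0 → x = z := by
        intro x hx hxz
        by_contra hne
        have : A p x + A p z ≤ degIn A R p := by
          rw [← sum_pair hne]
          exact sum_le_sum_of_subset (by intro a; simp; rintro (rfl | rfl) <;> assumption)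
        omega
      have hpz : A p z = 1 := by
        have : A p z ≤ degIn A R p := single_le_sum (f := fun q => A p q) (fun _ _ => by simp) hzR
        omega
      -- The leaf `p` joins the class of its only neighbour, which gains one vertex and one edge.
      set ℓ' := Function.update ℓ p (ℓ z) with hℓ'
      have e1 : ℓ' p = ℓ z := by simp [hℓ']
      have e2 : ∀ x, x ≠ p → ℓ' x = ℓ x := fun x hx => by simp [hℓ', hx]
      have hcls : ∀ c, ({q ∈ R | ℓ' q = c} : Finset V) =
          if c = ℓ z then insert p {q ∈ R.erase p | ℓ q = c} else {q ∈ R.erase p | ℓ q = c} := by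
        intro c
        ext q
        by_cases hq : q = p
        · subst hq
          split_ifs with hc <;> simp [e1, hp, hc, eq_comm]
        · split_ifs with hc <;> simp [e2 q hq, hq]
      refine ⟨ℓ', fun x hx => ?_, fun x hx x' hx' hxx => ?_, fun x hx => ?_⟩
      · by_cases hxp : x = p
        · rw [hxp, e1]; exact mem_of_mem_erase (h1 z hzE)
        · rw [e2 x hxp]; exact mem_of_mem_erase (h1 x (mem_erase.2 ⟨hxp, hx⟩))
      · by_cases hxp : x = p
        · subst hxp
          rw [honly x' hx' hxx, e1, e2 z hzp]
        · by_cases hxp' : x' = p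
          · subst hxp'
            rw [hs] at hxx
            rw [honly x hx hxx, e1, e2 z hzp]
          · rw [e2 x hxp, e2 x' hxp']
            exact h2 x (mem_erase.2 ⟨hxp, hx⟩) x' (mem_erase.2 ⟨hxp', hx'⟩) hxx
      · rw [hcls]
        have hx2 : ∃ x' ∈ R.erase p, ℓ' x = ℓ x' := by
          by_cases hxp : x = p
          · exact ⟨z, hzE, by rw [hxp, e1]⟩
          · exact ⟨x, mem_erase.2 ⟨hxp, hx⟩, e2 x hxp⟩
        obtain ⟨x', hx', hxx'⟩ := hx2
        rw [hxx']
        have h3' := h3 x' hx'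
        split_ifs with hc
        · rw [key _ (by simp), card_insert_of_notMem (by simp)]
          have : degIn A {q ∈ R.erase p | ℓ q = ℓ x'} p = 1 := by
            rw [degIn, sum_eq_single z, hpz]
            · intro q hq hqz
              by_contra hne
              exact hqz (honly q (by simp at hq; tauto) hne)
            · intro hh
              exact absurd (by simp [hzR, hzp, hc]) hh
          omega
        · exact h3'
    · push Not at hz
      -- The isolated vertex `p` becomes a class of its own. Its label is fresh because the old
      -- labels lie in `R.erase p`.
      set ℓ' := Function.update ℓ p p with hℓ'
      have e1 : ℓ' p = p := by simp [hℓ']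
      have e2 : ∀ x, x ≠ p → ℓ' x = ℓ x := fun x hx => by simp [hℓ', hx]
      have e3 : ∀ x ∈ R, x ≠ p → ℓ x ≠ p := fun x hx hxp =>
        (mem_erase.1 (h1 x (mem_erase.2 ⟨hxp, hx⟩))).1
      refine ⟨ℓ', fun x hx => ?_, fun x hx x' hx' hxx => ?_, fun x hx => ?_⟩
      · by_cases hxp : x = p
        · rwa [hxp, e1]
        · rw [e2 x hxp]; exact mem_of_mem_erase (h1 x (mem_erase.2 ⟨hxp, hx⟩))
      · have hxp : x ≠ p := by rintro rfl; exact hxx (hz x' hx')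
        have hxp' : x' ≠ p := by rintro rfl; rw [hs] at hxx; exact hxx (hz x hx)
        rw [e2 x hxp, e2 x' hxp']
        exact h2 x (mem_erase.2 ⟨hxp, hx⟩) x' (mem_erase.2 ⟨hxp', hx'⟩) hxx
      · by_cases hxp : x = p
        · subst hxp
          have : ({q ∈ R | ℓ' q = ℓ' x} : Finset V) = {x} := by
            ext q
            by_cases hq : q = x
            · simp [hq, hx]
            · simp only [mem_filter, e1, e2 q hq, mem_singleton, hq, iff_false, not_and]
              exact fun hqR => e3 q hqR hq
          rw [this]
          simp [degIn, hd]
        · have : ({q ∈ R | ℓ' q = ℓ' x} : Finset V) = {q ∈ R.erase p | ℓ q = ℓ x} := by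
            ext q
            by_cases hq : q = p
            · subst hq
              simp [e1, e2 x hxp, Ne.symm (e3 x hx hxp)]
            · simp [e2 q hq, e2 x hxp, hq]
          rw [this]
          exact h3 x (mem_erase.2 ⟨hxp, hx⟩)

/-- Removing a vertex of degree at most one loses at most one edge, so a nonempty forest has fewer
edges than vertices. -/
theorem IsForest.sum_degIn_le (hs : ∀ p q, A p q = A q p) (hd : ∀ p, A p p = 0)
    (h : IsForest A R) (hne : R.Nonempty) : ∑ p ∈ R, degIn A R p + 2 ≤ 2 * #R := by
  induction hn : #R generalizing R with
  | zero => simp [card_eq_zero.1 hn] at hne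
  | succ m ih =>
    obtain ⟨p, hp, hpd⟩ := h R Subset.rfl hne
    have hT : p ∉ R.erase p := by simp
    have e : ∑ x ∈ R.erase p, A x p = degIn A (R.erase p) p := sum_congr rfl fun x _ => hs x p
    have key : ∑ x ∈ R, degIn A R x =
        ∑ x ∈ R.erase p, degIn A (R.erase p) x + 2 * degIn A (R.erase p) p := by
      conv_lhs => rw [← insert_erase hp]
      rw [sum_insert hT, degIn_insert hT, hd, sum_congr rfl fun x _ => degIn_insert hT x,
        sum_add_distrib]
      omega
    have hle := degIn_mono (A := A) (erase_subset p R) p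
    rcases (R.erase p).eq_empty_or_nonempty with h0 | h0
    · rw [key, h0]; simp [degIn]
    · have := ih (h.mono (erase_subset p R)) h0 (by rw [card_erase_of_mem hp]; omega)
      omega

/-- A vertex that cannot be added to a forest has two edges to one of the trees. -/
theorem IsForest.exists_two_le (hs : ∀ p q, A p q = A q p) (hd : ∀ p, A p p = 0)
    (h : IsForest A R) {ℓ : V → V} (hℓ : ∀ x ∈ R, ∀ z ∈ R, A x z ≠ 0 → ℓ x = ℓ z)
    (hv : ¬ IsForest A (insert v R)) : ∃ x ∈ R, 2 ≤ degIn A {q ∈ R | ℓ q = ℓ x} v := by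
  by_contra! hcon
  refine hv fun U hU hne => ?_
  by_cases hvU : v ∈ U
  swap
  · exact h U ((subset_insert_iff_of_notMem hvU).1 hU) hne
  have hUR : U.erase v ⊆ R := by rw [← subset_insert_iff]; exact hU
  rcases (U.erase v).eq_empty_or_nonempty with h0 | ⟨x, hx⟩
  · refine ⟨v, hvU, ?_⟩
    rw [← degIn_erase_add hvU, h0, hd]; simp [degIn]
  -- If all degrees in `U` were at least two, the part `T` of one class would have degree sum at
  -- least `2 * #T`. Inside it has at most `2 * #T - 2`, and `v` contributes at most one.
  by_contra! hdeg
  set T := {q ∈ U.erase v | ℓ q = ℓ x} with hT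
  have hTR : T ⊆ R := (filter_subset _ _).trans hUR
  have h1 := (h.mono hTR).sum_degIn_le hs hd ⟨x, by rw [hT, mem_filter]; exact ⟨hx, rfl⟩⟩
  have h2 : ∀ p ∈ T, degIn A U p = degIn A T p + A p v := by
    intro p hp
    rw [← degIn_erase_add hvU]
    congr 1
    symm
    refine sum_subset (filter_subset _ _) fun q hq hqT => ?_
    by_contra hpq
    apply hqT
    rw [hT, mem_filter] at hp ⊢
    exact ⟨hq, (hℓ p (hUR hp.1) q (hUR hq) hpq) ▸ hp.2⟩
  have h3 : ∑ p ∈ T, A p v ≤ 1 := by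
    have := hcon x (hUR hx)
    have h4 : degIn A T v ≤ degIn A {q ∈ R | ℓ q = ℓ x} v :=
      degIn_mono (filter_subset_filter _ hUR) v
    have h5 : ∑ p ∈ T, A p v = degIn A T v := sum_congr rfl fun p _ => hs p v
    omega
  have h4 : ∑ p ∈ T, 2 ≤ ∑ p ∈ T, degIn A U p :=
    sum_le_sum fun p hp => hdeg p (mem_of_mem_erase (mem_filter.1 hp).1)
  rw [sum_congr rfl h2, sum_add_distrib] at h4
  simp at h4
  omega

/-- In a simple graph with minimum degree two in which no two vertices of degree two are adjacent,
the degrees on a maximal forest exceed two in total by the number of remaining vertices. -/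
theorem IsForest.card_add_le_sum_degIn (hs : ∀ p q, A p q = A q p) (hd : ∀ p, A p p = 0)
    (hRS : R ⊆ S) (h : IsForest A R) (hmax : ∀ f ∈ S \ R, ¬ IsForest A (insert f R))
    (h1 : ∀ p ∈ S, ∀ q ∈ S, A p q ≤ 1) (h2 : ∀ p ∈ S, 2 ≤ degIn A S p)
    (hadj : ∀ p ∈ S, ∀ q ∈ S, A p q ≠ 0 → degIn A S p = 2 → degIn A S q ≠ 2) :
    #(S \ R) + 2 * #R ≤ ∑ p ∈ R, degIn A S p := by
  obtain ⟨ℓ, hℓR, hℓ, htree⟩ := h.exists_trees hs hd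
  have hwit : ∀ f : V, ∃ x, f ∈ S \ R → x ∈ R ∧ 2 ≤ degIn A {q ∈ R | ℓ q = ℓ x} f := by
    intro f
    by_cases hf : f ∈ S \ R
    · obtain ⟨x, hx, h⟩ := h.exists_two_le hs hd hℓ (hmax f hf)
      exact ⟨x, fun _ => ⟨hx, h⟩⟩
    · exact ⟨f, fun h => absurd h hf⟩
  choose g hg using hwit
  have e1 : ∑ c ∈ R.image ℓ, ∑ p ∈ R with ℓ p = c, degIn A S p = ∑ p ∈ R, degIn A S p :=
    sum_fiberwise_of_maps_to (fun x hx => mem_image_of_mem ℓ hx) _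
  have e2 : ∑ c ∈ R.image ℓ, #{p ∈ R | ℓ p = c} = #R :=
    (card_eq_sum_card_fiberwise fun x hx => mem_image_of_mem ℓ hx).symm
  have e3 : ∑ c ∈ R.image ℓ, #{f ∈ S \ R | ℓ (g f) = c} = #(S \ R) :=
    (card_eq_sum_card_fiberwise fun f hf => mem_image_of_mem ℓ (hg f hf).1).symm
  -- Each vertex outside `R` is charged to one tree to which it has two edges, and the estimate is
  -- proved tree by tree.
  rw [← e1, ← e2, ← e3, mul_sum, ← sum_add_distrib]
  refine sum_le_sum fun c hc => ?_
  obtain ⟨x, hx, rfl⟩ := mem_image.1 hc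
  set T := {p ∈ R | ℓ p = ℓ x} with hT
  set M := {f ∈ S \ R | ℓ (g f) = ℓ x} with hM
  have hTR : T ⊆ R := filter_subset _ _
  have hxT : x ∈ T := mem_filter.2 ⟨hx, rfl⟩
  have htr : ∑ p ∈ T, degIn A T p + 2 = 2 * #T := htree x hx
  have hsplit : ∀ p ∈ T, degIn A S p = degIn A T p + degIn A (S \ R) p := by
    intro p hp
    have : degIn A S p = degIn A R p + degIn A (S \ R) p := by
      rw [add_comm]; exact (sum_sdiff hRS).symm
    rw [this]
    congr 1
    symm
    refine sum_subset hTR fun q hq hqT => ?_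
    by_contra hpq
    apply hqT
    rw [hT, mem_filter] at hp ⊢
    exact ⟨hq, (hℓ p hp.1 q hq hpq) ▸ hp.2⟩
  have hsum : ∑ p ∈ T, degIn A S p = ∑ p ∈ T, degIn A T p + ∑ f ∈ S \ R, degIn A T f := by
    rw [sum_congr rfl hsplit, sum_add_distrib]
    congr 1
    simp only [degIn]
    rw [sum_comm]
    exact sum_congr rfl fun f _ => sum_congr rfl fun p _ => hs p f
  have hout : 2 * #M ≤ ∑ f ∈ S \ R, degIn A T f := by
    have h4 : ∑ f ∈ M, 2 ≤ ∑ f ∈ M, degIn A T f := sum_le_sum fun f hf => by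
      obtain ⟨hf1, hf2⟩ := mem_filter.1 hf
      have := (hg f hf1).2
      rwa [hf2] at this
    have h5 : ∑ f ∈ M, degIn A T f ≤ ∑ f ∈ S \ R, degIn A T f :=
      sum_le_sum_of_subset (filter_subset _ _)
    simp at h4
    omega
  have hmin : 2 * #T ≤ ∑ p ∈ T, degIn A S p := by
    have : ∑ p ∈ T, 2 ≤ ∑ p ∈ T, degIn A S p := sum_le_sum fun p hp => h2 p (hRS (hTR hp))
    simp at this
    omega
  -- If two or more vertices are charged, `2 * #T - 2 + 2 * #M` is enough; if none is, minimum
  -- degree two is enough. A single charged vertex is the critical case.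
  rcases Nat.lt_or_ge 1 (#M) with hM2 | hM1
  · omega
  rcases Nat.eq_zero_or_pos (#M) with hM0 | hM0
  · omega
  by_contra! hcon
  -- Failure forces all degrees on `T` to be two, hence no edges inside `T`, hence a tree with one
  -- vertex. The charged vertex would then have a double edge to it.
  have hall : ∀ p ∈ T, degIn A S p = 2 := by
    have : ∑ p ∈ T, 2 = ∑ p ∈ T, degIn A S p := by simp; omega
    exact fun p hp => ((sum_eq_sum_iff_of_le fun p hp => h2 p (hRS (hTR hp))).1 this p hp).symm
  have hzero : ∑ p ∈ T, degIn A T p = 0 := by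
    refine sum_eq_zero fun p hp => sum_eq_zero fun q hq => ?_
    by_contra hpq
    exact hadj p (hRS (hTR hp)) q (hRS (hTR hq)) hpq (hall p hp) (hall q hq)
  have hT1 : #T = 1 := by omega
  obtain ⟨z, hz⟩ := card_eq_one.1 hT1
  obtain ⟨f, hf⟩ := card_pos.1 hM0
  obtain ⟨hf1, hf2⟩ := mem_filter.1 hf
  have h6 := (hg f hf1).2
  rw [hf2, ← hT, hz] at h6
  have h7 := h1 f (mem_sdiff.1 hf1).1 z (hRS (hTR (hz ▸ mem_singleton_self z)))
  simp [degIn] at h6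
  omega

/-- The complement of a forest in a graph with many edges has large total degree. -/
theorem IsForest.sum_degIn_le_of_sdiff (hs : ∀ p q, A p q = A q p) (hd : ∀ p, A p p = 0)
    {H : Finset V} (hH : H ⊆ S) (h : IsForest A (S \ H)) :
    ∑ p ∈ S, degIn A S p ≤ 2 * ∑ p ∈ H, degIn A S p + 2 * #(S \ H) := by
  have e1 : ∑ p ∈ S \ H, degIn A S p + ∑ p ∈ H, degIn A S p = ∑ p ∈ S, degIn A S p :=
    sum_sdiff hH
  have e2 : ∀ p, degIn A S p = degIn A (S \ H) p + degIn A H p := fun p => (sum_sdiff hH).symm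
  -- Edges between `H` and its complement are seen from both sides; this accounts for the factor
  -- two.
  have e3 : ∑ p ∈ S \ H, degIn A H p ≤ ∑ p ∈ H, degIn A S p := by
    simp only [degIn]
    rw [sum_comm]
    exact sum_le_sum fun p _ => (sum_congr rfl fun q _ => hs q p).le.trans
      (sum_le_sum_of_subset sdiff_subset)
  have e4 : ∑ p ∈ S \ H, degIn A (S \ H) p ≤ 2 * #(S \ H) := by
    rcases (S \ H).eq_empty_or_nonempty with h0 | h0
    · simp [h0]
    · have := h.sum_degIn_le hs hd h0; omega
  rw [sum_congr rfl fun p _ => e2 p, sum_add_distrib] at e1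
  omega

/-! ### Contraction of a vertex of degree two -/

/-- The multigraph with an additional edge between `u` and `y`. -/
def addEdge (A : V → V → ℕ) (u y : V) : V → V → ℕ :=
  fun p q => A p q + if (p = u ∧ q = y) ∨ (p = y ∧ q = u) then 1 else 0

theorem le_addEdge (p q : V) : A p q ≤ addEdge A u y p q := Nat.le_add_right _ _

theorem addEdge_symm (hs : ∀ p q, A p q = A q p) (p q : V) :
    addEdge A u y p q = addEdge A u y q p := by
  simp only [addEdge, hs p q]
  congr 2
  grind

theorem degIn_addEdge (huy : u ≠ y) (hu : u ∈ U) (hy : y ∈ U) (p : V) :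
    degIn (addEdge A u y) U p = degIn A U p + if p = u ∨ p = y then 1 else 0 := by
  simp only [degIn, addEdge, sum_add_distrib]
  congr 1
  by_cases hpu : p = u
  · subst hpu
    simp [huy, hy]
  · by_cases hpy : p = y
    · subst hpy
      simp [Ne.symm huy, hu]
    · simp [hpu, hpy]

theorem degIn_addEdge_of_notMem (h : u ∉ U ∨ y ∉ U) {p : V} (hp : p ∈ U) :
    degIn (addEdge A u y) U p = degIn A U p :=
  sum_congr rfl fun q hq => by
    have : ¬ ((p = u ∧ q = y) ∨ (p = y ∧ q = u)) := by grind
    simp [addEdge, this]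

/-- `v` has exactly two edges into `S`, one to `u` and one to `y`. -/
structure IsLink (A : V → V → ℕ) (S : Finset V) (v u y : V) : Prop where
  symm : ∀ p q, A p q = A q p
  diag : ∀ p, A p p = 0
  mem : v ∈ S
  mem_left : u ∈ S
  mem_right : y ∈ S
  ne : u ≠ y
  left : A v u = 1
  right : A v y = 1
  deg : degIn A S v = 2

namespace IsLink

variable (h : IsLink A S v u y)
include h

omit [DecidableEq V] in
theorem ne_left : u ≠ v := by
  rintro rfl; have := h.left; rw [h.diag] at this; omega

omit [DecidableEq V] in
theorem ne_right : y ≠ v := by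
  rintro rfl; have := h.right; rw [h.diag] at this; omega

theorem eq_zero {q : V} (hq : q ∈ S) (hu : q ≠ u) (hy : q ≠ y) : A v q = 0 := by
  have h1 : ∑ x ∈ {u, y, q}, A v x ≤ degIn A S v := by
    refine sum_le_sum_of_subset ?_
    have := h.mem_left; have := h.mem_right
    intro x; simp; rintro (rfl | rfl | rfl) <;> assumption
  rw [sum_insert (by simp [h.ne, Ne.symm hu]), sum_pair (Ne.symm hy), h.left, h.right, h.deg] at h1
  omega

/-- At `u` and `y` the new edge stands in for the edge to `v`, and `v` has no other neighbours in
`S`. -/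
theorem degIn_addEdge_eq (hU : U ⊆ S) (hv : v ∉ U) (hu : u ∈ U) (hy : y ∈ U) {p : V}
    (hp : p ∈ U) : degIn (addEdge A u y) U p = degIn A (insert v U) p := by
  rw [degIn_addEdge h.ne hu hy, degIn_insert hv, add_comm, h.symm p v]
  congr 1
  split_ifs with hc
  · rcases hc with rfl | rfl
    · exact h.left.symm
    · exact h.right.symm
  · push Not at hc
    exact (h.eq_zero (hU hp) hc.1 hc.2).symm

/-- For a set with both `u` and `y`, adding `v` preserves all degrees, and `v` cannot be the vertex
of low degree. A set that misses one of them does not see the new edge. -/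
theorem isForest_erase (hR : R ⊆ S) (hv : v ∈ R) (hF : IsForest A R) :
    IsForest (addEdge A u y) (R.erase v) := by
  intro U hU hne
  have hvU : v ∉ U := fun hh => by simpa using hU hh
  by_cases huy : u ∈ U ∧ y ∈ U
  · obtain ⟨p, hp, hpd⟩ := hF (insert v U)
      (insert_subset hv (hU.trans (erase_subset _ _))) ⟨v, by simp⟩
    rcases mem_insert.1 hp with rfl | hp
    · rw [degIn_insert hvU, h.diag] at hpd
      have : ∑ x ∈ {u, y}, A p x ≤ degIn A U p := sum_le_sum_of_subset (by
        intro x; simp; rintro (rfl | rfl); exacts [huy.1, huy.2])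
      rw [sum_pair h.ne, h.left, h.right] at this
      omega
    · refine ⟨p, hp, ?_⟩
      rwa [h.degIn_addEdge_eq ((hU.trans (erase_subset _ _)).trans hR) hvU huy.1 huy.2 hp]
  · obtain ⟨p, hp, hpd⟩ := hF U (hU.trans (erase_subset _ _)) hne
    exact ⟨p, hp, by rwa [degIn_addEdge_of_notMem (by tauto) hp]⟩

/-- The degrees agree when both neighbours of `v` are present; otherwise `v` itself has degree at
most one. Thus contraction never prevents `v` from returning. -/
theorem isForest_insert (hR : R ⊆ S.erase v) (hF : IsForest (addEdge A u y) R) :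
    IsForest A (insert v R) := by
  intro U hU hne
  by_cases hvU : v ∈ U
  swap
  · exact hF.of_le (fun p _ q _ => le_addEdge p q) U ((subset_insert_iff_of_notMem hvU).1 hU) hne
  have hUR : U.erase v ⊆ R := by rw [← subset_insert_iff]; exact hU
  have hUS : U.erase v ⊆ S := (hUR.trans hR).trans (erase_subset _ _)
  by_cases huy : u ∈ U ∧ y ∈ U
  · have hu : u ∈ U.erase v := mem_erase.2 ⟨h.ne_left, huy.1⟩
    have hy : y ∈ U.erase v := mem_erase.2 ⟨h.ne_right, huy.2⟩
    obtain ⟨p, hp, hpd⟩ := hF (U.erase v) hUR ⟨u, hu⟩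
    refine ⟨p, mem_of_mem_erase hp, ?_⟩
    rwa [h.degIn_addEdge_eq hUS (by simp) hu hy hp, insert_erase hvU] at hpd
  · refine ⟨v, hvU, ?_⟩
    have hUS' : U ⊆ S := by
      rw [← insert_erase hvU]; exact insert_subset h.mem hUS
    have hlt : degIn A U v + 1 ≤ degIn A S v := by
      have : ∃ z ∈ S, z ∉ U ∧ A v z = 1 := by
        rcases not_and_or.1 huy with hz | hz
        · exact ⟨u, h.mem_left, hz, h.left⟩
        · exact ⟨y, h.mem_right, hz, h.right⟩
      obtain ⟨z, hz, hzU, hz1⟩ := this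
      have h2 := degIn_mono (A := A) (insert_subset hz hUS') v
      rw [degIn_insert hzU, hz1] at h2
      omega
    rw [h.deg] at hlt
    omega

end IsLink

/-! ### The local ratio steps -/

/-- A maximal forest whose complement is a `2`-approximation of a minimum weight feedback vertex
set. -/
structure IsGood (A : V → V → ℕ) (S : Finset V) (w : V → ℕ) (R : Finset V) : Prop where
  subset : R ⊆ S
  forest : IsForest A R
  maximal : ∀ f ∈ S \ R, ¬ IsForest A (insert f R)
  le : ∀ H ⊆ S, IsForest A (S \ H) → ∑ p ∈ S \ R, w p ≤ 2 * ∑ p ∈ H, w p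

/-- The steps of the local ratio algorithm, each of which removes the vertex `v` from `S`. -/
inductive Step (A : V → V → ℕ) (S : Finset V) (w : V → ℕ) (v : V) :
    (V → V → ℕ) → (V → ℕ) → Prop
  | low (w' : V → ℕ) (h : degIn A S v ≤ 1) (hw : ∀ p ∈ S.erase v, w' p = w p) : Step A S w v A w'
  | double (w' : V → ℕ) (o : V) (ho : o ∈ S) (h : 2 ≤ A v o) (hle : w v ≤ w o)
      (hw : ∀ p ∈ S.erase v, w' p = if p = o then w p - w v else w p) : Step A S w v A w'
  | link (w' : V → ℕ) (u y : V) (h : IsLink A S v u y) (hle : w u ≤ w v)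
      (hw : ∀ p ∈ S.erase v, w' p = w p) : Step A S w v (addEdge A u y) w'
  | ratio (w' : V → ℕ) (h1 : ∀ p ∈ S, ∀ q ∈ S, A p q ≤ 1) (h2 : ∀ p ∈ S, 2 ≤ degIn A S p)
      (hadj : ∀ p ∈ S, ∀ q ∈ S, A p q ≠ 0 → degIn A S p = 2 → degIn A S q ≠ 2)
      (hle : ∀ p ∈ S, w v * (degIn A S p - 1) ≤ w p * (degIn A S v - 1))
      (hw : ∀ p ∈ S.erase v,
        w' p = w p * (degIn A S v - 1) - w v * (degIn A S p - 1)) : Step A S w v A w'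

theorem Step.symm_diag {w w' : V → ℕ} (h : Step A S w v A' w')
    (hA : (∀ p q, A p q = A q p) ∧ ∀ p, A p p = 0) :
    (∀ p q, A' p q = A' q p) ∧ ∀ p, A' p p = 0 := by
  cases h with
  | low => exact hA
  | double => exact hA
  | ratio => exact hA
  | link _ u y h =>
    refine ⟨addEdge_symm hA.1, fun p => ?_⟩
    have := h.ne
    simp only [addEdge, hA.2 p, zero_add, ite_eq_right_iff]
    grind

/-- Being a `2`-approximation is preserved by nonnegative combinations of weights. The weight of `v`
is used up by `ε * w₁`, so its membership does not matter for `w'`. The factor `c` clears the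
denominator of the ratio and keeps all weights integral. -/
theorem local_ratio {w w' w₁ : V → ℕ} {c ε : ℕ} {F F' H : Finset V} (hc : 0 < c)
    (hw : ∀ p ∈ S.erase v, c * w p = w' p + ε * w₁ p) (hv : c * w v = ε * w₁ v)
    (hF : F ⊆ S) (hH : H ⊆ S) (hFF' : F.erase v ⊆ F')
    (h' : ∑ p ∈ F', w' p ≤ 2 * ∑ p ∈ H.erase v, w' p) (h₁ : ∑ p ∈ F, w₁ p ≤ 2 * ∑ p ∈ H, w₁ p) :
    ∑ p ∈ F, w p ≤ 2 * ∑ p ∈ H, w p := by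
  have key : ∀ T ⊆ S, c * ∑ p ∈ T, w p = ∑ p ∈ T.erase v, w' p + ε * ∑ p ∈ T, w₁ p := by
    intro T hT
    have e1 : ∀ p ∈ T.erase v, c * w p = w' p + ε * w₁ p := fun p hp =>
      hw p (erase_subset_erase _ hT hp)
    by_cases hvT : v ∈ T
    · rw [← sum_erase_add _ _ hvT, ← sum_erase_add T w₁ hvT, mul_add, mul_sum,
        sum_congr rfl e1, sum_add_distrib, mul_add, mul_sum, hv]
      ring
    · rw [erase_eq_of_notMem hvT] at e1 ⊢
      rw [mul_sum, sum_congr rfl e1, sum_add_distrib, mul_sum]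
  have h3 : ∑ p ∈ F.erase v, w' p ≤ ∑ p ∈ F', w' p := sum_le_sum_of_subset hFF'
  refine Nat.le_of_mul_le_mul_left ?_ hc
  rw [key F hF, mul_left_comm, key H hH]
  nlinarith [Nat.mul_le_mul_left ε h₁]

-- Where weight is subtracted, the guarantee is lifted by `local_ratio`. In the cases `low` and
-- `link` the vertex `v` always enters the forest, and a feedback vertex set of the larger graph
-- yields one of the smaller graph at no greater weight.
open Classical in
theorem Step.isGood (hs : ∀ p q, A p q = A q p) (hd : ∀ p, A p p = 0) {w w' : V → ℕ} (hv : v ∈ S)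
    (hstep : Step A S w v A' w') {R : Finset V} (hR : IsGood A' (S.erase v) w' R) :
    IsGood A S w (if IsForest A (insert v R) then insert v R else R) := by
  set R₁ := if IsForest A (insert v R) then insert v R else R with hR₁
  have hRv : v ∉ R := fun h => by simpa using hR.subset h
  have hRS : R ⊆ S := hR.subset.trans (erase_subset _ _)
  have hR₁S : R₁ ⊆ S := by
    rw [hR₁]; split_ifs
    · exact insert_subset hv hRS
    · exact hRS
  have hsub : R ⊆ R₁ := by
    rw [hR₁]; split_ifs
    · exact subset_insert _ _
    · exact Subset.rfl
  have hsdiff : (S \ R₁).erase v ⊆ S.erase v \ R := fun p hp => by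
    simp only [mem_erase, mem_sdiff] at hp ⊢
    exact ⟨⟨hp.1, hp.2.1⟩, fun h => hp.2.2 (hsub h)⟩
  have hAA : ∀ p q, A p q ≤ A' p q := by
    cases hstep <;> intro p q
    exacts [le_rfl, le_rfl, le_addEdge p q, le_rfl]
  have hforest : IsForest A R₁ := by
    rw [hR₁]; split_ifs with h
    · exact h
    · exact hR.forest.of_le fun p _ q _ => hAA p q
  have hmaxv : v ∈ S \ R₁ → ¬ IsForest A (insert v R₁) := by
    rw [hR₁]; split_ifs with h
    · intro h'; simp at h'
    · exact fun _ => h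
  have hmax_of : A' = A → ∀ f ∈ S \ R₁, ¬ IsForest A (insert f R₁) := by
    intro hA f hf
    by_cases hfv : f = v
    · subst hfv; exact hmaxv hf
    · intro hh
      exact hR.maximal f (hsdiff (mem_erase.2 ⟨hfv, hf⟩))
        (hA ▸ hh.mono (insert_subset_insert _ hsub))
  have hH_of : ∀ H, S.erase v \ H.erase v ⊆ S \ H := fun H p hp => by
    simp only [mem_erase, mem_sdiff] at hp ⊢; tauto
  cases hstep with
  | low _ h hw =>
    refine ⟨hR₁S, hforest, hmax_of rfl, fun H hH hHF => ?_⟩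
    have h1 : R₁ = insert v R :=
      if_pos (hR.forest.insert_of_degIn_le ((degIn_mono hRS v).trans h) (hd v))
    have h2 := hR.le (H.erase v) (erase_subset_erase _ hH) (hHF.mono (hH_of H))
    have h3 : S \ R₁ ⊆ S.erase v \ R := by
      rw [h1]; intro p; simp only [mem_sdiff, mem_insert, mem_erase]; tauto
    calc ∑ p ∈ S \ R₁, w p ≤ ∑ p ∈ S.erase v \ R, w p := sum_le_sum_of_subset h3
      _ = ∑ p ∈ S.erase v \ R, w' p := sum_congr rfl fun p hp => (hw p (sdiff_subset hp)).symm
      _ ≤ 2 * ∑ p ∈ H.erase v, w' p := h2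
      _ = 2 * ∑ p ∈ H.erase v, w p := by
        rw [sum_congr rfl fun p hp => hw p (erase_subset_erase _ hH hp)]
      _ ≤ 2 * ∑ p ∈ H, w p := Nat.mul_le_mul_left _ (sum_le_sum_of_subset (erase_subset _ _))
  | double _ o ho h hle hw =>
    have hov : o ≠ v := by rintro rfl; rw [hd] at h; omega
    refine ⟨hR₁S, hforest, hmax_of rfl, fun H hH hHF => ?_⟩
    refine local_ratio (S := S) (v := v) (c := 1) (ε := w v) (w' := w')
      (w₁ := fun p => if p = v ∨ p = o then 1 else 0) one_pos ?_ (by simp) sdiff_subset hH hsdiff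
      (hR.le (H.erase v) (erase_subset_erase _ hH) (hHF.mono (hH_of H))) ?_
    · intro p hp
      rw [hw p hp]
      have hpv : p ≠ v := (mem_erase.1 hp).1
      by_cases hpo : p = o
      · subst hpo; simp; omega
      · simp [hpo, hpv]
    -- Any set pays at most two for the unit weights on `v` and `o`. A feedback vertex set pays at
    -- least one, since `v` and `o` span a double edge.
    · have h1 : ∑ p ∈ S \ R₁, (if p = v ∨ p = o then 1 else 0) ≤ 2 := by
        rw [← card_filter]
        refine (card_le_card (t := {v, o}) ?_).trans card_le_two
        intro p; simp
      have h2 : v ∈ H ∨ o ∈ H := by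
        by_contra! hcon
        obtain ⟨p, hp, hpd⟩ := hHF {v, o} (by
          intro p; simp only [mem_insert, mem_singleton, mem_sdiff]
          rintro (rfl | rfl)
          exacts [⟨hv, hcon.1⟩, ⟨ho, hcon.2⟩]) ⟨v, by simp⟩
        simp only [degIn, sum_pair hov.symm] at hpd
        have := hs v o
        rcases (by simpa using hp) with rfl | rfl <;> omega
      have h3 : 1 ≤ ∑ p ∈ H, (if p = v ∨ p = o then 1 else 0) := by
        rw [← card_filter]
        rcases h2 with h | h
        · exact card_pos.2 ⟨v, by simp [h]⟩
        · exact card_pos.2 ⟨o, by simp [h]⟩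
      omega
  | link _ u y h hle hw =>
    have h1 : R₁ = insert v R := if_pos (h.isForest_insert hR.subset hR.forest)
    refine ⟨hR₁S, hforest, fun f hf => ?_, fun H hH hHF => ?_⟩
    · rw [h1] at hf ⊢
      simp only [mem_sdiff, mem_insert, not_or] at hf
      intro hh
      refine hR.maximal f (by simp [hf]) ((h.isForest_erase ?_ ?_ hh).mono ?_)
      · exact insert_subset hf.1 (insert_subset hv hRS)
      · simp
      · intro p; simp only [mem_insert, mem_erase]
        rintro (rfl | hp)
        · exact ⟨hf.2.1, .inl rfl⟩
        · exact ⟨fun e => hRv (e ▸ hp), .inr (.inr hp)⟩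
    · have h3 : S \ R₁ = S.erase v \ R := by
        rw [h1]; ext p; simp only [mem_sdiff, mem_insert, mem_erase]; tauto
      rw [h3, sum_congr rfl fun p hp => (hw p (sdiff_subset hp)).symm]
      by_cases hvH : v ∈ H
      -- Exchange `v` for its neighbour `u`, which is not heavier; once `u` is deleted the new edge
      -- plays no role.
      · have huv := h.ne_left
        have hH' : insert u (H.erase v) ⊆ S.erase v :=
          insert_subset (mem_erase.2 ⟨huv, h.mem_left⟩) (erase_subset_erase _ hH)
        have h4 := hR.le (insert u (H.erase v)) hH' ?_
        · refine h4.trans (Nat.mul_le_mul_left _ ?_)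
          rw [sum_congr rfl fun p hp => hw p (hH' hp)]
          have h5 : ∑ p ∈ insert u (H.erase v), w p ≤ w u + ∑ p ∈ H.erase v, w p := by
            by_cases hu : u ∈ H.erase v
            · rw [insert_eq_of_mem hu]; omega
            · rw [sum_insert hu]
          have h6 := sum_erase_add H w hvH
          exact h5.trans (by omega)
        · refine (hHF.mono ((sdiff_subset_sdiff Subset.rfl (subset_insert u _)).trans
            (hH_of H))).of_le fun p hp q hq => ?_
          have hpu : p ≠ u := by rintro rfl; simp at hp
          have hqu : q ≠ u := by rintro rfl; simp at hq
          simp [addEdge, hpu, hqu]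
      · have hH' : H ⊆ S.erase v := fun p hp =>
          mem_erase.2 ⟨fun e => hvH (e ▸ hp), hH hp⟩
        have h4 := hR.le H hH' ?_
        · refine h4.trans_eq ?_
          rw [sum_congr rfl fun p hp => hw p (hH' hp)]
        · have := h.isForest_erase sdiff_subset (mem_sdiff.2 ⟨hv, hvH⟩) hHF
          refine this.mono fun p hp => ?_
          simp only [mem_erase, mem_sdiff] at hp ⊢; tauto
  | ratio _ g1 g2 hadj hle hw =>
    refine ⟨hR₁S, hforest, hmax_of rfl, fun H hH hHF => ?_⟩
    have hv2 := g2 v hv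
    refine local_ratio (S := S) (v := v) (c := degIn A S v - 1) (ε := w v) (w' := w')
      (w₁ := fun p => degIn A S p - 1) (by omega) ?_ (mul_comm _ _) sdiff_subset hH hsdiff
      (hR.le (H.erase v) (erase_subset_erase _ hH) (hHF.mono (hH_of H))) ?_
    · intro p hp
      rw [hw p hp, mul_comm]
      have := hle p (mem_of_mem_erase hp)
      omega
    -- Writing $d$ for the degree in $S$, the two estimates combine to $\sum_{S\setminus
    -- R_1}(d-1)\le\sum_S d-2|S|\le 2\sum_H(d-1)$.
    · have f1 := hforest.card_add_le_sum_degIn hs hd hR₁S (hmax_of rfl) g1 g2 hadj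
      have f2 := hHF.sum_degIn_le_of_sdiff hs hd hH
      have f3 : ∑ p ∈ S \ R₁, degIn A S p + ∑ p ∈ R₁, degIn A S p = ∑ p ∈ S, degIn A S p :=
        sum_sdiff hR₁S
      have f4 := card_sdiff_add_card_eq_card hR₁S
      have f5 := card_sdiff_add_card_eq_card hH
      have sub : ∀ T ⊆ S, ∑ p ∈ T, (degIn A S p - 1) + #T = ∑ p ∈ T, degIn A S p := by
        intro T hT
        rw [card_eq_sum_ones, ← sum_add_distrib]
        exact sum_congr rfl fun p hp => by have := g2 p (hT hp); omega
      have f6 := sub _ (sdiff_subset : S \ R₁ ⊆ S)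
      have f7 := sub H hH
      omega

end FVS

/-! ### Flows in the bipartite double cover -/

namespace DoubleCover

open Finset

variable {n : ℕ} {adj : ℕ → ℕ → Prop} {cap : ℕ → ℕ} {F F' : ℕ → ℕ → ℕ} {L R : ℕ → ℕ}

/-- A feasible flow from the left copy to the right copy of the vertices. -/
structure IsFlow (n : ℕ) (adj : ℕ → ℕ → Prop) (cap : ℕ → ℕ) (F : ℕ → ℕ → ℕ) : Prop where
  row : ∀ u < n, ∑ v ∈ range n, F u v ≤ cap u
  col : ∀ v < n, ∑ u ∈ range n, F u v ≤ cap v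
  supp : ∀ u < n, ∀ v < n, F u v ≠ 0 → adj u v

/-- The value of a flow. -/
def value (n : ℕ) (F : ℕ → ℕ → ℕ) : ℕ := ∑ u ∈ range n, ∑ v ∈ range n, F u v

/-- The vertices that are zeros of `L` on the left and those that are not zeros of `R` on the right
form a vertex cover of the double cover. -/
def IsCover (n : ℕ) (adj : ℕ → ℕ → Prop) (L R : ℕ → ℕ) : Prop :=
  ∀ u < n, ∀ v < n, adj u v → L u ≠ 0 → R v ≠ 0

/-- The weight of this cover. -/
def coverWeight (n : ℕ) (cap : ℕ → ℕ) (L R : ℕ → ℕ) : ℕ :=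
  ∑ u ∈ range n, ((if L u = 0 then cap u else 0) + if R u ≠ 0 then cap u else 0)

/-- Weak duality: each unit of flow runs along an edge with an end in the cover, and is charged to
the capacity of that end. -/
theorem IsFlow.value_le (hF : IsFlow n adj cap F) (hc : IsCover n adj L R) :
    value n F ≤ coverWeight n cap L R := by
  have h1 : value n F ≤ ∑ u ∈ range n, ∑ v ∈ range n,
      ((if L u = 0 then F u v else 0) + if R v ≠ 0 then F u v else 0) := by
    refine sum_le_sum fun u hu => sum_le_sum fun v hv => ?_
    by_cases h0 : F u v = 0
    · simp [h0]
    · have := hc u (mem_range.1 hu) v (mem_range.1 hv)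
        (hF.supp u (mem_range.1 hu) v (mem_range.1 hv) h0)
      split_ifs <;> omega
  refine h1.trans ?_
  simp only [sum_add_distrib, coverWeight]
  refine add_le_add ?_ ?_
  · refine sum_le_sum fun u hu => ?_
    split_ifs
    · exact hF.row u (mem_range.1 hu)
    · simp
  · rw [sum_comm]
    refine sum_le_sum fun v hv => ?_
    split_ifs
    · exact hF.col v (mem_range.1 hv)
    · simp

/-- Complementary slackness: the vertices of the cover are saturated, and no edge that carries flow
is covered at both ends. -/
theorem IsFlow.value_eq (hF : IsFlow n adj cap F) (hc : IsCover n adj L R)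
    (hL : ∀ u < n, L u = 0 → cap u ≤ ∑ v ∈ range n, F u v)
    (hR : ∀ v < n, R v ≠ 0 → cap v ≤ ∑ u ∈ range n, F u v)
    (hb : ∀ u < n, ∀ v < n, F u v ≠ 0 → R v ≠ 0 → L u ≠ 0) :
    value n F = coverWeight n cap L R := by
  refine le_antisymm (hF.value_le hc) ?_
  have h1 : ∑ u ∈ range n, ∑ v ∈ range n,
      ((if L u = 0 then F u v else 0) + if R v ≠ 0 then F u v else 0) ≤ value n F := by
    refine sum_le_sum fun u hu => sum_le_sum fun v hv => ?_
    by_cases h0 : F u v = 0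
    · simp [h0]
    · have := hb u (mem_range.1 hu) v (mem_range.1 hv) h0
      split_ifs <;> omega
  refine le_trans ?_ h1
  simp only [sum_add_distrib, coverWeight]
  refine add_le_add ?_ ?_
  · refine sum_le_sum fun u hu => ?_
    split_ifs with h
    · exact hL u (mem_range.1 hu) h
    · simp
  · rw [sum_comm]
    refine sum_le_sum fun v hv => ?_
    split_ifs with h
    · exact hR v (mem_range.1 hv) h
    · simp

/-- Stamps of a search from the unsaturated vertices on the left: every stamped vertex has a
predecessor with a smaller stamp or is a starting point, and the stamps do not exceed `t`. -/
structure IsSearch (n : ℕ) (adj : ℕ → ℕ → Prop) (cap : ℕ → ℕ) (F : ℕ → ℕ → ℕ) (L R : ℕ → ℕ)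
    (t : ℕ) : Prop where
  start : ∀ u < n, ∑ v ∈ range n, F u v < cap u → L u ≠ 0
  left : ∀ u < n, L u ≠ 0 → L u ≤ t ∧ ((L u = 1 ∧ ∑ v ∈ range n, F u v < cap u) ∨
    ∃ v < n, F u v ≠ 0 ∧ R v ≠ 0 ∧ R v < L u)
  right : ∀ v < n, R v ≠ 0 → R v ≤ t ∧ ∃ u < n, adj u v ∧ L u ≠ 0 ∧ L u < R v

/-- No further vertex can be stamped. -/
def IsClosed (n : ℕ) (adj : ℕ → ℕ → Prop) (F : ℕ → ℕ → ℕ) (L R : ℕ → ℕ) : Prop :=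
  (∀ u < n, ∀ v < n, L u ≠ 0 → adj u v → R v ≠ 0) ∧
    ∀ u < n, ∀ v < n, R v ≠ 0 → F u v ≠ 0 → L u ≠ 0

/-- The new stamp exceeds all old ones, so predecessors keep smaller stamps. An unstamped vertex is
nobody's recorded predecessor, so overwriting its zero does no harm. -/
theorem IsSearch.update_right {t : ℕ} (h : IsSearch n adj cap F L R t) {u v τ : ℕ} (hu : u < n)
    (hadj : adj u v) (hL : L u ≠ 0) (hv : R v = 0) (hτ : t < τ) :
    IsSearch n adj cap F L (Function.update R v τ) τ where
  start := h.start
  left a ha hLa := by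
    obtain ⟨h1, h2⟩ := h.left a ha hLa
    refine ⟨by omega, h2.imp_right ?_⟩
    rintro ⟨c, hc, h3, h4, h5⟩
    have : c ≠ v := by rintro rfl; exact h4 hv
    exact ⟨c, hc, h3, by simpa [this] using h4, by simpa [this] using h5⟩
  right c hc hRc := by
    by_cases hcv : c = v
    · subst hcv
      have := (h.left u hu hL).1
      simp only [Function.update_self]
      exact ⟨le_rfl, u, hu, hadj, hL, by omega⟩
    · simp only [Function.update_of_ne hcv] at hRc ⊢
      obtain ⟨h1, h2⟩ := h.right c hc hRc
      exact ⟨by omega, h2⟩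

theorem IsSearch.update_left {t : ℕ} (h : IsSearch n adj cap F L R t) {u v τ : ℕ} (hv : v < n)
    (hF : F u v ≠ 0) (hR : R v ≠ 0) (hu : L u = 0) (hτ : t < τ) :
    IsSearch n adj cap F (Function.update L u τ) R τ where
  start a ha hs := by
    by_cases hau : a = u
    · subst hau; simp; omega
    · simpa [hau] using h.start a ha hs
  left a ha hLa := by
    by_cases hau : a = u
    · subst hau
      have := (h.right v hv hR).1
      simp only [Function.update_self]
      exact ⟨le_rfl, .inr ⟨v, hv, hF, hR, by omega⟩⟩
    · simp only [Function.update_of_ne hau] at hLa ⊢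
      obtain ⟨h1, h2⟩ := h.left a ha hLa
      exact ⟨by omega, h2⟩
  right c hc hRc := by
    obtain ⟨h1, a, ha, h2, h3, h4⟩ := h.right c hc hRc
    have : a ≠ u := by rintro rfl; exact h3 hu
    exact ⟨by omega, a, ha, h2, by simpa [this] using h3, by simpa [this] using h4⟩

/-- The number of stamped vertices. -/
def marks (n : ℕ) (L R : ℕ → ℕ) : ℕ := #{u ∈ range n | L u ≠ 0} + #{v ∈ range n | R v ≠ 0}

theorem marks_le (n : ℕ) (L R : ℕ → ℕ) : marks n L R ≤ 2 * n := by
  have h1 := card_filter_le (range n) fun u => L u ≠ 0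
  have h2 := card_filter_le (range n) fun u => R u ≠ 0
  simp only [card_range] at h1 h2
  unfold marks; omega

theorem card_update_of_eq_zero {f : ℕ → ℕ} {a τ : ℕ} (ha : a < n) (h0 : f a = 0) (hτ : τ ≠ 0) :
    #{u ∈ range n | Function.update f a τ u ≠ 0} = #{u ∈ range n | f u ≠ 0} + 1 := by
  rw [← card_insert_of_notMem (a := a) (by simp [h0])]
  congr 1
  ext u
  by_cases hu : u = a
  · subst hu; simp [ha, hτ]
  · simp [hu]

theorem marks_update_right {v τ : ℕ} (hv : v < n) (h0 : R v = 0) (hτ : τ ≠ 0) :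
    marks n L (Function.update R v τ) = marks n L R + 1 := by
  simp only [marks, card_update_of_eq_zero hv h0 hτ, add_assoc]

theorem marks_update_left {u τ : ℕ} (hu : u < n) (h0 : L u = 0) (hτ : τ ≠ 0) :
    marks n (Function.update L u τ) R = marks n L R + 1 := by
  simp only [marks, card_update_of_eq_zero hu h0 hτ]; omega

/-- Max-flow min-cut: an unstamped vertex on the left is saturated because unsaturated ones are
starting points, and closedness supplies the remaining slackness conditions. -/
theorem IsFlow.value_eq_of_isClosed {t : ℕ} (hF : IsFlow n adj cap F)
    (hs : IsSearch n adj cap F L R t) (hc : IsClosed n adj F L R)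
    (hR : ∀ v < n, R v ≠ 0 → cap v ≤ ∑ u ∈ range n, F u v) :
    IsCover n adj L R ∧ value n F = coverWeight n cap L R := by
  have hcov : IsCover n adj L R := fun u hu v hv ha hL => hc.1 u hu v hv hL ha
  refine ⟨hcov, hF.value_eq hcov (fun u hu h0 => ?_) hR fun u hu v hv h1 h2 => hc.2 u hu v hv h2 h1⟩
  by_contra! hlt
  exact hs.start u hu hlt h0

/-- Adding a unit of flow. -/
theorem IsFlow.add_unit (hF : IsFlow n adj cap F) {u v : ℕ} (hu : u < n) (hv : v < n)
    (hadj : adj u v) (hru : ∑ b ∈ range n, F u b < cap u) (hcv : ∑ a ∈ range n, F a v < cap v)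
    (h' : ∀ a < n, ∀ b < n, F' a b = F a b + if a = u ∧ b = v then 1 else 0) :
    IsFlow n adj cap F' ∧ value n F' = value n F + 1 := by
  have hrow : ∀ a < n, ∑ b ∈ range n, F' a b = ∑ b ∈ range n, F a b + if a = u then 1 else 0 := by
    intro a ha
    rw [sum_congr rfl fun b hb => h' a ha b (mem_range.1 hb), sum_add_distrib]
    by_cases hau : a = u <;> simp [hau, hv]
  have hcol : ∀ b < n, ∑ a ∈ range n, F' a b = ∑ a ∈ range n, F a b + if b = v then 1 else 0 := by
    intro b hb
    rw [sum_congr rfl fun a ha => h' a (mem_range.1 ha) b hb, sum_add_distrib]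
    by_cases hbv : b = v <;> simp [hbv, hu]
  refine ⟨⟨fun a ha => ?_, fun b hb => ?_, fun a ha b hb h => ?_⟩, ?_⟩
  · rw [hrow a ha]
    split_ifs with h
    · subst h; omega
    · exact hF.row a ha
  · rw [hcol b hb]
    split_ifs with h
    · subst h; omega
    · exact hF.col b hb
  · by_cases hab : a = u ∧ b = v
    · rw [hab.1, hab.2]; exact hadj
    · rw [h' a ha b hb, if_neg hab] at h
      exact hF.supp a ha b hb h
  · rw [value, sum_congr rfl fun a ha => hrow a (mem_range.1 ha), sum_add_distrib]
    simp [value, hu]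

/-- Rerouting a unit of flow. -/
theorem IsFlow.shift_unit (hF : IsFlow n adj cap F) {u v v' : ℕ} (hu : u < n) (hv : v < n)
    (hv' : v' < n) (hvv : v' ≠ v) (hadj : adj u v) (hcv : ∑ a ∈ range n, F a v < cap v)
    (hpos : F u v' ≠ 0)
    (h' : ∀ a < n, ∀ b < n, F' a b =
      if a = u ∧ b = v' then F a b - 1 else F a b + if a = u ∧ b = v then 1 else 0) :
    IsFlow n adj cap F' ∧ value n F' = value n F ∧ ∑ a ∈ range n, F' a v' < cap v' := by
  -- The additive form removes the truncated subtraction; `hpos` makes it exact.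
  have h'' : ∀ a < n, ∀ b < n, F' a b + (if a = u ∧ b = v' then 1 else 0) =
      F a b + if a = u ∧ b = v then 1 else 0 := by
    intro a ha b hb
    rw [h' a ha b hb]
    by_cases h1 : a = u ∧ b = v'
    · obtain ⟨rfl, rfl⟩ := h1
      simp [hvv]; omega
    · simp [h1]
  have hrow : ∀ a < n, ∑ b ∈ range n, F' a b = ∑ b ∈ range n, F a b := by
    intro a ha
    have := sum_congr rfl fun b hb => h'' a ha b (mem_range.1 hb)
    rw [sum_add_distrib, sum_add_distrib] at this
    by_cases hau : a = u
    · subst hau; simpa [hv, hv'] using this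
    · simpa [hau] using this
  have hcol : ∀ b < n, ∑ a ∈ range n, F' a b + (if b = v' then 1 else 0) =
      ∑ a ∈ range n, F a b + if b = v then 1 else 0 := by
    intro b hb
    have := sum_congr rfl fun a ha => h'' a (mem_range.1 ha) b hb
    rw [sum_add_distrib, sum_add_distrib] at this
    by_cases hbv : b = v <;> by_cases hbv' : b = v' <;> simp_all
  refine ⟨⟨fun a ha => ?_, fun b hb => ?_, fun a ha b hb h => ?_⟩, ?_, ?_⟩
  · rw [hrow a ha]; exact hF.row a ha
  · have h1 := hcol b hb
    have h2 := hF.col b hb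
    by_cases h : b = v
    · subst h; simp [Ne.symm hvv] at h1; omega
    · simp only [h, if_false] at h1; omega
  · by_cases hab : a = u ∧ b = v
    · rw [hab.1, hab.2]; exact hadj
    · refine hF.supp a ha b hb fun h0 => h ?_
      have := h'' a ha b hb
      simp only [hab, if_false, h0] at this
      omega
  · exact sum_congr rfl fun a ha => hrow a (mem_range.1 ha)
  · have h1 := hcol v' hv'
    have h2 := hF.col v' hv'
    simp [hvv] at h1
    omega

end DoubleCover

/-! ### Storage conventions and the residual search. -/

namespace RAM

/-! Names of the arrays (`a…`) and of the scalar variables (`x…`) of the program. -/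

notation "aOut" => 1
notation "aW" => 2
notation "aAA" => 3
notation "aWW" => 4
notation "aDead" => 5
notation "aDeg" => 6
notation "aVV" => 7
notation "aRR" => 8
notation "aU" => 9
notation "aOrd" => 10
notation "aC" => 11
notation "aF" => 12
notation "aCap" => 13
notation "aL" => 14
notation "aR" => 15
notation "aRow" => 16
notation "aCol" => 17
notation "aK" => 18
notation "xi" => 20
notation "xp" => 21
notation "xq" => 22
notation "xj" => 23
notation "xt" => 24
notation "xr" => 25
notation "xv" => 26
notation "xu" => 27
notation "xy" => 28
notation "xacc" => 29
notation "xP" => 30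
notation "xo" => 31
notation "xs" => 32
notation "xk" => 33
notation "xm" => 34

/-- The number of vertices. -/
def nE : Expr := var 0

/-- The row of a position in a square matrix. -/
def rowE (e : Expr) : Expr := e / nE

/-- The column of a position in a square matrix. -/
def colE (e : Expr) : Expr := e - e / nE * nE

/-- The input is `I`, with `n` vertices, and `b` is a size parameter. -/
structure Input (b n : ℕ) (I : ℕ → ℕ) (s : State) : Prop where
  three_le : 3 ≤ b
  le : n ≤ b
  zero : I 0 = n
  eq : s 0 = I

variable {b n : ℕ} {I : ℕ → ℕ} {s : State}

theorem Input.two_le (h : Input b n I s) : 2 ≤ b := Nat.le_of_lt h.three_le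

theorem Input.of_eq (h : Input b n I s) {s' : State} (hs : s' 0 = s 0) : Input b n I s' :=
  ⟨h.three_le, h.le, h.zero, hs.trans h.eq⟩

theorem Input.le_cube (h : Input b n I s) : n ≤ b ^ 3 := by
  have := h.le; have := h.two_le; nlinarith [sq_nonneg b]

theorem Input.sq_le_cube (h : Input b n I s) : n * n ≤ b ^ 3 := by
  have := h.le; have := h.two_le; nlinarith [Nat.mul_le_mul h.le h.le]

theorem Input.two_mul_le_cube (h : Input b n I s) : n + n + 1 ≤ b ^ 3 := by
  have h1 := h.le; have h2 := h.two_le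
  have : 2 * 2 * b ≤ b * b * b := Nat.mul_le_mul_right b (Nat.mul_le_mul h2 h2)
  nlinarith

theorem Input.nE_eval (h : Input b n I s) : nE.eval s = n := by
  simp [nE, h.eq, h.zero]

theorem Input.rowE_eval (h : Input b n I s) (e : Expr) : (rowE e).eval s = e.eval s / n := by
  simp [rowE, h.nE_eval]

theorem Input.colE_eval (h : Input b n I s) (e : Expr) : (colE e).eval s = e.eval s % n := by
  simp [colE, h.nE_eval, Nat.mod_eq_sub_div_mul]

/-- The matrix with `n` columns that is stored row by row in `x`. -/
def mat (n : ℕ) (x : ℕ → ℕ) : ℕ → ℕ → ℕ := fun u v => x (u * n + v)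

theorem mat_div_mod (x : ℕ → ℕ) (k : ℕ) : mat n x (k / n) (k % n) = x k := by
  rw [mat, Nat.div_add_mod']

theorem div_lt_and_mod_lt {k : ℕ} (h : k < n * n) : k / n < n ∧ k % n < n := by
  have : 0 < n := by by_contra h0; simp [show n = 0 by omega] at h
  exact ⟨Nat.div_lt_of_lt_mul h, Nat.mod_lt _ this⟩

theorem add_div_and_mod {u v : ℕ} (hv : v < n) : (u * n + v) / n = u ∧ (u * n + v) % n = v := by
  have h0 : 0 < n := by omega
  constructor
  · rw [mul_comm, Nat.mul_add_div h0, Nat.div_eq_of_lt hv, add_zero]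
  · rw [mul_comm, Nat.mul_add_mod, Nat.mod_eq_of_lt hv]

theorem mul_add_lt {u v : ℕ} (hu : u < n) (hv : v < n) : u * n + v < n * n := by nlinarith

theorem mul_add_inj {u v u' v' : ℕ} (hv : v < n) (hv' : v' < n) :
    u * n + v = u' * n + v' ↔ u = u' ∧ v = v' := by
  refine ⟨fun h => ?_, by rintro ⟨rfl, rfl⟩; rfl⟩
  have h1 := add_div_and_mod (u := u) hv
  have h2 := add_div_and_mod (u := u') hv'
  rw [h] at h1
  exact ⟨h1.1.symm.trans h2.1, h1.2.symm.trans h2.2⟩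

theorem forall_lt_mul {P : ℕ → ℕ → Prop} (h : ∀ k < n * n, P (k / n) (k % n)) :
    ∀ u < n, ∀ v < n, P u v := fun u hu v hv => by
  have := h _ (mul_add_lt hu hv)
  rwa [(add_div_and_mod hv).1, (add_div_and_mod hv).2] at this

/-- The graph whose adjacency matrix is stored in the input. -/
def inputAdj (n : ℕ) (I : ℕ → ℕ) (u v : ℕ) : Prop := I (1 + (u * n + v)) ≠ 0

theorem inputAdj_div_mod (k : ℕ) : inputAdj n I (k / n) (k % n) ↔ I (1 + k) ≠ 0 := by
  rw [inputAdj, Nat.div_add_mod']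

open DoubleCover Finset

/-- Row and column sums of the flow. -/
def flowSumsC : Cmd :=
  tabSumC aRow xacc xp xq nE (.read aF (var xp * nE + var xq)) ;;
  tabSumC aCol xacc xp xq nE (.read aF (var xq * nE + var xp))

theorem run_flowSumsC (h : Input b n I s) : Run b flowSumsC s fun s' =>
    (∀ u < n, s' aRow u = ∑ v ∈ range n, mat n (s aF) u v) ∧
      ∀ v < n, s' aCol v = ∑ u ∈ range n, mat n (s aF) u v := by
  refine Run.seq h.two_le (P := fun s' => ∀ u < n, s' aRow u = ∑ v ∈ range n, mat n (s aF) u v) ?_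
    fun s' h1 hF => ?_
  · refine Run.tabSumC h.two_le (n := n) (fun u v => mat n (s aF) u v) (by decide) h.le_cube
      (fun s' h' => (h.of_eq h').nE_eval) ?_ fun s' _ h1 _ => h1
    intro u hu v hv s' h1 h2 h3
    have := (h.of_eq (h3 0 (by decide) (by decide) (by decide) (by decide))).nE_eval
    simp [h1, h2, h3, this, mat]
  · have h' := h.of_eq (hF 0 rfl)
    refine Run.tabSumC h.two_le (n := n) (fun v u => mat n (s aF) u v) (by decide) h.le_cube
      (fun s' h'' => (h'.of_eq h'').nE_eval) ?_ fun s'' h2 h3 _ => ⟨?_, h3⟩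
    · intro u hu v hv s'' h1 h2 h3
      have := (h'.of_eq (h3 0 (by decide) (by decide) (by decide) (by decide))).nE_eval
      simp [h1, h2, h3, this, mat, hF aF rfl]
    · intro u hu
      rw [h2 aRow (by decide) (by decide) (by decide) (by decide)]
      exact h1 u hu

/-- Stamp the unsaturated vertices on the left. -/
def searchInitC : Cmd :=
  tabC aL xp 0 nE (1 - (1 - (.read aCap (var xp) - .read aRow (var xp)))) ;;
  tabC aR xp 0 nE 0

/-- The expression `1 - (1 - x)` is the indicator of `x ≠ 0`, so exactly the unsaturated vertices
receive the stamp `1`. -/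
theorem run_searchInitC (h : Input b n I s) {adj : ℕ → ℕ → Prop}
    (hrow : ∀ u < n, s aRow u = ∑ v ∈ range n, mat n (s aF) u v) :
    Run b searchInitC s fun s' => IsSearch n adj (s aCap) (mat n (s aF)) (s' aL) (s' aR) 1 := by
  refine Run.seq h.two_le
    (P := fun s' => ∀ u < n, s' aL u = 1 - (1 - (s aCap u - s aRow u))) ?_ fun s' h1 hF => ?_
  · refine Run.tabC h.two_le (n := n) (o' := 0) _ (by decide) (by decide) (by decide) h.le_cube
      (fun s' h' => (h.of_eq h').nE_eval) (fun _ _ => rfl) ?_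
      fun s' _ h1 _ u hu => by simpa using h1 u hu
    intro u hu s' h1 h2 _
    simp [h1, h2]
  · have h' := h.of_eq (hF 0 rfl)
    refine Run.tabC h.two_le (n := n) (o' := 0) (fun _ => 0) (by decide) (by decide) (by decide)
      h.le_cube (fun s' h'' => (h'.of_eq h'').nE_eval) (fun _ _ => rfl)
      (fun _ _ _ _ _ _ => by simp) fun s'' h2 h3 _ => ?_
    rw [h2 aL (by decide) (by decide)]
    simp only [zero_add] at h3
    refine ⟨fun u hu hlt => ?_, fun u hu h0 => ?_, fun v hv h0 => absurd (h3 v hv) h0⟩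
    · rw [h1 u hu, hrow u hu]; omega
    · rw [h1 u hu, hrow u hu] at h0 ⊢
      exact ⟨by omega, .inl ⟨by omega, by omega⟩⟩

/-- Extend the search by at most one vertex on either side. -/
def searchStepC : Cmd :=
  findC xr xj (nE * nE) (.read aL (rowE (var xj)) * .read 0 (1 + var xj) *
    (1 - .read aR (colE (var xj)))) ;;
  .ite (var xr) (.assign aR (colE (var xr - 1)) (var xt + var xt + 2)) .skip ;;
  findC xr xj (nE * nE) (.read aR (colE (var xj)) * .read aF (var xj) *
    (1 - .read aL (rowE (var xj)))) ;;
  .ite (var xr) (.assign aL (rowE (var xr - 1)) (var xt + var xt + 2 + 1)) .skip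

/-- Round `t` uses the stamps `2 * t + 2` on the right and `2 * t + 3` on the left. If neither scan
finds a vertex, the search is closed; otherwise the number of stamped vertices keeps pace with the
number of rounds. -/
theorem run_searchStepC (h : Input b n I s) {t : ℕ} (ht : s xt 0 = t) {cap : ℕ → ℕ}
    (hS : IsSearch n (inputAdj n I) cap (mat n (s aF)) (s aL) (s aR) (t + t + 1))
    (hm : t ≤ marks n (s aL) (s aR) ∨
      IsClosed n (inputAdj n I) (mat n (s aF)) (s aL) (s aR)) :
    Run b searchStepC s fun s' =>
      IsSearch n (inputAdj n I) cap (mat n (s aF)) (s' aL) (s' aR) (t + 1 + (t + 1) + 1) ∧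
      (t + 1 ≤ marks n (s' aL) (s' aR) ∨
        IsClosed n (inputAdj n I) (mat n (s aF)) (s' aL) (s' aR)) := by
  have hsq : ∀ {s : State}, Input b n I s → ∀ s', s' 0 = s 0 → (nE * nE).eval s' = n * n :=
    fun h s' h' => by simp [(h.of_eq h').nE_eval]
  have upd : ∀ (s : State) (a i v : ℕ), s.store a i v a = Function.update (s a) i v := by
    intro s a i v; simp [State.store]
  refine Run.seq h.two_le (P := fun s' => (s' xr 0 = 0 ∧ ∀ k < n * n,
      ¬ (s aL (k / n) ≠ 0 ∧ inputAdj n I (k / n) (k % n) ∧ s aR (k % n) = 0)) ∨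
      ∃ k < n * n, s' xr 0 = k + 1 ∧
        (s aL (k / n) ≠ 0 ∧ inputAdj n I (k / n) (k % n) ∧ s aR (k % n) = 0)) ?_ fun s₁ h₁ F₁ => ?_
  · refine Run.findC h.two_le (n := n * n) _ (by decide) (by decide) (by decide) h.sq_le_cube
      (hsq h) ?_ fun s' _ h1 => h1
    intro k hk s' h1 h2
    have h' := h.of_eq (h2 0 (by decide) (by decide))
    simp only [Expr.eval_mul, Expr.eval_read, Expr.eval_sub, Expr.eval_add, Expr.eval_one,
      h'.rowE_eval, h'.colE_eval, Expr.eval_var, h1, h'.eq, inputAdj_div_mod]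
    rw [h2 aL (by decide) (by decide), h2 aR (by decide) (by decide)]
    simp [and_assoc, Nat.sub_eq_zero_iff_le]
  have h' := h.of_eq (F₁ 0 rfl)
  have eL := F₁ aL rfl
  have eR := F₁ aR rfl
  have eF := F₁ aF rfl
  have et : s₁ xt 0 = t := by rw [F₁ xt rfl, ht]
  rw [← eL, ← eR] at h₁ hm hS
  rw [← eF] at hm hS ⊢
  clear eL eR eF F₁ ht
  refine Run.seq h.two_le (P := fun s' =>
      IsSearch n (inputAdj n I) cap (mat n (s₁ aF)) (s' aL) (s' aR) (t + t + 2) ∧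
      ((t + 1 ≤ marks n (s' aL) (s' aR) ∨
        IsClosed n (inputAdj n I) (mat n (s₁ aF)) (s' aL) (s' aR)) ∨
        t ≤ marks n (s' aL) (s' aR) ∧
          ∀ u < n, ∀ v < n, s' aL u ≠ 0 → inputAdj n I u v → s' aR v ≠ 0)) ?_
      fun s₂ h₂ F₂ => ?_
  · refine Run.ite h.two_le (fun h1 => Run.assign ?_) fun h1 => Run.skip ?_
    · rcases h₁ with h₁ | ⟨k, hk, h₁, h2, h3, h4⟩
      · exact absurd h₁.1 h1
      obtain ⟨hk1, hk2⟩ := div_lt_and_mod_lt hk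
      simp only [h'.colE_eval, Expr.eval_sub, Expr.eval_var, Expr.eval_one, h₁, Expr.eval_add,
        Expr.eval_two, Nat.add_sub_cancel, et, upd, State.store_ne _ _ _ (show aL ≠ aR by decide)]
      refine ⟨hS.update_right hk1 h3 h2 h4 (by omega), ?_⟩
      rw [marks_update_right hk2 h4 (by omega)]
      rcases hm with hm | hm
      · exact .inl (.inl (by omega))
      · exact absurd h4 (hm.1 _ hk1 _ hk2 h2 h3)
    · rcases h₁ with ⟨-, h₁⟩ | ⟨k, hk, h₁, -⟩
      · refine ⟨⟨hS.start, fun u hu h0 => ?_, fun u hu h0 => ?_⟩, ?_⟩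
        · have := hS.left u hu h0
          exact ⟨by omega, this.2⟩
        · have := hS.right u hu h0
          exact ⟨by omega, this.2⟩
        · rcases hm with hm | hm
          · refine .inr ⟨hm, ?_⟩
            have := forall_lt_mul
              (P := fun u v => ¬ (s₁ aL u ≠ 0 ∧ inputAdj n I u v ∧ s₁ aR v = 0)) h₁
            intro u hu v hv h3 h4 h5
            exact this u hu v hv ⟨h3, h4, h5⟩
          · exact .inl (.inr hm)
      · simp [h₁] at h1
  have h' := h'.of_eq (F₂ 0 rfl)
  have eF := F₂ aF rfl
  have et : s₂ xt 0 = t := by rw [F₂ xt rfl, et]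
  obtain ⟨hS, hm⟩ := h₂
  rw [← eF] at hm hS ⊢
  clear eF F₂ h₁
  refine Run.seq h.two_le (P := fun s' => (s' xr 0 = 0 ∧ ∀ k < n * n,
      ¬ (s₂ aR (k % n) ≠ 0 ∧ mat n (s₂ aF) (k / n) (k % n) ≠ 0 ∧ s₂ aL (k / n) = 0)) ∨
      ∃ k < n * n, s' xr 0 = k + 1 ∧
        (s₂ aR (k % n) ≠ 0 ∧ mat n (s₂ aF) (k / n) (k % n) ≠ 0 ∧ s₂ aL (k / n) = 0)) ?_
      fun s₃ h₃ F₃ => ?_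
  · refine Run.findC h.two_le (n := n * n) _ (by decide) (by decide) (by decide) h.sq_le_cube
      (hsq h') ?_ fun s' _ h1 => h1
    intro k hk s' h1 h2
    have h' := h'.of_eq (h2 0 (by decide) (by decide))
    simp only [Expr.eval_mul, Expr.eval_read, Expr.eval_sub, Expr.eval_one,
      h'.rowE_eval, h'.colE_eval, Expr.eval_var, h1, mat_div_mod]
    rw [h2 aL (by decide) (by decide), h2 aR (by decide) (by decide),
      h2 aF (by decide) (by decide)]
    simp [and_assoc, Nat.sub_eq_zero_iff_le]
  have h' := h'.of_eq (F₃ 0 rfl)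
  have eL := F₃ aL rfl
  have eR := F₃ aR rfl
  have eF := F₃ aF rfl
  have et : s₃ xt 0 = t := by rw [F₃ xt rfl, et]
  rw [← eL, ← eR, ← eF] at h₃ hm hS
  rw [← eF]
  clear eL eR eF F₃
  refine Run.ite h.two_le (fun h1 => Run.assign ?_) fun h1 => Run.skip ?_
  · rcases h₃ with h₃ | ⟨k, hk, h₃, h2, h3, h4⟩
    · exact absurd h₃.1 h1
    obtain ⟨hk1, hk2⟩ := div_lt_and_mod_lt hk
    simp only [h'.rowE_eval, Expr.eval_sub, Expr.eval_var, Expr.eval_one, h₃, Expr.eval_add,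
      Expr.eval_two, Nat.add_sub_cancel, et, upd, State.store_ne _ _ _ (show aR ≠ aL by decide)]
    refine ⟨?_, ?_⟩
    · convert hS.update_left hk2 h3 h2 h4 (show t + t + 2 < t + t + 2 + 1 by omega) using 1
      omega
    rw [marks_update_left hk1 h4 (by omega)]
    rcases hm with (hm | hm) | hm
    · exact .inl (by omega)
    · exact absurd h4 (hm.2 _ hk1 _ hk2 h2 h3)
    · exact .inl (by omega)
  · rcases h₃ with ⟨-, h₃⟩ | ⟨k, hk, h₃, -⟩
    · refine ⟨⟨hS.start, fun u hu h0 => ?_, fun u hu h0 => ?_⟩, ?_⟩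
      · have := hS.left u hu h0
        exact ⟨by omega, this.2⟩
      · have := hS.right u hu h0
        exact ⟨by omega, this.2⟩
      · rcases hm with hm | hm
        · exact hm
        · refine .inr ⟨hm.2, ?_⟩
          have := forall_lt_mul
            (P := fun u v => ¬ (s₃ aR v ≠ 0 ∧ mat n (s₃ aF) u v ≠ 0 ∧ s₃ aL u = 0)) h₃
          intro u hu v hv h3 h4 h5
          exact this u hu v hv ⟨h3, h4, h5⟩
    · simp [h₃] at h1

end RAM

/-! ### Completing the search and augmenting along stamps. -/

namespace RAM

open DoubleCover Finset

variable {b n : ℕ} {I : ℕ → ℕ} {s : State}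

/-- Search for an augmenting path. -/
def searchC : Cmd := flowSumsC ;; searchInitC ;; forC xt (nE + nE + 1) searchStepC

/-- After `2 * n + 1` rounds the search must be closed, as there are only `2 * n` vertices to stamp.
The bound on the stamps later limits the length of the walk; here `3 ≤ b` is needed. -/
theorem run_searchC (h : Input b n I s) : Run b searchC s fun s' =>
    (∀ v < n, s' aCol v = ∑ u ∈ range n, mat n (s aF) u v) ∧
    (∃ t ≤ b ^ 3, IsSearch n (inputAdj n I) (s aCap) (mat n (s aF)) (s' aL) (s' aR) t) ∧
    IsClosed n (inputAdj n I) (mat n (s aF)) (s' aL) (s' aR) := by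
  refine Run.seq h.two_le (run_flowSumsC h) fun s₁ ⟨h₁, hcol⟩ F₁ => ?_
  have h' := h.of_eq (F₁ 0 rfl)
  rw [← F₁ aF rfl] at h₁ hcol ⊢
  rw [← F₁ aCap rfl]
  clear F₁
  refine Run.seq h.two_le (run_searchInitC (adj := inputAdj n I) h' h₁) fun s₂ h₂ F₂ => ?_
  have h' := h'.of_eq (F₂ 0 rfl)
  rw [← F₂ aF rfl, ← F₂ aCap rfl] at *
  rw [← F₂ aCol rfl] at hcol
  clear F₂
  refine Run.forC h.two_le (n := n + n + 1) (fun t s' =>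
      IsSearch n (inputAdj n I) (s₂ aCap) (mat n (s₂ aF)) (s' aL) (s' aR) (t + t + 1) ∧
      (t ≤ marks n (s' aL) (s' aR) ∨
        IsClosed n (inputAdj n I) (mat n (s₂ aF)) (s' aL) (s' aR))) rfl h.two_mul_le_cube
      (fun s' hs' => by simp [(h'.of_eq hs').nE_eval]) rfl (by decide) ?_ ?_ ?_
  · intro s' _ hs'
    rw [hs' aL (by decide), hs' aR (by decide)]
    exact ⟨h₂, .inl (Nat.zero_le _)⟩
  · intro t ht s' ht' hF ⟨hS, hm⟩
    have hi := h'.of_eq (hF 0 (by decide) rfl)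
    have eF := hF aF (by decide) rfl
    rw [← eF] at hS hm ⊢
    refine (run_searchStepC hi ht' hS hm).conseq fun s₃ h₃ _ s₄ _ h₄ => ?_
    rw [h₄ aL (by decide), h₄ aR (by decide)]
    exact h₃
  · intro s' hF ⟨hS, hm⟩
    refine ⟨fun v hv => by rw [hF aCol (by decide) rfl]; exact hcol v hv, ⟨_, ?_, hS⟩, ?_⟩
    · have h1 := h.three_le; have h2 := h.le
      have : 3 * 3 * b ≤ b * b * b := Nat.mul_le_mul_right b (Nat.mul_le_mul h1 h1)
      nlinarith
    · have := marks_le n (s' aL) (s' aR)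
      exact hm.resolve_left (by omega)

/-- Find an unsaturated vertex that was stamped on the right. -/
def targetC : Cmd :=
  findC xr xj nE (.read aR (var xj) * (.read aCap (var xj) - .read aCol (var xj)))

theorem run_targetC (h : Input b n I s) : Run b targetC s fun s' =>
    (s' xr 0 = 0 ∧ ∀ v < n, s aR v ≠ 0 → s aCap v ≤ s aCol v) ∨
      ∃ v < n, s' xr 0 = v + 1 ∧ s aR v ≠ 0 ∧ s aCol v < s aCap v := by
  refine Run.findC h.two_le (n := n) (fun v => s aR v ≠ 0 ∧ s aCol v < s aCap v) (by decide)
    (by decide) (by decide) h.le_cube (fun s' h' => (h.of_eq h').nE_eval) ?_ fun s' _ h1 => ?_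
  · intro v hv s' h1 h2
    simp [h1, h2, Nat.sub_eq_zero_iff_le]
  · refine h1.imp_left fun h2 => ⟨h2.1, fun v hv h3 => ?_⟩
    have := h2.2 v hv
    push Not at this
    exact this h3

/-- Augment the flow along the path that the stamps describe. -/
def walkC : Cmd :=
  .loop (var xr) (
    findC xu xj nE (.read 0 (1 + (var xj * nE + (var xr - 1))) * .read aL (var xj) *
      (.read aR (var xr - 1) - .read aL (var xj))) ;;
    .assign aF ((var xu - 1) * nE + (var xr - 1))
      (.read aF ((var xu - 1) * nE + (var xr - 1)) + 1) ;;
    .ite (.read aL (var xu - 1) - 1)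
      (findC xy xj nE (.read aF ((var xu - 1) * nE + var xj) * .read aR (var xj) *
        (.read aL (var xu - 1) - .read aR (var xj))) ;;
      .assign aF ((var xu - 1) * nE + (var xy - 1))
        (.read aF ((var xu - 1) * nE + (var xy - 1)) - 1) ;;
      .assign xr 0 (var xy))
      (.assign xr 0 0))

theorem mat_store_of_lt {u v a c x : ℕ} {i : ℕ} (hv : v < n) (hc : c < n) :
    mat n (s.store i (u * n + v) x i) a c = if a = u ∧ c = v then x else mat n (s i) a c := by
  simp [mat, mul_add_inj hc hv]

/-- The walk goes back from an unsaturated vertex on the right. A unit is added on an edge `u v`;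
unless `u` is a starting point, a unit is taken from a flow edge `u w`, and `w` becomes the
unsaturated vertex. The flow is feasible after each round, and its value grows only in the last one.
-/
theorem run_walkC (h : Input b n I s) {cap : ℕ → ℕ} {t : ℕ} (ht : t ≤ b ^ 3)
    (hflow : IsFlow n (inputAdj n I) cap (mat n (s aF)))
    (hS : IsSearch n (inputAdj n I) cap (mat n (s aF)) (s aL) (s aR) t) {v : ℕ} (hv : v < n)
    (hr : s xr 0 = v + 1) (hR : s aR v ≠ 0) (hc : ∑ a ∈ range n, mat n (s aF) a v < cap v) :
    Run b walkC s fun s' => IsFlow n (inputAdj n I) cap (mat n (s' aF)) ∧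
      value n (mat n (s' aF)) = value n (mat n (s aF)) + 1 := by
  -- Rows whose left stamp is below the current right stamp are still unchanged, so the predecessors
  -- recorded there remain usable. The current right stamp is the variant.
  refine Run.loop h.two_le (fun s' => IsFlow n (inputAdj n I) cap (mat n (s' aF)) ∧
      ((s' xr 0 = 0 ∧ value n (mat n (s' aF)) = value n (mat n (s aF)) + 1) ∨
      ∃ v < n, s' xr 0 = v + 1 ∧ s aR v ≠ 0 ∧ ∑ a ∈ range n, mat n (s' aF) a v < cap v ∧
        value n (mat n (s' aF)) = value n (mat n (s aF)) ∧
        ∀ a < n, s aL a < s aR v → ∀ c < n, mat n (s' aF) a c = mat n (s aF) a c))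
    (fun s' => if s' xr 0 = 0 then 0 else s aR (s' xr 0 - 1))
    ⟨hflow, .inr ⟨v, hv, hr, hR, hc, rfl, fun _ _ _ _ _ => rfl⟩⟩ ?_ ?_ ?_
  · simp only [hr]
    have := (hS.right v hv hR).1
    simp; omega
  · rintro s₁ ⟨hfl, h₁⟩ he F₁
    rcases h₁ with h₁ | ⟨v, hv, hr₁, hR, hc₁, hval, hsame⟩
    · exact absurd h₁.1 he
    clear hr hc
    have hr₀ := hr₁
    have h' := h.of_eq (F₁ 0 rfl)
    have eL := F₁ aL rfl
    have eR := F₁ aR rfl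
    clear F₁
    obtain ⟨hRt, u₀, hu₀, ha₀, hL₀, hlt₀⟩ := hS.right v hv hR
    refine Run.seq h.two_le (P := fun s' => (∀ a, a ≠ xu → a ≠ xj → s' a = s₁ a) ∧
      ∃ u < n, s' xu 0 = u + 1 ∧ inputAdj n I u v ∧ s aL u ≠ 0 ∧ s aL u < s aR v) ?_
      fun s₂ ⟨F₂, u, hu, hxu, hadj, hL, hlt⟩ _ => ?_
    · refine Run.findC h.two_le (n := n)
        (fun u => inputAdj n I u v ∧ s aL u ≠ 0 ∧ s aL u < s aR v) (by decide) (by decide)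
        (by decide) h.le_cube (fun s' hs' => (h'.of_eq hs').nE_eval) ?_ fun s' hs' h1 => ⟨hs', ?_⟩
      · intro u hu s' h1 h2
        have hi := h'.of_eq (h2 0 (by decide) (by decide))
        simp [h1, hi.nE_eval, hi.eq, h2, hr₁, eL, eR, inputAdj, and_assoc,
          Nat.sub_eq_zero_iff_le]
      · rcases h1 with h1 | ⟨u, hu, h1, h2⟩
        · exact absurd ⟨ha₀, hL₀, hlt₀⟩ (h1.2 u₀ hu₀)
        · exact ⟨u, hu, h1, h2⟩
    have h' := h'.of_eq (F₂ 0 (by decide) (by decide))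
    rw [← F₂ aL (by decide) (by decide)] at eL
    rw [← F₂ aR (by decide) (by decide)] at eR
    rw [← F₂ xr (by decide) (by decide)] at hr₁
    rw [← F₂ aF (by decide) (by decide)] at hfl hc₁ hval hsame
    clear F₂
    refine Run.seq_assign h.two_le ?_
    simp only [Expr.eval_add, Expr.eval_mul, Expr.eval_sub, Expr.eval_var, Expr.eval_one, hr₁, hxu,
      Nat.add_sub_cancel, h'.nE_eval, Expr.eval_read]
    set s₃ := s₂.store aF (u * n + v) (s₂ aF (u * n + v) + 1) with hs₃
    have F₃ : ∀ a, a ≠ aF → s₃ a = s₂ a := fun a ha => by simp [hs₃, ha]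
    have m₃ : ∀ a < n, ∀ c < n, mat n (s₃ aF) a c =
        mat n (s₂ aF) a c + if a = u ∧ c = v then 1 else 0 := by
      intro a ha c hc
      rw [hs₃, mat_store_of_lt hv hc]
      split_ifs with h
      · rw [h.1, h.2]; rfl
      · simp
    have h₃ := h'.of_eq (F₃ 0 (by decide))
    rw [← F₃ aL (by decide)] at eL
    rw [← F₃ aR (by decide)] at eR
    have hxu₃ : s₃ xu 0 = u + 1 := by rw [F₃ xu (by decide), hxu]
    refine Run.ite h.two_le (fun h1 => ?_) fun h1 => Run.assign ?_
    · simp only [Expr.eval_sub, Expr.eval_var, Expr.eval_one, Expr.eval_read, hxu₃, eL,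
        Nat.add_sub_cancel] at h1
      obtain ⟨hLt, hpre⟩ := hS.left u hu hL
      rcases hpre with hpre | ⟨w₀, hw₀, hF₀, hR₀, hlt₁⟩
      · omega
      have hne : ∀ w, s aR w < s aL u → w ≠ v := by
        rintro w hw rfl; omega
      refine Run.seq h.two_le (P := fun s' => (∀ a, a ≠ xy → a ≠ xj → s' a = s₃ a) ∧
        ∃ w < n, s' xy 0 = w + 1 ∧ mat n (s₂ aF) u w ≠ 0 ∧ s aR w ≠ 0 ∧ s aR w < s aL u) ?_
        fun s₄ ⟨F₄, w, hw, hxy, hFw, hRw, hltw⟩ _ => ?_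
      · refine Run.findC h.two_le (n := n)
          (fun w => mat n (s₃ aF) u w ≠ 0 ∧ s aR w ≠ 0 ∧ s aR w < s aL u) (by decide) (by decide)
          (by decide) h.le_cube (fun s' hs' => (h₃.of_eq hs').nE_eval) ?_
          fun s' hs' h1 => ⟨hs', ?_⟩
        · intro w hw s' h1 h2
          have hi := h₃.of_eq (h2 0 (by decide) (by decide))
          simp [h1, hi.nE_eval, h2, hxu₃, eL, eR, mat, and_assoc, Nat.sub_eq_zero_iff_le]
        · have e : ∀ w < n, s aR w < s aL u → mat n (s₃ aF) u w = mat n (s₂ aF) u w := by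
            intro w hw hw'
            rw [m₃ u hu w hw]; simp [hne w hw']
          rcases h1 with h1 | ⟨w, hw, h1, h2, h3, h4⟩
          · refine absurd ⟨?_, hR₀, hlt₁⟩ (h1.2 w₀ hw₀)
            rw [e w₀ hw₀ hlt₁, hsame u hu hlt w₀ hw₀]
            exact hF₀
          · exact ⟨w, hw, h1, by rwa [← e w hw h4], h3, h4⟩
      have h₄ := h₃.of_eq (F₄ 0 (by decide) (by decide))
      have hxu₄ : s₄ xu 0 = u + 1 := by rw [F₄ xu (by decide) (by decide), hxu₃]
      have eF := F₄ aF (by decide) (by decide)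
      refine Run.seq_assign h.two_le (Run.assign ?_)
      simp only [Expr.eval_add, Expr.eval_mul, Expr.eval_sub, Expr.eval_var, Expr.eval_one, hxy,
        hxu₄, Nat.add_sub_cancel, h₄.nE_eval, Expr.eval_read, Expr.eval_zero]
      set s₅ := s₄.store aF (u * n + w) (s₄ aF (u * n + w) - 1) with hs₅
      have e₅ : ∀ x, s₅.store xr 0 x aF = s₅ aF := fun x => by simp
      have e₆ : s₅ xy 0 = w + 1 := by rw [hs₅]; simp [hxy]
      have m₅ : ∀ a < n, ∀ c < n, mat n (s₅ aF) a c = if a = u ∧ c = w then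
          mat n (s₂ aF) a c - 1 else mat n (s₂ aF) a c + if a = u ∧ c = v then 1 else 0 := by
        intro a ha c hc
        rw [hs₅, mat_store_of_lt hw hc, eF, m₃ a ha c hc]
        by_cases h : a = u ∧ c = w
        · have := m₃ a ha c hc
          rw [if_neg fun h2 => hne w hltw (h.2.symm.trans h2.2), add_zero] at this
          rw [if_pos h, if_pos h, ← h.1, ← h.2]
          exact congrArg (· - 1) this
        · rw [if_neg h, if_neg h]
      obtain ⟨g1, g2, g3⟩ := hfl.shift_unit hu hv hw (hne w hltw) hadj hc₁ hFw m₅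
      simp only [e₅, State.store_self, e₆, if_true]
      refine ⟨⟨g1, .inr ⟨w, hw, rfl, hRw, g3, g2.trans hval, fun a ha hlt' c hc => ?_⟩⟩, ?_⟩
      · have : a ≠ u := by rintro rfl; omega
        rw [m₅ a ha c hc]
        simp only [this, false_and, if_false, add_zero]
        exact hsame a ha (by omega) c hc
      · simp only [hr₀, Nat.add_sub_cancel, Nat.add_one_ne_zero, if_false]
        omega
    · simp only [Expr.eval_sub, Expr.eval_var, Expr.eval_one, Expr.eval_read, hxu₃, eL,
        Nat.add_sub_cancel] at h1
      have hru : ∑ c ∈ range n, mat n (s₂ aF) u c < cap u := by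
        rw [sum_congr rfl fun c hc => hsame u hu hlt c (mem_range.1 hc)]
        rcases (hS.left u hu hL).2 with h2 | ⟨w, -, -, h2, h3⟩
        · exact h2.2
        · omega
      obtain ⟨g1, g2⟩ := hfl.add_unit hu hv hadj hru hc₁ m₃
      refine ⟨⟨by simpa using g1, .inl ⟨by simp, ?_⟩⟩, ?_⟩
      · rw [State.store_ne _ _ _ (by decide), g2, hval]
      · simp [hr₀]; omega
  · rintro s₁ ⟨hfl, h₁⟩ he F₁
    rcases h₁ with h₁ | ⟨v, hv, hr₁, -⟩
    · exact ⟨hfl, h₁.2⟩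
    · simp [hr₁] at he

end RAM

/-! ### Maximum flow by capacity scaling. -/

namespace RAM

open DoubleCover Finset

variable {b n : ℕ} {I : ℕ → ℕ} {s : State}

/-- Search for an augmenting path and augment the flow by one unit if there is one. -/
def roundC : Cmd := searchC ;; targetC ;; walkC

/-- The stamps of the last search describe a cover whose weight is the value of the flow. -/
def IsTight (n : ℕ) (I cap : ℕ → ℕ) (s : State) : Prop :=
  IsCover n (inputAdj n I) (s aL) (s aR) ∧
    value n (mat n (s aF)) = coverWeight n cap (s aL) (s aR)

/-- Without an unsaturated stamped vertex on the right, the walk makes no iteration and the stamps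
certify optimality. -/
theorem run_roundC (h : Input b n I s) {cap : ℕ → ℕ} (hcap : s aCap = cap)
    (hflow : IsFlow n (inputAdj n I) cap (mat n (s aF))) : Run b roundC s fun s' =>
    IsFlow n (inputAdj n I) cap (mat n (s' aF)) ∧
      (value n (mat n (s' aF)) = value n (mat n (s aF)) + 1 ∨ IsTight n I cap s') := by
  subst hcap
  refine Run.seq h.two_le (run_searchC h) fun s₁ ⟨hcol, ⟨t, ht, hS⟩, hC⟩ F₁ => ?_
  have h' := h.of_eq (F₁ 0 rfl)
  rw [← F₁ aF rfl] at hcol hS hC hflow ⊢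
  rw [← F₁ aCap rfl] at hS hflow ⊢
  refine Run.seq h.two_le (run_targetC h') fun s₂ h₂ F₂ => ?_
  have h' := h'.of_eq (F₂ 0 rfl)
  rw [← F₂ aF rfl, ← F₂ aCap rfl, ← F₂ aL rfl, ← F₂ aR rfl, ← F₂ aCol rfl] at *
  rcases h₂ with ⟨hr, h₂⟩ | ⟨v, hv, hr, hRv, hlt⟩
  · refine Run.loop h.two_le (fun s' => s' = s₂) (fun _ => 0) rfl (Nat.zero_le _) ?_ ?_
    · rintro s' rfl he
      exact absurd hr he
    · rintro s' rfl - -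
      obtain ⟨g1, g2⟩ := hflow.value_eq_of_isClosed hS hC fun v hv hR =>
        (h₂ v hv hR).trans (hcol v hv).le
      exact ⟨hflow, .inr ⟨g1, g2⟩⟩
  · refine (run_walkC h' ht hflow hS hv hr hRv (by rw [← hcol v hv]; exact hlt)).conseq ?_
    rintro s' ⟨g1, g2⟩ -
    exact ⟨g1, .inl g2⟩

/-- Halve the unit of the capacities and make the flow maximal again. -/
def phaseC : Cmd :=
  .assign xP 0 (var xP / 2) ;;
  tabC aCap xp 0 nE (.read aW (var xp) / var xP) ;;
  tabC aF xj 0 (nE * nE) (.read aF (var xj) + .read aF (var xj)) ;;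
  forC xk (nE + nE + 1) roundC

theorem coverWeight_le_of_le {cap cap' L R : ℕ → ℕ} (h : ∀ v < n, cap' v ≤ 2 * cap v + 1) :
    coverWeight n cap' L R ≤ 2 * coverWeight n cap L R + 2 * n := by
  have : ∀ u ∈ range n, ((if L u = 0 then cap' u else 0) + if R u ≠ 0 then cap' u else 0) ≤
      2 * ((if L u = 0 then cap u else 0) + if R u ≠ 0 then cap u else 0) + 2 := fun u hu => by
    have := h u (mem_range.1 hu)
    split_ifs <;> omega
  refine (sum_le_sum this).trans_eq ?_
  rw [sum_add_distrib, ← mul_sum]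
  simp [coverWeight, mul_comm]

/-- Since $2\lfloor x/2P\rfloor\le\lfloor x/P\rfloor\le 2\lfloor x/2P\rfloor+1$, the doubled flow is
feasible and the old optimal cover exceeds its value by at most $2n$. Hence not all $2n+1$ rounds
can augment. -/
theorem run_phaseC (h : Input b n I s) {P : ℕ} (hP : s xP 0 = 2 * P)
    (hcap : ∀ v < n, s aCap v = s aW v / (2 * P))
    (hflow : IsFlow n (inputAdj n I) (s aCap) (mat n (s aF)))
    (hopt : ∃ L R, IsCover n (inputAdj n I) L R ∧
      value n (mat n (s aF)) = coverWeight n (s aCap) L R) : Run b phaseC s fun s' =>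
    s' xP 0 = P ∧ (∀ v < n, s' aCap v = s aW v / P) ∧
    IsFlow n (inputAdj n I) (s' aCap) (mat n (s' aF)) ∧ IsTight n I (s' aCap) s' := by
  refine Run.seq_assign h.two_le ?_
  simp only [Expr.eval_zero, Expr.eval_div, Expr.eval_var, hP, Expr.eval_two,
    show 2 * P / 2 = P by omega]
  set s₁ := s.store xP 0 P with hs₁
  have F₁ : ∀ a, a ≠ xP → s₁ a = s a := fun a ha => by simp [hs₁, ha]
  have hP₁ : s₁ xP 0 = P := by simp [hs₁]
  have h' := h.of_eq (F₁ 0 (by decide))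
  rw [← F₁ aCap (by decide)] at hcap hflow hopt
  rw [← F₁ aF (by decide)] at hflow hopt
  rw [← F₁ aW (by decide)] at hcap ⊢
  clear_value s₁
  clear hP hs₁ F₁
  refine Run.seq h.two_le (P := fun s' => ∀ v < n, s' aCap v = s₁ aW v / P) ?_ fun s₂ h₂ F₂ => ?_
  · refine Run.tabC h.two_le (n := n) (o' := 0) (fun v => s₁ aW v / P) (by decide) (by decide)
      (by decide) h.le_cube (fun s' hs' => (h'.of_eq hs').nE_eval) (fun _ _ => rfl) ?_
      fun s' _ h1 _ => by simpa using h1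
    intro v hv s' h1 h2 _
    simp [h1, h2, hP₁]
  have h' := h'.of_eq (F₂ 0 rfl)
  have e1 := F₂ aF rfl
  have e2 := F₂ xP rfl
  rw [← e1] at hflow hopt
  rw [← e2] at hP₁
  clear e1 e2 F₂
  refine Run.seq h.two_le (P := fun s' => ∀ u < n, ∀ v < n, mat n (s' aF) u v =
    2 * mat n (s₂ aF) u v) ?_ fun s₃ h₃ F₃ => ?_
  · refine Run.tabC h.two_le (n := n * n) (o' := 0) (fun k => s₂ aF k + s₂ aF k) (by decide)
      (by decide) (by decide) h.sq_le_cube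
      (fun s' hs' => by simp [(h'.of_eq hs').nE_eval]) (fun _ _ => rfl) ?_
      fun s' _ h1 _ u hu v hv => ?_
    · intro k hk s' h1 h2 h3
      have := h3 k (.inr (by omega))
      simp [h1, this]
    · have := h1 _ (mul_add_lt hu hv)
      rw [zero_add] at this
      simp only [mat, this]; omega
  have h' := h'.of_eq (F₃ 0 rfl)
  rw [← F₃ aCap rfl] at h₂
  rw [← F₃ xP rfl] at hP₁
  have hle : ∀ v < n, s₃ aCap v ≤ 2 * s₁ aCap v + 1 ∧ 2 * s₁ aCap v ≤ s₃ aCap v := by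
    intro v hv
    rw [h₂ v hv, hcap v hv, mul_comm 2 P, ← Nat.div_div_eq_div_mul]
    omega
  have hval : value n (mat n (s₃ aF)) = 2 * value n (mat n (s₂ aF)) := by
    simp only [value, mul_sum]
    exact sum_congr rfl fun u hu => sum_congr rfl fun v hv =>
      h₃ u (mem_range.1 hu) v (mem_range.1 hv)
  have hflow₃ : IsFlow n (inputAdj n I) (s₃ aCap) (mat n (s₃ aF)) := by
    refine ⟨fun u hu => ?_, fun v hv => ?_, fun u hu v hv h0 => ?_⟩
    · rw [sum_congr rfl fun v hv => h₃ u hu v (mem_range.1 hv), ← mul_sum]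
      exact (Nat.mul_le_mul_left 2 (hflow.row u hu)).trans (hle u hu).2
    · rw [sum_congr rfl fun u hu => h₃ u (mem_range.1 hu) v hv, ← mul_sum]
      exact (Nat.mul_le_mul_left 2 (hflow.col v hv)).trans (hle v hv).2
    · rw [h₃ u hu v hv] at h0
      exact hflow.supp u hu v hv (by omega)
  obtain ⟨L₀, R₀, hcov, hL₀⟩ := hopt
  have hbound := coverWeight_le_of_le (L := L₀) (R := R₀) fun v hv => (hle v hv).1
  refine Run.forC h.two_le (n := n + n + 1) (fun k s' =>
      IsFlow n (inputAdj n I) (s₃ aCap) (mat n (s' aF)) ∧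
      (value n (mat n (s₃ aF)) + k ≤ value n (mat n (s' aF)) ∨ IsTight n I (s₃ aCap) s')) rfl
      h.two_mul_le_cube (fun s' hs' => by simp [(h'.of_eq hs').nE_eval]) rfl (by decide) ?_ ?_ ?_
  · intro s' _ hs'
    rw [hs' aF (by decide)]
    exact ⟨hflow₃, .inl le_rfl⟩
  · intro k hk s' _ hF ⟨hfl, hk'⟩
    have hi := h'.of_eq (hF 0 (by decide) rfl)
    refine (run_roundC hi (hF aCap (by decide) rfl) hfl).conseq ?_
    rintro s₄ ⟨hfl', h4⟩ - s₅ - h₅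
    have : IsTight n I (s₃ aCap) s₅ ↔ IsTight n I (s₃ aCap) s₄ := by
      simp only [IsTight, h₅ aF (by decide), h₅ aL (by decide), h₅ aR (by decide)]
    rw [this, h₅ aF (by decide)]
    refine ⟨hfl', ?_⟩
    rcases h4 with h4 | h4
    · rcases hk' with hk' | hk'
      · exact .inl (by omega)
      -- Once the flow is tight, another augmentation would violate weak duality.
      · have h5 := hfl'.value_le hk'.1
        have h6 := hk'.2
        omega
    · exact .inr h4
  · intro s' hF ⟨hfl, hk'⟩
    have ecap : s' aCap = s₃ aCap := hF aCap (by decide) rfl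
    have exP : s' xP = s₃ xP := hF xP (by decide) rfl
    rw [ecap, exP]
    refine ⟨hP₁, h₂, hfl, hk'.resolve_left fun hk' => ?_⟩
    have := hfl.value_le hcov
    omega

/-- A minimum weight vertex cover of the double cover for the weights in `aW`. -/
def flowC : Cmd :=
  sumC xs xp nE (.read aW (var xp)) ;;
  .assign xP 0 2 ;;
  .loop (var xs + 1 - var xP) (.assign xP 0 (var xP + var xP)) ;;
  .loop (var xP - 1) phaseC

/-- The unit starts at a power of two above the total weight, where capacities and flow vanish, and
ends at one, where capacities are the weights. It is at least two initially, so that at least one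
phase runs and leaves a certificate even when all weights are zero. -/
theorem run_flowC (h : Input b n I s) {m : ℕ} (hm : 0 < m) (hmb : m ≤ b ^ 3)
    (hW : ∑ v ∈ range n, s aW v < 2 ^ m) (hcap : s aCap = 0) (hF0 : s aF = 0) :
    Run b flowC s fun s' => IsCover n (inputAdj n I) (s' aL) (s' aR) ∧
      ∀ L R, IsCover n (inputAdj n I) L R →
        coverWeight n (s aW) (s' aL) (s' aR) ≤ coverWeight n (s aW) L R := by
  refine Run.seq h.two_le (P := fun s' => s' xs 0 = ∑ v ∈ range n, s aW v) ?_ fun s₁ h₁ F₁ => ?_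
  · exact Run.sumC h.two_le (n := n) (fun v => s aW v) (by decide) (by decide) (by decide)
      h.le_cube (fun s' hs' => (h.of_eq hs').nE_eval) (fun v _ s' h1 h2 => by simp [h1, h2])
      fun s' _ h1 => h1
  have h' := h.of_eq (F₁ 0 rfl)
  rw [← F₁ aW rfl] at h₁ hW ⊢
  rw [← F₁ aCap rfl] at hcap
  rw [← F₁ aF rfl] at hF0
  clear F₁
  refine Run.seq_assign h.two_le ?_
  refine Run.seq h.two_le
    (P := fun s' => ∃ k ≤ m, 0 < k ∧ s' xP 0 = 2 ^ k ∧ ∑ v ∈ range n, s₁ aW v < 2 ^ k) ?_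
    fun s₂ h₂ F₂ => ?_
  · refine Run.loop h.two_le (fun s' => ∃ k ≤ m, 0 < k ∧ s' xP 0 = 2 ^ k)
      (fun s' => m - Nat.log 2 (s' xP 0)) ⟨1, hm, one_pos, by simp⟩ (by omega) ?_ ?_
    · rintro s' ⟨k, hk, hk0, hP⟩ he F
      have e1 : s' xs 0 = ∑ v ∈ range n, s₁ aW v := by
        rw [F xs rfl, State.store_ne _ _ _ (by decide), h₁]
      have hkm : k < m := by
        by_contra hcon
        have : 2 ^ m ≤ 2 ^ k := Nat.pow_le_pow_right (by norm_num) (by omega)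
        simp [e1, hP] at he
        omega
      refine Run.assign ?_
      have e2 : (s'.store xP ((0 : Expr).eval s') ((var xP + var xP).eval s')) xP 0 =
          2 ^ (k + 1) := by
        simp [hP, pow_succ]; omega
      rw [e2, hP, Nat.log_pow (by norm_num), Nat.log_pow (by norm_num)]
      exact ⟨⟨k + 1, hkm, by omega, rfl⟩, by omega⟩
    · rintro s' ⟨k, hk, hk0, hP⟩ he F
      have e1 : s' xs 0 = ∑ v ∈ range n, s₁ aW v := by
        rw [F xs rfl, State.store_ne _ _ _ (by decide), h₁]
      refine ⟨k, hk, hk0, hP, ?_⟩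
      simp [e1, hP] at he
      omega
  have F₂' : ∀ a, a ≠ xP → s₂ a = s₁ a := fun a ha => by
    rw [F₂ a (by simp [Cmd.writes, Ne.symm ha]), State.store_ne _ _ _ ha]
  have h' := h'.of_eq (F₂' 0 (by decide))
  rw [← F₂' aW (by decide)] at h₂ ⊢
  rw [← F₂' aCap (by decide)] at hcap
  rw [← F₂' aF (by decide)] at hF0
  clear F₂ F₂' h₁ hW
  obtain ⟨k, hkm, hk0, hP, hW⟩ := h₂
  refine Run.loop h.two_le (fun s' => ∃ k ≤ m, s' xP 0 = 2 ^ k ∧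
      (∀ v < n, s' aCap v = s₂ aW v / 2 ^ k) ∧
      IsFlow n (inputAdj n I) (s' aCap) (mat n (s' aF)) ∧
      (∃ L R, IsCover n (inputAdj n I) L R ∧
        value n (mat n (s' aF)) = coverWeight n (s' aCap) L R) ∧
      (k = 0 → IsTight n I (s' aCap) s'))
    (fun s' => Nat.log 2 (s' xP 0)) ⟨k, hkm, hP, ?_, ?_, ?_, ?_⟩ ?_ ?_ ?_
  · intro v hv
    have : s₂ aW v ≤ ∑ v ∈ range n, s₂ aW v :=
      single_le_sum (f := fun v => s₂ aW v) (fun _ _ => Nat.zero_le _) (mem_range.2 hv)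
    rw [Nat.div_eq_of_lt (this.trans_lt hW), hcap]; rfl
  · rw [hF0, hcap]
    exact ⟨by simp [mat], by simp [mat], by simp [mat]⟩
  · refine ⟨fun _ => 1, fun _ => 1, fun u _ v _ _ _ => one_ne_zero, ?_⟩
    rw [hF0, hcap]; simp [value, mat, coverWeight]
  · omega
  · rw [hP, Nat.log_pow (by norm_num)]; omega
  · rintro s' ⟨k, hk, hP, hcap', hfl, hopt, -⟩ he F
    simp only [Expr.eval_sub, Expr.eval_var, Expr.eval_one, hP] at he
    obtain _ | k := k
    · simp at he
    refine (run_phaseC (h'.of_eq (F 0 rfl)) (P := 2 ^ k) (by rw [hP, pow_succ, mul_comm])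
      (fun v hv => by rw [hcap' v hv, F aW rfl, pow_succ, mul_comm]) hfl hopt).conseq ?_
    rintro s'' ⟨g1, g2, g3, g4⟩ -
    refine ⟨⟨k, by omega, g1, fun v hv => by rw [g2 v hv, F aW rfl], g3, ⟨_, _, g4⟩, fun _ => g4⟩, ?_⟩
    rw [g1, hP, Nat.log_pow (by norm_num), Nat.log_pow (by norm_num)]; omega
  · rintro s' ⟨k, hk, hP, hcap', hfl, hopt, ht⟩ he F
    simp only [Expr.eval_sub, Expr.eval_var, Expr.eval_one, hP] at he
    have hk0 : k = 0 := by
      by_contra h0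
      have := Nat.one_lt_two_pow h0
      omega
    obtain ⟨g1, g2⟩ := ht hk0
    refine ⟨g1, fun L R hLR => ?_⟩
    have e : ∀ L R, coverWeight n (s₂ aW) L R = coverWeight n (s' aCap) L R := by
      intro L R
      refine sum_congr rfl fun v hv => ?_
      rw [hcap' v (mem_range.1 hv), hk0]; simp
    rw [e, e, ← g2]
    exact hfl.value_le hLR

end RAM

/-! ### Forest test by peeling, and the reverse pass of local ratio. -/

namespace RAM

open FVS Finset

variable {b n : ℕ} {I : ℕ → ℕ} {s : State}

/-- The symmetric multigraph that is stored in `x` from position `o` on. -/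
def graphAt (n : ℕ) (x : ℕ → ℕ) (o : ℕ) : ℕ → ℕ → ℕ :=
  fun p q => if p < n ∧ q < n then x (o + (p * n + q)) else 0

/-- The vertices that are marked by a nonzero entry of `x`. -/
def marked (n : ℕ) (x : ℕ → ℕ) : Finset ℕ := {p ∈ range n | x p ≠ 0}

theorem mem_marked {x : ℕ → ℕ} {p : ℕ} : p ∈ marked n x ↔ p < n ∧ x p ≠ 0 := by simp [marked]

theorem graphAt_of_lt {x : ℕ → ℕ} {o p q : ℕ} (hp : p < n) (hq : q < n) :
    graphAt n x o p q = x (o + (p * n + q)) := by simp [graphAt, hp, hq]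

/-- A product of two computed cells would not be tame. The selection is therefore written as a
subtraction, which is bounded by its first operand. -/
theorem degIn_marked {x u : ℕ → ℕ} {o p : ℕ} (hp : p < n) :
    degIn (graphAt n x o) (marked n u) p =
      ∑ q ∈ range n, (x (o + (p * n + q)) - (1 - u q) * x (o + (p * n + q))) := by
  rw [degIn, marked, sum_filter]
  refine sum_congr rfl fun q hq => ?_
  rw [graphAt_of_lt hp (mem_range.1 hq)]
  split_ifs with h
  · rw [show 1 - u q = 0 by omega]; simp
  · rw [not_not.1 h]; simp

theorem marked_update_zero {x : ℕ → ℕ} {a : ℕ} :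
    marked n (Function.update x a 0) = (marked n x).erase a := by
  ext p
  by_cases hp : p = a <;> simp [mem_marked, hp]

theorem marked_update_one {x : ℕ → ℕ} {a : ℕ} (ha : a < n) :
    marked n (Function.update x a 1) = insert a (marked n x) := by
  ext p
  by_cases hp : p = a <;> simp [mem_marked, hp, ha]

/-- The vertex `p` with `r = p + 1`, if any, has degree at most one and is removed. -/
def PeelStep (A : ℕ → ℕ → ℕ) (U U' : Finset ℕ) (r : ℕ) : Prop :=
  (r = 0 ∧ U' = U) ∨ ∃ p ∈ U, r = p + 1 ∧ degIn A U p ≤ 1 ∧ U' = U.erase p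

theorem PeelStep.isForest_iff {A : ℕ → ℕ → ℕ} {U U' : Finset ℕ} {r : ℕ} (h : PeelStep A U U' r)
    (hd : ∀ p, A p p = 0) : IsForest A U ↔ IsForest A U' := by
  rcases h with ⟨-, rfl⟩ | ⟨p, hp, -, hdeg, rfl⟩
  · rfl
  · refine ⟨fun h => h.mono (erase_subset _ _), fun h => ?_⟩
    rw [← insert_erase hp]
    exact h.insert_of_degIn_le ((degIn_mono (erase_subset _ _) _).trans hdeg) (hd p)

/-- `n` times remove a vertex of degree at most one from the vertices marked in `aU`, and record
the removed vertices in `aOrd`. -/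
def peelC : Cmd :=
  forC xt nE (
    tabSumC aDeg xacc xp xq nE (.read aAA (var xo + (var xp * nE + var xq)) -
      (1 - .read aU (var xq)) * .read aAA (var xo + (var xp * nE + var xq))) ;;
    findC xr xj nE (.read aU (var xj) * (2 - .read aDeg (var xj))) ;;
    .assign aOrd (var xt) (var xr) ;;
    .ite (var xr) (.assign aU (var xr - 1) 0) .skip)

/-- A round removes a vertex unless the minimum degree is already two, after which nothing changes.
So `n` rounds either empty the set or get stuck. -/
theorem run_peelC (h : Input b n I s) {o : ℕ} (ho : s xo 0 = o) :
    Run b peelC s fun s' => ∃ Us : ℕ → Finset ℕ, Us 0 = marked n (s aU) ∧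
      (∀ t < n, PeelStep (graphAt n (s aAA) o) (Us t) (Us (t + 1)) (s' aOrd t)) ∧
      Us n = marked n (s' aU) ∧
      (Us n = ∅ ∨ ∀ p ∈ Us n, 2 ≤ degIn (graphAt n (s aAA) o) (Us n) p) := by
  set A := graphAt n (s aAA) o with hA
  refine Run.forC h.two_le (n := n) (fun t s' => ∃ Us : ℕ → Finset ℕ, Us 0 = marked n (s aU) ∧
      (∀ t' < t, PeelStep A (Us t') (Us (t' + 1)) (s' aOrd t')) ∧
      Us t = marked n (s' aU) ∧
      (#(Us t) + t ≤ n ∨ ∀ p ∈ Us t, 2 ≤ degIn A (Us t) p)) rfl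
      h.le_cube (fun s' hs' => (h.of_eq hs').nE_eval) rfl (by decide) ?_ ?_ ?_
  · intro s' _ hs'
    refine ⟨fun _ => marked n (s aU), rfl, by simp, by rw [hs' aU (by decide)], .inl ?_⟩
    have := card_filter_le (range n) fun p => s aU p ≠ 0
    rw [card_range] at this
    exact this
  · rintro t ht s₁ ht₁ hF ⟨Us, h0, hst, hU, hc⟩
    have h' := h.of_eq (hF 0 (by decide) rfl)
    have hA₁ : A = graphAt n (s₁ aAA) o := by rw [hF aAA (by decide) rfl]
    have ho₁ : s₁ xo 0 = o := by rw [hF xo (by decide) rfl, ho]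
    clear hF
    refine Run.seq h.two_le (P := fun s' => ∀ p < n, s' aDeg p = degIn A (Us t) p) ?_
      fun s₂ h₂ F₂ => ?_
    · refine Run.tabSumC h.two_le (n := n) (fun p q => s₁ aAA (o + (p * n + q)) -
        (1 - s₁ aU q) * s₁ aAA (o + (p * n + q))) (by decide) h.le_cube
        (fun s' hs' => (h'.of_eq hs').nE_eval) ?_ fun s' _ h1 _ p hp => ?_
      · intro p hp q hq s' h1 h2 h3
        have := (h'.of_eq (h3 0 (by decide) (by decide) (by decide) (by decide))).nE_eval
        simp [h1, h2, h3, this, ho₁]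
      · rw [h1 p hp, hU, hA₁, degIn_marked hp]
    have h' := h'.of_eq (F₂ 0 rfl)
    rw [← F₂ xt rfl] at ht₁
    have eU := F₂ aU rfl
    have eO := F₂ aOrd rfl
    rw [← eU] at hU
    rw [← eO] at hst
    clear eU eO F₂ hA₁ ho₁
    refine Run.seq h.two_le (P := fun s' => (s' xr 0 = 0 ∧ ∀ p ∈ Us t, 2 ≤ degIn A (Us t) p) ∨
      ∃ p ∈ Us t, s' xr 0 = p + 1 ∧ degIn A (Us t) p ≤ 1) ?_ fun s₃ h₃ F₃ => ?_
    · refine Run.findC h.two_le (n := n) (fun p => s₂ aU p ≠ 0 ∧ s₂ aDeg p < 2) (by decide)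
        (by decide) (by decide) h.le_cube (fun s' h'' => (h'.of_eq h'').nE_eval) ?_
        fun s' _ h1 => ?_
      · intro v hv s' h1 h2
        simp [h1, h2, Nat.sub_eq_zero_iff_le]
      · rcases h1 with ⟨h1, h3⟩ | ⟨p, hp, h1, h3, h4⟩
        · refine .inl ⟨h1, fun p hp => ?_⟩
          have hp' := mem_marked.1 (hU ▸ hp)
          have := h3 p hp'.1
          rw [h₂ p hp'.1] at this
          by_contra hcon
          exact this ⟨hp'.2, by omega⟩
        · refine .inr ⟨p, hU ▸ mem_marked.2 ⟨hp, h3⟩, h1, ?_⟩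
          rw [h₂ p hp] at h4; omega
    have h' := h'.of_eq (F₃ 0 rfl)
    rw [← F₃ xt rfl] at ht₁
    have eU := F₃ aU rfl
    have eO := F₃ aOrd rfl
    rw [← eU] at hU
    rw [← eO] at hst
    clear eU eO F₃
    refine Run.seq_assign h.two_le ?_
    simp only [Expr.eval_var, ht₁]
    set s₄ := s₃.store aOrd t (s₃ xr 0) with hs₄
    have eO : ∀ t', s₄ aOrd t' = if t' = t then s₃ xr 0 else s₃ aOrd t' := by simp [hs₄]
    have eU : s₄ aU = s₃ aU := by simp [hs₄]
    have er : s₄ xr = s₃ xr := by simp [hs₄]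
    rw [← eU] at hU
    rw [← er] at h₃
    have main : ∀ V : Finset ℕ, ∀ s₅ s₆ : State, PeelStep A (Us t) V (s₄ xr 0) →
        s₅ aOrd = s₄ aOrd → V = marked n (s₅ aU) →
        (#V + (t + 1) ≤ n ∨ ∀ p ∈ V, 2 ≤ degIn A V p) → (∀ a ≠ xt, s₆ a = s₅ a) →
        ∃ Us : ℕ → Finset ℕ, Us 0 = marked n (s aU) ∧
          (∀ t' < t + 1, PeelStep A (Us t') (Us (t' + 1)) (s₆ aOrd t')) ∧
          Us (t + 1) = marked n (s₆ aU) ∧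
          (#(Us (t + 1)) + (t + 1) ≤ n ∨ ∀ p ∈ Us (t + 1), 2 ≤ degIn A (Us (t + 1)) p) := by
      intro V s₅ s₆ hV h5 hV' hc' h6
      refine ⟨Function.update Us (t + 1) V, by simp [h0], fun t' ht' => ?_, ?_, ?_⟩
      · rw [h6 aOrd (by decide), h5, eO]
        rcases Nat.lt_succ_iff_lt_or_eq.1 ht' with hlt | rfl
        · rw [if_neg (by omega), Function.update_of_ne (by omega), Function.update_of_ne (by omega)]
          exact hst t' hlt
        · rw [if_pos rfl, Function.update_of_ne (by omega), Function.update_self, ← er]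
          exact hV
      · rw [Function.update_self, h6 aU (by decide), hV']
      · rw [Function.update_self]; exact hc'
    refine Run.ite h.two_le (fun h1 => Run.assign fun s₆ _ h6 => ?_)
      fun h1 => Run.skip fun s₆ _ h6 => ?_
    · rcases h₃ with h₃ | ⟨p, hp, h₃, hdeg⟩
      · exact absurd h₃.1 h1
      refine main ((Us t).erase p) _ s₆ (.inr ⟨p, hp, h₃, hdeg, rfl⟩) (by simp) ?_ ?_ h6
      · simp only [Expr.eval_sub, Expr.eval_var, Expr.eval_one, Expr.eval_zero, h₃,
          Nat.add_sub_cancel, State.store, Function.update_self]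
        rw [marked_update_zero, ← hU]
      · rcases hc with hc | hc
        · left
          have := card_pos.2 ⟨p, hp⟩
          rw [card_erase_of_mem hp]; omega
        · have := hc p hp; omega
    · rcases h₃ with ⟨h₃, hall⟩ | ⟨p, hp, h₃, hdeg⟩
      · exact main (Us t) _ s₆ (.inl ⟨h₃, rfl⟩) rfl hU (.inr hall) h6
      · simp [h₃] at h1
  · rintro s' - ⟨Us, h0, hst, hU, hc⟩
    refine ⟨Us, h0, hst, hU, hc.imp_left fun hc => ?_⟩
    exact card_eq_zero.1 (by omega)

/-- Peeling does not affect being a forest, and a nonempty remainder of minimum degree two is itself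
an obstruction. -/
theorem isForest_iff_of_peelStep {A : ℕ → ℕ → ℕ} (hd : ∀ p, A p p = 0) {Us : ℕ → Finset ℕ}
    {r : ℕ → ℕ} (h : ∀ t < n, PeelStep A (Us t) (Us (t + 1)) (r t))
    (hn : Us n = ∅ ∨ ∀ p ∈ Us n, 2 ≤ degIn A (Us n) p) : IsForest A (Us 0) ↔ Us n = ∅ := by
  have h1 : ∀ t ≤ n, IsForest A (Us 0) ↔ IsForest A (Us t) := by
    intro t
    induction t with
    | zero => exact fun _ => Iff.rfl
    | succ t ih => exact fun ht => (ih (by omega)).trans ((h t ht).isForest_iff hd)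
  rw [h1 n le_rfl]
  refine ⟨fun hF => ?_, fun h => h ▸ isForest_empty⟩
  rcases (Us n).eq_empty_or_nonempty with h0 | h0
  · exact h0
  · obtain ⟨p, hp, hpd⟩ := hF _ Subset.rfl h0
    refine hn.resolve_right fun hall => ?_
    have := hall p hp
    omega

/-- The vertices that remain after the first `i` removals. -/
def remaining (n : ℕ) (vv : ℕ → ℕ) : ℕ → Finset ℕ
  | 0 => range n
  | i + 1 => (remaining n vv i).erase (vv i)

/-- The memory records `k` steps of the local ratio algorithm. -/
def IsTrace (n : ℕ) (s : State) (k : ℕ) : Prop :=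
  ∀ i < k, s aVV i ∈ remaining n (s aVV) i ∧
    Step (graphAt n (s aAA) (i * n * n)) (remaining n (s aVV) i) (fun p => s aWW (i * n + p))
      (s aVV i) (graphAt n (s aAA) ((i + 1) * n * n)) fun p => s aWW ((i + 1) * n + p)

theorem remaining_subset (n : ℕ) (vv : ℕ → ℕ) : ∀ i, remaining n vv i ⊆ range n
  | 0 => Subset.rfl
  | i + 1 => (erase_subset _ _).trans (remaining_subset n vv i)

theorem IsTrace.card {k : ℕ} (h : IsTrace n s k) : ∀ i ≤ k, #(remaining n (s aVV) i) + i = n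
  | 0, _ => by simp [remaining]
  | i + 1, hi => by
    have h1 := h.card i (by omega)
    have h2 := (h i hi).1
    have := card_pos.2 ⟨_, h2⟩
    rw [remaining, card_erase_of_mem h2]; omega

theorem IsTrace.symm_diag {k : ℕ} (h : IsTrace n s k)
    (h0 : (∀ p q, graphAt n (s aAA) 0 p q = graphAt n (s aAA) 0 q p) ∧
      ∀ p, graphAt n (s aAA) 0 p p = 0) : ∀ i ≤ k,
    (∀ p q, graphAt n (s aAA) (i * n * n) p q = graphAt n (s aAA) (i * n * n) q p) ∧
      ∀ p, graphAt n (s aAA) (i * n * n) p p = 0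
  | 0, _ => by simpa using h0
  | i + 1, hi => (h i hi).2.symm_diag (h.symm_diag h0 i (by omega))

/-- Undo the steps of the local ratio algorithm in reverse order and keep a maximal forest. -/
def reverseC : Cmd :=
  forC xi nE (
    .assign xo 0 ((nE - 1 - var xi) * nE * nE) ;;
    .assign xv 0 (.read aVV (nE - 1 - var xi)) ;;
    tabC aU xp 0 nE (.read aRR (var xp)) ;;
    .assign aU (var xv) 1 ;;
    peelC ;;
    findC xr xj nE (.read aU (var xj)) ;;
    .ite (var xr) .skip (.assign aRR (var xv) 1))

/-- This iterates `Step.isGood` from the empty vertex set back to the full graph. Every intermediate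
graph is still stored, in its own block of `n * n` cells, so each test of `v` refers to the graph in
which `v` was removed. -/
theorem run_reverseC (h : Input b n I s) (ht : IsTrace n s n)
    (h0 : (∀ p q, graphAt n (s aAA) 0 p q = graphAt n (s aAA) 0 q p) ∧
      ∀ p, graphAt n (s aAA) 0 p p = 0) (hRR : s aRR = 0) :
    Run b reverseC s fun s' =>
      IsGood (graphAt n (s aAA) 0) (range n) (s aWW) (marked n (s' aRR)) := by
  refine Run.forC h.two_le (n := n) (fun k s' => IsGood (graphAt n (s aAA) ((n - k) * n * n))
      (remaining n (s aVV) (n - k)) (fun p => s aWW ((n - k) * n + p)) (marked n (s' aRR))) rfl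
      h.le_cube (fun s' hs' => (h.of_eq hs').nE_eval) rfl (by decide) ?_ ?_ ?_
  · intro s' _ hs'
    have e1 : remaining n (s aVV) (n - 0) = ∅ := by
      have := ht.card n le_rfl
      rw [Nat.sub_zero]
      exact card_eq_zero.1 (by omega)
    have e2 : marked n (s' aRR) = ∅ := by
      rw [hs' aRR (by decide), hRR]; simp [marked]
    rw [e1, e2]
    exact ⟨Subset.rfl, isForest_empty, by simp, by simp⟩
  · intro k hk s₁ hk₁ hF hI
    obtain ⟨i, hi⟩ : ∃ i, n = k + 1 + i := ⟨n - (k + 1), by omega⟩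
    have h' := h.of_eq (hF 0 (by decide) rfl)
    have hin : i < n := by omega
    have e1 : n - k = i + 1 := by omega
    have e2 : n - (k + 1) = i := by omega
    rw [e1] at hI
    rw [e2]
    obtain ⟨hvS, hstep⟩ := ht i hin
    set v := s aVV i with hv
    have hvn : v < n := mem_range.1 (remaining_subset _ _ _ hvS)
    set A := graphAt n (s aAA) (i * n * n) with hA
    have hgood := hstep.isGood (ht.symm_diag h0 i hin.le).1 (ht.symm_diag h0 i hin.le).2 hvS hI
    clear hI hstep
    have eA : s₁ aAA = s aAA := hF aAA (by decide) rfl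
    have eV : s₁ aVV = s aVV := hF aVV (by decide) rfl
    have ex : n - 1 - k = i := by omega
    refine Run.seq_assign h.two_le (Run.seq_assign h.two_le ?_)
    set s₂ := (s₁.store xo ((0 : Expr).eval s₁) (((nE - 1 - var xi) * nE * nE).eval s₁)) with hs₂
    set s₃ := s₂.store xv ((0 : Expr).eval s₂) ((Expr.read aVV (nE - 1 - var xi)).eval s₂) with hs₃
    have F₃ : ∀ a, a ≠ xo → a ≠ xv → s₃ a = s₁ a := fun a h1 h2 => by simp [hs₃, hs₂, h1, h2]
    have h₂ := h'.of_eq (show s₂ 0 = s₁ 0 by simp [hs₂])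
    have ho₃ : s₃ xo 0 = i * n * n := by simp [hs₃, hs₂, h'.nE_eval, hk₁, ex]
    have hv₃ : s₃ xv 0 = v := by
      have : s₂ xi 0 = k := by simp [hs₂, hk₁]
      simp [hs₃, h₂.nE_eval, this, ex, hv]
      simp [hs₂, eV]
    have h' := h'.of_eq (F₃ 0 (by decide) (by decide))
    rw [← F₃ aAA (by decide) (by decide)] at eA
    rw [← F₃ aRR (by decide) (by decide)] at hgood
    clear_value s₃
    clear hs₃ hs₂ h₂ F₃
    refine Run.seq h.two_le (P := fun s' => marked n (s' aU) = marked n (s₃ aRR)) ?_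
      fun s₄ h₄ F₄ => ?_
    · refine Run.tabC h.two_le (n := n) (o' := 0) (fun p => s₃ aRR p) (by decide) (by decide)
        (by decide) h.le_cube (fun s' hs' => (h'.of_eq hs').nE_eval) (fun _ _ => rfl)
        (fun p hp s' h1 h2 _ => by simp [h1, h2]) fun s' _ h1 _ => ?_
      ext p
      simp only [mem_marked]
      refine and_congr_right fun hp => ?_
      rw [← h1 p hp, zero_add]
    have h' := h'.of_eq (F₄ 0 rfl)
    rw [← F₄ aAA rfl] at eA
    rw [← F₄ aRR rfl] at hgood h₄
    rw [← F₄ xv rfl] at hv₃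
    rw [← F₄ xo rfl] at ho₃
    clear F₄
    refine Run.seq_assign h.two_le ?_
    simp only [Expr.eval_var, hv₃, Expr.eval_one]
    set s₅ := s₄.store aU v 1 with hs₅
    have F₅ : ∀ a, a ≠ aU → s₅ a = s₄ a := fun a h1 => by simp [hs₅, h1]
    have h₅ : marked n (s₅ aU) = insert v (marked n (s₄ aRR)) := by
      simp only [hs₅, State.store, Function.update_self]
      rw [marked_update_one hvn, h₄]
    have h' := h'.of_eq (F₅ 0 (by decide))
    rw [← F₅ aAA (by decide)] at eA
    rw [← F₅ aRR (by decide)] at hgood h₅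
    rw [← F₅ xv (by decide)] at hv₃
    rw [← F₅ xo (by decide)] at ho₃
    clear_value s₅
    clear F₅ hs₅
    refine Run.seq h.two_le (P := fun s' => IsForest A (insert v (marked n (s₅ aRR))) ↔
      marked n (s' aU) = ∅) ?_ fun s₆ h₆ F₆ => ?_
    · refine (run_peelC h' ho₃).conseq ?_
      rintro s' ⟨Us, g1, g2, g3, g4⟩ -
      rw [eA, ← hA] at g2 g4
      have := isForest_iff_of_peelStep (ht.symm_diag h0 i hin.le).2 g2 g4
      rw [g1, h₅] at this
      rw [this, g3]
    have h' := h'.of_eq (F₆ 0 rfl)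
    rw [← F₆ aRR rfl] at hgood h₆
    rw [← F₆ xv rfl] at hv₃
    refine Run.seq h.two_le (P := fun s' => s' xr 0 = 0 ↔ marked n (s₆ aU) = ∅) ?_
      fun s₇ h₇ F₇ => ?_
    · refine Run.findC h.two_le (n := n) (fun p => s₆ aU p ≠ 0) (by decide)
        (by decide) (by decide) h.le_cube (fun s' h'' => (h'.of_eq h'').nE_eval)
        (fun p hp s' h1 h2 => by simp [h1, h2]) fun s' _ h1 => ?_
      rw [eq_empty_iff_forall_notMem]
      simp only [mem_marked, not_and]
      rcases h1 with h1 | ⟨p, hp, h1, h2⟩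
      · exact ⟨fun _ => h1.2, fun _ => h1.1⟩
      · exact ⟨fun h => by omega, fun h => absurd h2 (h p hp)⟩
    rw [← F₇ aRR rfl] at hgood h₆
    rw [← F₇ xv rfl] at hv₃
    rw [← h₆] at h₇
    refine Run.ite h.two_le (fun h1 => Run.skip fun s₈ _ h8 => ?_)
      fun h1 => Run.assign fun s₈ _ h8 => ?_
    · rw [h8 aRR (by decide)]
      rw [if_neg (fun hh => h1 (h₇.2 hh))] at hgood
      exact hgood
    · rw [h8 aRR (by decide)]
      rw [if_pos (h₇.1 h1)] at hgood
      simp only [Expr.eval_var, hv₃, Expr.eval_one, State.store, Function.update_self]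
      rw [marked_update_one hvn]
      exact hgood
  · intro s' _ hI
    simpa [remaining] using hI

end RAM

/-! ### Programs for the individual local ratio steps. -/

namespace RAM

open FVS Finset

variable {b n : ℕ} {I : ℕ → ℕ} {s : State}

/-- The vertices that are not marked by a nonzero entry of `x`. -/
def unmarked (n : ℕ) (x : ℕ → ℕ) : Finset ℕ := {p ∈ range n | x p = 0}

theorem mem_unmarked {x : ℕ → ℕ} {p : ℕ} : p ∈ unmarked n x ↔ p < n ∧ x p = 0 := by
  simp [unmarked]

theorem unmarked_update_one {x : ℕ → ℕ} {a : ℕ} :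
    unmarked n (Function.update x a 1) = (unmarked n x).erase a := by
  ext p
  by_cases hp : p = a <;> simp [mem_unmarked, hp]

theorem graphAt_div_mod {x : ℕ → ℕ} {o k : ℕ} (hk : k < n * n) :
    graphAt n x o (k / n) (k % n) = x (o + k) := by
  obtain ⟨h1, h2⟩ := div_lt_and_mod_lt hk
  rw [graphAt_of_lt h1 h2, Nat.div_add_mod']

theorem graphAt_eq_of_copy {x : ℕ → ℕ} {o o' : ℕ} (h : ∀ k < n * n, x (o' + k) = x (o + k)) :
    graphAt n x o' = graphAt n x o := by
  funext p q
  simp only [graphAt]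
  split_ifs with hpq
  · exact h _ (mul_add_lt hpq.1 hpq.2)
  · rfl

/-- The current graph, weights and removed vertices are stored in `X`, `Y` and `D`; the degrees are
known and the graph and the weights are copied to the place of their successors. -/
structure Prepared (n o ws : ℕ) (X Y D : ℕ → ℕ) (s : State) : Prop where
  eq_xo : s xo 0 = o
  eq_xm : s xm 0 = o + n * n
  eq_xs : s xs 0 = ws
  eq_graph : s aAA = X
  eq_weight : s aWW = Y
  eq_dead : s aDead = D
  deg : ∀ p < n, s aDeg p = degIn (graphAt n X o) (unmarked n D) p
  graph : ∀ k < n * n, X (o + n * n + k) = X (o + k)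
  weight : ∀ k < n, Y (ws + n + k) = Y (ws + k)

theorem Prepared.congr {o ws : ℕ} {X Y D : ℕ → ℕ} {s' : State} (h : Prepared n o ws X Y D s)
    (h1 : s' xo = s xo) (h2 : s' xm = s xm) (h3 : s' xs = s xs) (h4 : s' aAA = s aAA)
    (h5 : s' aWW = s aWW) (h6 : s' aDead = s aDead) (h7 : s' aDeg = s aDeg) :
    Prepared n o ws X Y D s' :=
  ⟨h1 ▸ h.eq_xo, h2 ▸ h.eq_xm, h3 ▸ h.eq_xs, h4 ▸ h.eq_graph, h5 ▸ h.eq_weight, h6 ▸ h.eq_dead,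
    h7 ▸ h.deg, h.graph, h.weight⟩

/-- A step of the local ratio algorithm has been made. -/
def IsStepped (n o ws : ℕ) (X Y D : ℕ → ℕ) (s : State) : Prop :=
  ∃ v ∈ unmarked n D, s xv 0 = v ∧
    Step (graphAt n X o) (unmarked n D) (fun p => Y (ws + p)) v (graphAt n (s aAA) (o + n * n))
      (fun p => s aWW (ws + n + p)) ∧
    (∀ k < o + n * n, s aAA k = X k) ∧ ∀ k < ws + n, s aWW k = Y k

variable {o ws : ℕ} {X Y D : ℕ → ℕ}

/-- The step at a vertex with a multiple edge to a vertex of at least the same weight. -/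
def doubleC : Cmd :=
  .assign xv 0 (rowE (var xr - 1)) ;;
  .assign aWW (var xs + nE + colE (var xr - 1))
    (.read aWW (var xs + colE (var xr - 1)) - .read aWW (var xs + rowE (var xr - 1)))

theorem run_doubleC (h : Input b n I s) (hp : Prepared n o ws X Y D s) {k : ℕ} (hk : k < n * n)
    (hr : s xr 0 = k + 1) (h1 : k / n ∈ unmarked n D) (h2 : k % n ∈ unmarked n D)
    (h3 : 2 ≤ graphAt n X o (k / n) (k % n)) (h4 : Y (ws + k / n) ≤ Y (ws + k % n)) :
    Run b doubleC s (IsStepped n o ws X Y D) := by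
  refine Run.seq_assign h.two_le (Run.assign ?_)
  simp only [Expr.eval_zero, h.rowE_eval, Expr.eval_sub, Expr.eval_var, Expr.eval_one, hr,
    Nat.add_sub_cancel]
  set s₁ := s.store xv 0 (k / n) with hs₁
  have F₁ : ∀ a, a ≠ xv → s₁ a = s a := fun a ha => by simp [hs₁, ha]
  have h' := h.of_eq (F₁ 0 (by decide))
  have hv : s₁ xv 0 = k / n := by simp [hs₁]
  simp only [Expr.eval_add, Expr.eval_read, h'.rowE_eval, h'.colE_eval, Expr.eval_sub,
    Expr.eval_var, Expr.eval_one, F₁ xr (by decide), F₁ xs (by decide), F₁ aWW (by decide), hr,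
    Nat.add_sub_cancel, h'.nE_eval, hp.eq_xs, hp.eq_weight]
  obtain ⟨hk1, hk2⟩ := div_lt_and_mod_lt hk
  refine ⟨k / n, h1, by simp [hv], ?_, fun i hi => ?_, fun i hi => ?_⟩
  · rw [State.store_ne _ _ _ (by decide), F₁ aAA (by decide), hp.eq_graph,
      graphAt_eq_of_copy hp.graph]
    refine .double _ (k % n) h2 h3 h4 fun p hp' => ?_
    have hpn : p < n := (mem_unmarked.1 (mem_of_mem_erase hp')).1
    rw [State.store_self, F₁ aWW (by decide), hp.eq_weight]
    by_cases hpk : p = k % n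
    · subst hpk; simp
    · rw [if_neg (by omega), if_neg hpk, hp.weight p hpn]
  · rw [State.store_ne _ _ _ (by decide), F₁ aAA (by decide), hp.eq_graph]
  · rw [State.store_self, F₁ aWW (by decide), hp.eq_weight, if_neg (by omega)]

/-- The contraction of a vertex of degree two into an adjacent vertex of degree two. -/
def linkC : Cmd :=
  .assign xv 0 (colE (var xr - 1)) ;;
  .assign xu 0 (rowE (var xr - 1)) ;;
  findC xy xj nE ((1 - .read aDead (var xj)) * .read aAA (var xo + (var xv * nE + var xj)) *
    ((var xu - var xj) + (var xj - var xu))) ;;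
  .assign aAA (var xm + (var xu * nE + (var xy - 1)))
    (.read aAA (var xm + (var xu * nE + (var xy - 1))) + 1) ;;
  .assign aAA (var xm + ((var xy - 1) * nE + var xu))
    (.read aAA (var xm + ((var xy - 1) * nE + var xu)) + 1)

/-- The end `v` of the edge that is not lighter is contracted. As there are no multiple edges and
`v` has degree two, it has exactly one further neighbour `y` besides `u`. -/
theorem run_linkC (h : Input b n I s) (hp : Prepared n o ws X Y D s)
    (hA : (∀ p q, graphAt n X o p q = graphAt n X o q p) ∧ ∀ p, graphAt n X o p p = 0)
    (hone : ∀ p ∈ unmarked n D, ∀ q ∈ unmarked n D, graphAt n X o p q ≤ 1) {k : ℕ}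
    (hk : k < n * n) (hr : s xr 0 = k + 1) (h1 : k / n ∈ unmarked n D) (h2 : k % n ∈ unmarked n D)
    (h3 : graphAt n X o (k / n) (k % n) ≠ 0)
    (h4 : degIn (graphAt n X o) (unmarked n D) (k % n) = 2)
    (h5 : Y (ws + k / n) ≤ Y (ws + k % n)) : Run b linkC s (IsStepped n o ws X Y D) := by
  refine Run.seq_assign h.two_le (Run.seq_assign h.two_le ?_)
  simp only [Expr.eval_zero, h.colE_eval, Expr.eval_sub, Expr.eval_var, Expr.eval_one, hr,
    Nat.add_sub_cancel]
  set s₁ := s.store xv 0 (k % n) with hs₁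
  have h' := h.of_eq (show s₁ 0 = s 0 by simp [hs₁])
  have hr₁ : s₁ xr 0 = k + 1 := by simp [hs₁, hr]
  simp only [h'.rowE_eval, Expr.eval_sub, Expr.eval_var, Expr.eval_one, hr₁, Nat.add_sub_cancel]
  obtain ⟨hk1, hk2⟩ := div_lt_and_mod_lt hk
  set u := k / n with hu
  set v := k % n with hv
  set A := graphAt n X o with hAdef
  set S := unmarked n D with hS
  set s₂ := s₁.store xu 0 u with hs₂
  have F₂ : ∀ a, a ≠ xu → a ≠ xv → s₂ a = s a := fun a h1 h2 => by simp [hs₂, hs₁, h1, h2]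
  have h' := h.of_eq (F₂ 0 (by decide) (by decide))
  have hv₂ : s₂ xv 0 = v := by simp [hs₂, hs₁]
  have hu₂ : s₂ xu 0 = u := by simp [hs₂]
  clear_value s₂
  clear hs₂
  have hp₂ : Prepared n o ws X Y D s₂ := by apply hp.congr <;> exact F₂ _ (by decide) (by decide)
  clear F₂ hr₁ hs₁
  have hvu : A v u = 1 := by
    have e1 := hone v h2 u h1
    rw [hA.1] at h3; omega
  obtain ⟨y₀, hy₀, hyu₀, hvy₀⟩ : ∃ y ∈ S, y ≠ u ∧ A v y ≠ 0 := by
    by_contra! hcon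
    have : degIn A S v = A v u :=
      sum_eq_single u (fun q hq hqu => hcon q hq hqu) fun hh => absurd h1 hh
    omega
  refine Run.seq h.two_le (P := fun s' => ∃ y ∈ S, s' xy 0 = y + 1 ∧ y ≠ u ∧ A v y ≠ 0) ?_
    fun s₃ ⟨y, hy, hxy, hyu, hvy⟩ F₃ => ?_
  · refine Run.findC h.two_le (n := n) (fun y => D y = 0 ∧ A v y ≠ 0 ∧ y ≠ u) (by decide)
        (by decide) (by decide) h.le_cube (fun s' h'' => (h'.of_eq h'').nE_eval) ?_
        fun s' _ h1 => ?_
    · intro y hy s' g1 g2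
      have hi := h'.of_eq (g2 0 (by decide) (by decide))
      simp only [Expr.eval_mul, Expr.eval_sub, Expr.eval_one, Expr.eval_read, Expr.eval_var, g1,
        Expr.eval_add, hi.nE_eval, g2 aDead (by decide) (by decide), hp₂.eq_dead,
        g2 aAA (by decide) (by decide), hp₂.eq_graph, g2 xo (by decide) (by decide), hp₂.eq_xo,
        g2 xv (by decide) (by decide), hv₂, g2 xu (by decide) (by decide), hu₂, mul_ne_zero_iff,
        hAdef, graphAt_of_lt hk2 hy]
      omega
    · rcases h1 with h1 | ⟨y, hy, h1, g1, g2, g3⟩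
      · exact absurd ⟨(mem_unmarked.1 hy₀).2, hvy₀, hyu₀⟩ (h1.2 y₀ (mem_unmarked.1 hy₀).1)
      · exact ⟨y, mem_unmarked.2 ⟨hy, g1⟩, h1, g3, g2⟩
  have h' := h'.of_eq (F₃ 0 rfl)
  rw [← F₃ xv rfl] at hv₂
  rw [← F₃ xu rfl] at hu₂
  have hp₃ : Prepared n o ws X Y D s₃ := by apply hp₂.congr <;> exact F₃ _ rfl
  clear F₃ hp₂
  have hyn := (mem_unmarked.1 hy).1
  have hlink : IsLink A S v u y := ⟨hA.1, hA.2, h2, h1, hy, hyu.symm, hvu, by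
    have := hone v h2 y hy; omega, h4⟩
  refine Run.seq_assign h.two_le (Run.assign ?_)
  simp only [Expr.eval_add, Expr.eval_mul, Expr.eval_sub, Expr.eval_var, Expr.eval_one,
    Expr.eval_read, h'.nE_eval, hxy, hu₂, Nat.add_sub_cancel, hp₃.eq_xm, hp₃.eq_graph]
  set s₄ := s₃.store aAA (o + n * n + (u * n + y)) (X (o + n * n + (u * n + y)) + 1) with hs₄
  have F₄ : ∀ a, a ≠ aAA → s₄ a = s₃ a := fun a ha => by simp [hs₄, ha]
  have h' := h'.of_eq (F₄ 0 (by decide))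
  have e₄ : ∀ i, s₄ aAA i = if i = o + n * n + (u * n + y) then
      X (o + n * n + (u * n + y)) + 1 else X i := by
    intro i; rw [hs₄, State.store_self, hp₃.eq_graph]
  simp only [F₄ xm (by decide), F₄ xy (by decide), F₄ xu (by decide), h'.nE_eval, hxy, hu₂,
    Nat.add_sub_cancel, hp₃.eq_xm]
  refine ⟨v, h2, by simp [F₄, hv₂], ?_, fun i hi => ?_, fun i hi => ?_⟩
  · have : graphAt n ((s₄.store aAA (o + n * n + (y * n + u))
        (s₄ aAA (o + n * n + (y * n + u)) + 1)) aAA) (o + n * n) = addEdge A u y := by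
      funext p q
      by_cases hpq : p < n ∧ q < n
      · have i1 := mul_add_inj (u := y) (u' := u) hk1 hyn
        have i2 := mul_add_inj (u := p) (u' := u) hpq.2 hyn
        have i3 := mul_add_inj (u := p) (u' := y) hpq.2 hk1
        have c1 := hp.graph _ (mul_add_lt hpq.1 hpq.2)
        rw [graphAt_of_lt hpq.1 hpq.2, State.store_self, e₄, e₄, addEdge, hAdef,
          graphAt_of_lt hpq.1 hpq.2, ← c1]
        simp only [Nat.add_left_cancel_iff, i1, i2, i3]
        have hyu' : ¬ (y = u ∧ u = y) := fun hh => hyu hh.1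
        rw [if_neg hyu']
        by_cases c2 : p = u ∧ q = y
        · obtain ⟨rfl, rfl⟩ := c2
          simp [hyu]
        · by_cases c3 : p = y ∧ q = u
          · simp [c3]
          · simp [c2, c3]
      · have c2 : ¬ ((p = u ∧ q = y) ∨ (p = y ∧ q = u)) := by
          rintro (⟨rfl, rfl⟩ | ⟨rfl, rfl⟩) <;> simp_all
        simp [graphAt, hpq, addEdge, hAdef, c2]
    rw [this]
    refine .link _ u y hlink h5 fun p hp' => ?_
    rw [State.store_ne _ _ _ (by decide), F₄ aWW (by decide), hp₃.eq_weight,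
      hp.weight p (mem_unmarked.1 (mem_of_mem_erase hp')).1]
  · rw [State.store_self, if_neg (by omega), e₄, if_neg (by omega)]
  · rw [State.store_ne _ _ _ (by decide), F₄ aWW (by decide), hp₃.eq_weight]

/-- The step that reduces the weights in proportion to the degrees minus one. -/
def ratioC : Cmd :=
  .assign xr 0 0 ;;
  forC xj nE (.ite ((1 - .read aDead (var xj)) * ((1 - var xr) +
      (.read aWW (var xs + (var xr - 1)) * (.read aDeg (var xj) - 1) -
        .read aWW (var xs + var xj) * (.read aDeg (var xr - 1) - 1))))
    (.assign xr 0 (var xj + 1)) .skip) ;;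
  .assign xv 0 (var xr - 1) ;;
  tabC aWW xj (var xs + nE) nE
    (.read aWW (var xs + var xj) * (nE - (nE - (.read aDeg (var xv) - 1))) -
      .read aWW (var xs + var xv) * (nE - (nE - (.read aDeg (var xj) - 1))))

/-- A vertex minimising weight over degree minus one is found by cross multiplication, and
minimality prevents truncation in the new weights. The factor `n - (n - x)` is `min n x`. It is
bounded by an input entry, which makes the product tame, and it equals `x` because degrees in a
simple graph are at most `n`. -/
theorem run_ratioC (h : Input b n I s) (hp : Prepared n o ws X Y D s)
    (hone : ∀ p ∈ unmarked n D, ∀ q ∈ unmarked n D, graphAt n X o p q ≤ 1)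
    (htwo : ∀ p ∈ unmarked n D, 2 ≤ degIn (graphAt n X o) (unmarked n D) p)
    (hadj : ∀ p ∈ unmarked n D, ∀ q ∈ unmarked n D, graphAt n X o p q ≠ 0 →
      degIn (graphAt n X o) (unmarked n D) p = 2 → degIn (graphAt n X o) (unmarked n D) q ≠ 2)
    (hne : (unmarked n D).Nonempty) : Run b ratioC s (IsStepped n o ws X Y D) := by
  set A := graphAt n X o with hAdef
  set S := unmarked n D with hS
  set w : ℕ → ℕ := fun p => Y (ws + p) with hw
  have hdn : ∀ p ∈ S, degIn A S p ≤ n := by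
    intro p hp
    have : degIn A S p ≤ ∑ q ∈ S, 1 := sum_le_sum fun q hq => hone p hp q hq
    have h2 := card_filter_le (range n) fun p => D p = 0
    simp at this
    rw [card_range] at h2
    exact this.trans h2
  refine Run.seq_assign h.two_le ?_
  set s₁ := s.store xr ((0 : Expr).eval s) ((0 : Expr).eval s) with hs₁
  have F₁ : ∀ a, a ≠ xr → s₁ a = s a := fun a ha => by simp [hs₁, ha]
  have hr₁ : s₁ xr 0 = 0 := by simp [hs₁]
  have h' := h.of_eq (F₁ 0 (by decide))
  have hp₁ : Prepared n o ws X Y D s₁ := by apply hp.congr <;> exact F₁ _ (by decide)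
  clear_value s₁
  clear hs₁ F₁
  refine Run.seq h.two_le (P := fun s' => ∃ v ∈ S, s' xr 0 = v + 1 ∧
    ∀ p ∈ S, w v * (degIn A S p - 1) ≤ w p * (degIn A S v - 1)) ?_
    fun s₂ ⟨v, hvS, hxr, hmin⟩ F₂ => ?_
  · refine Run.forC h.two_le (n := n) (fun k s' => (s' xr 0 = 0 ∧ ∀ p < k, p ∉ S) ∨
      ∃ v ∈ S, s' xr 0 = v + 1 ∧
        ∀ p < k, p ∈ S → w v * (degIn A S p - 1) ≤ w p * (degIn A S v - 1)) rfl
      h.le_cube (fun s' hs' => (h'.of_eq hs').nE_eval) rfl (by decide) ?_ ?_ ?_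
    · intro s' _ hs'
      rw [hs' xr (by decide)]
      exact .inl ⟨hr₁, by simp⟩
    · intro k hk s' hk' hF hI
      have hp' : Prepared n o ws X Y D s' := by
        apply hp₁.congr <;> exact hF _ (by decide) rfl
      have hcond : ∀ m, s' xr 0 = m + 1 → m ∈ S →
          (((1 - Expr.read aDead (var xj)) * ((1 - var xr) +
            (.read aWW (var xs + (var xr - 1)) * (.read aDeg (var xj) - 1) -
            .read aWW (var xs + var xj) * (.read aDeg (var xr - 1) - 1)))).eval s' ≠ 0 ↔
          k ∈ S ∧ w k * (degIn A S m - 1) < w m * (degIn A S k - 1)) := by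
        intro m hm hmS
        simp only [Expr.eval_mul, Expr.eval_sub, Expr.eval_one, Expr.eval_read, Expr.eval_var,
          Expr.eval_add, hk', hm, hp'.eq_dead, hp'.eq_weight, hp'.eq_xs, hp'.deg k hk,
          hp'.deg m (mem_unmarked.1 hmS).1, Nat.add_sub_cancel, mul_ne_zero_iff, hS, mem_unmarked,
          hw, ← hAdef]
        omega
      have hcond0 : s' xr 0 = 0 →
          (((1 - Expr.read aDead (var xj)) * ((1 - var xr) +
            (.read aWW (var xs + (var xr - 1)) * (.read aDeg (var xj) - 1) -
            .read aWW (var xs + var xj) * (.read aDeg (var xr - 1) - 1)))).eval s' ≠ 0 ↔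
          k ∈ S) := by
        intro hm
        simp only [Expr.eval_mul, Expr.eval_sub, Expr.eval_one, Expr.eval_read, Expr.eval_var,
          Expr.eval_add, hk', hm, hp'.eq_dead, mul_ne_zero_iff, hS, mem_unmarked]
        omega
      refine Run.ite h.two_le (fun h1 => Run.assign fun s₃ _ h3 => ?_)
        fun h1 => Run.skip fun s₃ _ h3 => ?_
      · rw [h3 xr (by decide)]
        simp only [State.store_self, Expr.eval_zero, if_true, Expr.eval_add, Expr.eval_var, hk',
          Expr.eval_one]
        right
        rcases hI with ⟨h0, hno⟩ | ⟨m, hm, h0, hle⟩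
        · refine ⟨k, (hcond0 h0).1 h1, rfl, fun p hpk hpS => ?_⟩
          rcases Nat.lt_succ_iff_lt_or_eq.1 hpk with hlt | rfl
          · exact absurd hpS (hno p hlt)
          · exact le_rfl
        · obtain ⟨hkS, hlt⟩ := (hcond m h0 hm).1 h1
          refine ⟨k, hkS, rfl, fun p hpk hpS => ?_⟩
          rcases Nat.lt_succ_iff_lt_or_eq.1 hpk with hlt' | rfl
          · have h4 := hle p hlt' hpS
            have h5 := htwo m hm
            -- Transitivity of comparing fractions, with the positive denominator of the previous
            -- minimum `m` cancelled.
            refine Nat.le_of_mul_le_mul_right (c := degIn A S m - 1) ?_ (by omega)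
            calc w k * (degIn A S p - 1) * (degIn A S m - 1)
                = w k * (degIn A S m - 1) * (degIn A S p - 1) := by ring
              _ ≤ w m * (degIn A S k - 1) * (degIn A S p - 1) := Nat.mul_le_mul_right _ hlt.le
              _ = w m * (degIn A S p - 1) * (degIn A S k - 1) := by ring
              _ ≤ w p * (degIn A S m - 1) * (degIn A S k - 1) := Nat.mul_le_mul_right _ h4
              _ = w p * (degIn A S k - 1) * (degIn A S m - 1) := by ring
          · exact le_rfl
      · rw [h3 xr (by decide)]
        rcases hI with ⟨h0, hno⟩ | ⟨m, hm, h0, hle⟩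
        · refine .inl ⟨h0, fun p hpk => ?_⟩
          rcases Nat.lt_succ_iff_lt_or_eq.1 hpk with hlt | rfl
          · exact hno p hlt
          · exact fun hh => (hcond0 h0).2 hh h1
        · refine .inr ⟨m, hm, h0, fun p hpk hpS => ?_⟩
          rcases Nat.lt_succ_iff_lt_or_eq.1 hpk with hlt | rfl
          · exact hle p hlt hpS
          · by_contra hcon
            exact (hcond m h0 hm).2 ⟨hpS, not_le.1 hcon⟩ h1
    · intro s' _ hI
      obtain ⟨p, hp⟩ := hne
      rcases hI with ⟨h0, hno⟩ | ⟨m, hm, h0, hle⟩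
      · exact absurd hp (hno p (mem_unmarked.1 hp).1)
      · exact ⟨m, hm, h0, fun p hp => hle p (mem_unmarked.1 hp).1 hp⟩
  have h' := h'.of_eq (F₂ 0 rfl)
  have hp₂ : Prepared n o ws X Y D s₂ := by apply hp₁.congr <;> exact F₂ _ rfl
  clear F₂ hp₁
  refine Run.seq_assign h.two_le ?_
  simp only [Expr.eval_zero, Expr.eval_sub, Expr.eval_var, Expr.eval_one, hxr, Nat.add_sub_cancel]
  set s₃ := s₂.store xv 0 v with hs₃
  have F₃ : ∀ a, a ≠ xv → s₃ a = s₂ a := fun a ha => by simp [hs₃, ha]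
  have hv : s₃ xv 0 = v := by simp [hs₃]
  have h' := h'.of_eq (F₃ 0 (by decide))
  have hp₃ : Prepared n o ws X Y D s₃ := by apply hp₂.congr <;> exact F₃ _ (by decide)
  clear_value s₃
  clear hs₃ F₃
  have hvn := (mem_unmarked.1 hvS).1
  refine Run.tabC h.two_le (n := n) (o' := ws + n)
    (fun p => w p * (n - (n - (degIn A S v - 1))) - w v * (n - (n - (degIn A S p - 1))))
    (by decide) (by decide) (by decide) h.le_cube (fun s' h'' => (h'.of_eq h'').nE_eval) ?_ ?_
    fun s' g1 g2 g3 => ?_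
  · intro s' g1
    simp [g1, (h'.of_eq (g1 0 (by decide) (by decide))).nE_eval, hp₃.eq_xs]
  · intro p hpn s' g1 g2 g3
    have e1 := g3 (ws + p) (by omega)
    have e2 := g3 (ws + v) (by omega)
    simp only [Expr.eval_mul, Expr.eval_sub, Expr.eval_one, Expr.eval_read, Expr.eval_var,
      Expr.eval_add, g1, g2 xs (by decide) (by decide), g2 xv (by decide) (by decide), hv,
      hp₃.eq_xs, e1, e2, (h'.of_eq (g2 0 (by decide) (by decide))).nE_eval,
      g2 aDeg (by decide) (by decide), hp₃.deg p hpn, hp₃.deg v hvn, hp₃.eq_weight, hw, hS, hAdef]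
  · have eA : s' aAA = X := by rw [g1 aAA (by decide) (by decide), hp₃.eq_graph]
    refine ⟨v, hvS, by rw [g1 xv (by decide) (by decide), hv], ?_, fun i hi => by rw [eA],
      fun i hi => by rw [g3 i (.inl hi), hp₃.eq_weight]⟩
    rw [eA, graphAt_eq_of_copy hp.graph]
    refine .ratio _ hone htwo hadj hmin fun p hp' => ?_
    have hpS := mem_of_mem_erase hp'
    have i1 := hdn v hvS
    have i2 := hdn p hpS
    rw [g2 p (mem_unmarked.1 hpS).1, show n - (n - (degIn A S v - 1)) = degIn A S v - 1 by omega,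
      show n - (n - (degIn A S p - 1)) = degIn A S p - 1 by omega]

end RAM

/-! ### Choice of the step and the forward pass. -/

namespace RAM

open FVS Finset

variable {b n : ℕ} {I : ℕ → ℕ} {s : State} {o ws : ℕ} {X Y D : ℕ → ℕ}

/-- Find a vertex of degree at most one. -/
def findLowC : Cmd := findC xr xj nE ((1 - .read aDead (var xj)) * (2 - .read aDeg (var xj)))

/-- Find a multiple edge. -/
def findDoubleC : Cmd :=
  findC xr xj (nE * nE) ((1 - .read aDead (rowE (var xj))) * (1 - .read aDead (colE (var xj))) *
    (.read aAA (var xo + var xj) - 1) *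
    (1 - (.read aWW (var xs + rowE (var xj)) - .read aWW (var xs + colE (var xj)))))

/-- Find an edge between two vertices of degree two. -/
def findLinkC : Cmd :=
  findC xr xj (nE * nE) ((1 - .read aDead (rowE (var xj))) * (1 - .read aDead (colE (var xj))) *
    .read aAA (var xo + var xj) *
    (1 - ((.read aDeg (rowE (var xj)) - 2) + (2 - .read aDeg (rowE (var xj))))) *
    (1 - ((.read aDeg (colE (var xj)) - 2) + (2 - .read aDeg (colE (var xj))))) *
    (1 - (.read aWW (var xs + rowE (var xj)) - .read aWW (var xs + colE (var xj)))))

/-- One step of the local ratio algorithm. -/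
def chooseC : Cmd :=
  findLowC ;;
  .ite (var xr) (.assign xv 0 (var xr - 1)) (
    findDoubleC ;;
    .ite (var xr) doubleC (
      findLinkC ;;
      .ite (var xr) linkC ratioC))

/-- The failure of each search supplies the hypotheses of what follows: minimum degree two, then no
multiple edges, then no adjacent vertices of degree two. -/
theorem run_chooseC (h : Input b n I s) (hp : Prepared n o ws X Y D s)
    (hA : (∀ p q, graphAt n X o p q = graphAt n X o q p) ∧ ∀ p, graphAt n X o p p = 0)
    (hne : (unmarked n D).Nonempty) : Run b chooseC s (IsStepped n o ws X Y D) := by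
  have hsq : ∀ {s : State}, Input b n I s → ∀ s', s' 0 = s 0 → (nE * nE).eval s' = n * n :=
    fun h s' h' => by simp [(h.of_eq h').nE_eval]
  set A := graphAt n X o with hAdef
  set S := unmarked n D with hS
  refine Run.seq h.two_le (P := fun s' => (s' xr 0 = 0 ∧ ∀ p ∈ S, 2 ≤ degIn A S p) ∨
      ∃ p ∈ S, s' xr 0 = p + 1 ∧ degIn A S p ≤ 1) ?_ fun s₁ h₁ F₁ => ?_
  · refine Run.findC h.two_le (n := n) (fun p => D p = 0 ∧ degIn A S p < 2) (by decide)
      (by decide) (by decide) h.le_cube (fun s' h'' => (h.of_eq h'').nE_eval) ?_ fun s' _ h1 => ?_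
    · intro p hpn s' h1 h2
      simp only [Expr.eval_mul, Expr.eval_sub, Expr.eval_one, Expr.eval_two, Expr.eval_read,
        Expr.eval_var, h1, h2 aDead (by decide) (by decide), h2 aDeg (by decide) (by decide),
        hp.eq_dead, hp.deg p hpn, mul_ne_zero_iff, hAdef, hS]
      omega
    · rcases h1 with ⟨h1, h2⟩ | ⟨p, hpn, h1, h2, h3⟩
      · refine .inl ⟨h1, fun p hp => ?_⟩
        obtain ⟨g1, g2⟩ := mem_unmarked.1 hp
        by_contra hcon
        exact h2 p g1 ⟨g2, by omega⟩
      · exact .inr ⟨p, mem_unmarked.2 ⟨hpn, h2⟩, h1, by omega⟩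
  have h' := h.of_eq (F₁ 0 rfl)
  have hp₁ : Prepared n o ws X Y D s₁ := by apply hp.congr <;> exact F₁ _ rfl
  clear F₁ hp
  refine Run.ite h.two_le (fun hr => Run.assign ?_) fun hr => ?_
  · rcases h₁ with h₁ | ⟨p, hpS, h₁, hdeg⟩
    · exact absurd h₁.1 hr
    simp only [Expr.eval_zero, Expr.eval_sub, Expr.eval_var, Expr.eval_one, h₁, Nat.add_sub_cancel]
    refine ⟨p, hpS, by simp, ?_, fun i _ => ?_, fun i _ => ?_⟩
    · rw [State.store_ne _ _ _ (by decide), State.store_ne _ _ _ (by decide), hp₁.eq_graph,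
        hp₁.eq_weight, graphAt_eq_of_copy hp₁.graph]
      exact .low _ hdeg fun q hq => hp₁.weight q (mem_unmarked.1 (mem_of_mem_erase hq)).1
    · rw [State.store_ne _ _ _ (by decide), hp₁.eq_graph]
    · rw [State.store_ne _ _ _ (by decide), hp₁.eq_weight]
  have htwo : ∀ p ∈ S, 2 ≤ degIn A S p := by
    rcases h₁ with h₁ | ⟨p, hpS, h₁, hdeg⟩
    · exact h₁.2
    · simp [h₁] at hr
  clear h₁ hr
  let P₂ : ℕ → ℕ → Prop := fun p q => D p = 0 ∧ D q = 0 ∧ 2 ≤ A p q ∧ Y (ws + p) ≤ Y (ws + q)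
  refine Run.seq h.two_le (P := fun s' => (s' xr 0 = 0 ∧ ∀ k < n * n, ¬ P₂ (k / n) (k % n)) ∨
      ∃ k < n * n, s' xr 0 = k + 1 ∧ P₂ (k / n) (k % n)) ?_ fun s₂ h₂ F₂ => ?_
  · refine Run.findC h.two_le (n := n * n) (fun k => P₂ (k / n) (k % n)) (by decide)
      (by decide) (by decide) h.sq_le_cube (hsq h') ?_ fun s' _ h1 => h1
    intro k hk s' h1 h2
    have hi := h'.of_eq (h2 0 (by decide) (by decide))
    simp only [P₂, hAdef, graphAt_div_mod hk, Expr.eval_mul, Expr.eval_sub, Expr.eval_one,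
      Expr.eval_add, Expr.eval_read, hi.rowE_eval, hi.colE_eval, Expr.eval_var, h1,
      h2 aDead (by decide) (by decide), h2 aAA (by decide) (by decide),
      h2 aWW (by decide) (by decide), h2 xo (by decide) (by decide), h2 xs (by decide) (by decide),
      hp₁.eq_dead, hp₁.eq_graph, hp₁.eq_weight, hp₁.eq_xo, hp₁.eq_xs, mul_ne_zero_iff]
    omega
  have h' := h'.of_eq (F₂ 0 rfl)
  have hp₂ : Prepared n o ws X Y D s₂ := by apply hp₁.congr <;> exact F₂ _ rfl
  clear F₂ hp₁
  refine Run.ite h.two_le (fun hr => ?_) fun hr => ?_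
  · rcases h₂ with h₂ | ⟨k, hk, h₂, g1, g2, g3, g4⟩
    · exact absurd h₂.1 hr
    obtain ⟨hk1, hk2⟩ := div_lt_and_mod_lt hk
    exact run_doubleC h' hp₂ hk h₂ (mem_unmarked.2 ⟨hk1, g1⟩) (mem_unmarked.2 ⟨hk2, g2⟩) g3 g4
  have hone : ∀ p ∈ S, ∀ q ∈ S, A p q ≤ 1 := by
    rcases h₂ with h₂ | ⟨k, hk, h₂, -⟩
    · have h2 := forall_lt_mul (P := fun p q => ¬ P₂ p q) h₂.2
      intro p hp q hq
      obtain ⟨p1, p2⟩ := mem_unmarked.1 hp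
      obtain ⟨q1, q2⟩ := mem_unmarked.1 hq
      by_contra hcon
      -- The search also demands an order of the two weights; one of the two orientations of the
      -- edge always satisfies it.
      rcases le_total (Y (ws + p)) (Y (ws + q)) with hle | hle
      · exact h2 p p1 q q1 ⟨p2, q2, by omega, hle⟩
      · exact h2 q q1 p p1 ⟨q2, p2, by rw [hA.1]; omega, hle⟩
    · simp [h₂] at hr
  clear h₂ hr
  let P₃ : ℕ → ℕ → Prop := fun p q => D p = 0 ∧ D q = 0 ∧ A p q ≠ 0 ∧ degIn A S p = 2 ∧
    degIn A S q = 2 ∧ Y (ws + p) ≤ Y (ws + q)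
  refine Run.seq h.two_le (P := fun s' => (s' xr 0 = 0 ∧ ∀ k < n * n, ¬ P₃ (k / n) (k % n)) ∨
      ∃ k < n * n, s' xr 0 = k + 1 ∧ P₃ (k / n) (k % n)) ?_ fun s₃ h₃ F₃ => ?_
  · refine Run.findC h.two_le (n := n * n) (fun k => P₃ (k / n) (k % n)) (by decide)
      (by decide) (by decide) h.sq_le_cube (hsq h') ?_ fun s' _ h1 => h1
    intro k hk s' h1 h2
    have hi := h'.of_eq (h2 0 (by decide) (by decide))
    obtain ⟨hk1, hk2⟩ := div_lt_and_mod_lt hk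
    have e1 := hp₂.deg _ hk1
    have e2 := hp₂.deg _ hk2
    simp only [P₃, hAdef, hS, ← e1, ← e2]
    simp only [graphAt_div_mod hk, Expr.eval_mul, Expr.eval_sub, Expr.eval_one, Expr.eval_two,
      Expr.eval_add, Expr.eval_read, hi.rowE_eval, hi.colE_eval, Expr.eval_var, h1,
      h2 aDead (by decide) (by decide), h2 aAA (by decide) (by decide),
      h2 aWW (by decide) (by decide), h2 xo (by decide) (by decide), h2 xs (by decide) (by decide),
      h2 aDeg (by decide) (by decide),
      hp₂.eq_dead, hp₂.eq_graph, hp₂.eq_weight, hp₂.eq_xo, hp₂.eq_xs, mul_ne_zero_iff]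
    omega
  have h' := h'.of_eq (F₃ 0 rfl)
  have hp₃ : Prepared n o ws X Y D s₃ := by apply hp₂.congr <;> exact F₃ _ rfl
  clear F₃ hp₂
  refine Run.ite h.two_le (fun hr => ?_) fun hr => ?_
  · rcases h₃ with h₃ | ⟨k, hk, h₃, g1, g2, g3, -, g4, g5⟩
    · exact absurd h₃.1 hr
    obtain ⟨hk1, hk2⟩ := div_lt_and_mod_lt hk
    exact run_linkC h' hp₃ hA hone hk h₃ (mem_unmarked.2 ⟨hk1, g1⟩) (mem_unmarked.2 ⟨hk2, g2⟩)
      g3 g4 g5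
  · refine run_ratioC h' hp₃ hone htwo ?_ hne
    rcases h₃ with h₃ | ⟨k, hk, h₃, -⟩
    · have h2 := forall_lt_mul (P := fun p q => ¬ P₃ p q) h₃.2
      intro p hp q hq hpq dp dq
      obtain ⟨p1, p2⟩ := mem_unmarked.1 hp
      obtain ⟨q1, q2⟩ := mem_unmarked.1 hq
      rcases le_total (Y (ws + p)) (Y (ws + q)) with hle | hle
      · exact h2 p p1 q q1 ⟨p2, q2, hpq, dp, dq, hle⟩
      · exact h2 q q1 p p1 ⟨q2, p2, by rw [← hA.1]; exact hpq, dq, dp, hle⟩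
    · simp [h₃] at hr

/-- Compute the degrees and copy the graph and the weights. -/
def prepareC : Cmd :=
  .assign xo 0 (var xi * nE * nE) ;;
  .assign xm 0 (var xo + nE * nE) ;;
  .assign xs 0 (var xi * nE) ;;
  tabSumC aDeg xacc xp xq nE (.read aAA (var xo + (var xp * nE + var xq)) -
    .read aDead (var xq) * .read aAA (var xo + (var xp * nE + var xq))) ;;
  tabC aAA xj (var xm) (nE * nE) (.read aAA (var xo + var xj)) ;;
  tabC aWW xj (var xs + nE) nE (.read aWW (var xs + var xj))

theorem degIn_unmarked {x d : ℕ → ℕ} {p : ℕ} (hp : p < n) :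
    degIn (graphAt n x o) (unmarked n d) p =
      ∑ q ∈ range n, (x (o + (p * n + q)) - d q * x (o + (p * n + q))) := by
  rw [degIn, unmarked, sum_filter]
  refine sum_congr rfl fun q hq => ?_
  rw [graphAt_of_lt hp (mem_range.1 hq)]
  split_ifs with h
  · rw [h]; simp
  · have : x (o + (p * n + q)) ≤ d q * x (o + (p * n + q)) :=
      Nat.le_mul_of_pos_left _ (by omega)
    omega

theorem graphAt_congr {x x' : ℕ → ℕ} (h : ∀ k < o + n * n, x' k = x k) :
    graphAt n x' o = graphAt n x o := by
  funext p q
  simp only [graphAt]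
  split_ifs with hpq
  · have := mul_add_lt hpq.1 hpq.2
    exact h _ (by omega)
  · rfl

theorem run_prepareC (h : Input b n I s) {i : ℕ} (hi : s xi 0 = i) :
    Run b prepareC s fun s' => Prepared n (i * n * n) (i * n) (s' aAA) (s' aWW) (s aDead) s' ∧
      (∀ k < i * n * n + n * n, s' aAA k = s aAA k) ∧ ∀ k < i * n + n, s' aWW k = s aWW k := by
  refine Run.seq_assign h.two_le (Run.seq_assign h.two_le (Run.seq_assign h.two_le ?_))
  simp only [Expr.eval_zero, Expr.eval_mul, Expr.eval_var, h.nE_eval, hi]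
  set s₁ := s.store xo 0 (i * n * n) with hs₁
  have h' := h.of_eq (show s₁ 0 = s 0 by simp [hs₁])
  simp only [Expr.eval_add, Expr.eval_mul, Expr.eval_var, h'.nE_eval]
  have e₁ : s₁ xo 0 = i * n * n := by simp [hs₁]
  rw [e₁]
  set s₂ := s₁.store xm 0 (i * n * n + n * n) with hs₂
  have h' := h'.of_eq (show s₂ 0 = s₁ 0 by simp [hs₂])
  have e₂ : s₂ xi 0 = i := by simp [hs₂, hs₁, hi]
  simp only [h'.nE_eval, e₂]
  set s₃ := s₂.store xs 0 (i * n) with hs₃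
  have h' := h'.of_eq (show s₃ 0 = s₂ 0 by simp [hs₃])
  have hxo : s₃ xo 0 = i * n * n := by simp [hs₃, hs₂, e₁]
  have hxm : s₃ xm 0 = i * n * n + n * n := by simp [hs₃, hs₂]
  have hxs : s₃ xs 0 = i * n := by simp [hs₃]
  have eA : s₃ aAA = s aAA := by simp [hs₃, hs₂, hs₁]
  have eW : s₃ aWW = s aWW := by simp [hs₃, hs₂, hs₁]
  have eD : s₃ aDead = s aDead := by simp [hs₃, hs₂, hs₁]
  rw [← eA, ← eW, ← eD]
  clear_value s₃
  clear hs₃ hs₂ hs₁ e₁ e₂ eA eW eD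
  refine Run.seq h.two_le (P := fun s' => ∀ p < n, s' aDeg p =
      degIn (graphAt n (s₃ aAA) (i * n * n)) (unmarked n (s₃ aDead)) p) ?_
      fun s₄ h₄ F₄ => ?_
  · refine Run.tabSumC h.two_le (n := n) (fun p q => s₃ aAA (i * n * n + (p * n + q)) -
      s₃ aDead q * s₃ aAA (i * n * n + (p * n + q))) (by decide) h.le_cube
      (fun s' hs' => (h'.of_eq hs').nE_eval) ?_ fun s' _ h1 _ p hp => ?_
    · intro p hp q hq s' h1 h2 h3
      have := (h'.of_eq (h3 0 (by decide) (by decide) (by decide) (by decide))).nE_eval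
      simp [h1, h2, h3, this, hxo]
    · rw [h1 p hp, degIn_unmarked hp]
  have h' := h'.of_eq (F₄ 0 rfl)
  rw [← F₄ xo rfl] at hxo
  rw [← F₄ xm rfl] at hxm
  rw [← F₄ xs rfl] at hxs
  rw [← F₄ aAA rfl, ← F₄ aDead rfl] at h₄
  rw [← F₄ aAA rfl, ← F₄ aDead rfl, ← F₄ aWW rfl]
  clear F₄
  refine Run.seq h.two_le (P := fun s' =>
      (∀ k < n * n, s' aAA (i * n * n + n * n + k) = s₄ aAA (i * n * n + k)) ∧
      ∀ k < i * n * n + n * n, s' aAA k = s₄ aAA k) ?_ fun s₅ ⟨h₅, h₅'⟩ F₅ => ?_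
  · refine Run.tabC h.two_le (n := n * n) (o' := i * n * n + n * n)
      (fun k => s₄ aAA (i * n * n + k)) (by decide) (by decide) (by decide) h.sq_le_cube
      (fun s' hs' => by simp [(h'.of_eq hs').nE_eval])
      (fun s' g1 => by simp [g1, hxm]) ?_ fun s' _ g1 g2 => ⟨g1, fun k hk => g2 k (.inl hk)⟩
    intro k hk s' g1 g2 g3
    have := g3 (i * n * n + k) (by omega)
    simp [g1, g2, hxo, this]
  have h' := h'.of_eq (F₅ 0 rfl)
  rw [← F₅ xo rfl] at hxo
  rw [← F₅ xm rfl] at hxm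
  rw [← F₅ xs rfl] at hxs
  rw [← F₅ aDead rfl, ← F₅ aDeg rfl] at h₄
  rw [← F₅ aDead rfl, ← F₅ aWW rfl]
  clear F₅
  refine Run.tabC h.two_le (n := n) (o' := i * n + n) (fun k => s₅ aWW (i * n + k)) (by decide)
    (by decide) (by decide) h.le_cube (fun s' hs' => (h'.of_eq hs').nE_eval) ?_ ?_
    fun s' g1 g2 g3 => ?_
  · intro s' g1
    simp [g1, hxs, (h'.of_eq (g1 0 (by decide) (by decide))).nE_eval]
  · intro k hk s' g1 g2 g3
    have := g3 (i * n + k) (by omega)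
    simp [g1, g2, hxs, this]
  · have g1' : ∀ a, a ≠ aWW → a ≠ xj → s' a = s₅ a := g1
    have eA := g1 aAA (by decide) (by decide)
    rw [eA]
    refine ⟨⟨by rw [g1' xo (by decide) (by decide), hxo],
      by rw [g1' xm (by decide) (by decide), hxm],
      by rw [g1' xs (by decide) (by decide), hxs], eA, rfl,
      g1' aDead (by decide) (by decide), fun p hp => ?_, fun k hk => ?_, fun k hk => ?_⟩, h₅',
      fun k hk => g3 k (.inl hk)⟩
    · rw [g1' aDeg (by decide) (by decide), h₄ p hp, graphAt_congr h₅']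
    · rw [h₅ k hk, h₅' _ (by omega)]
    · rw [g2 k hk, g3 _ (by omega)]

/-- The local ratio algorithm: `n` vertices are removed one after the other. -/
def forwardC : Cmd :=
  forC xi nE (
    prepareC ;;
    chooseC ;;
    .assign aVV (var xi) (var xv) ;;
    .assign aDead (var xv) 1)

theorem remaining_congr {vv vv' : ℕ → ℕ} : ∀ {i : ℕ}, (∀ j < i, vv' j = vv j) →
    remaining n vv' i = remaining n vv i
  | 0, _ => rfl
  | i + 1, h => by
    rw [remaining, remaining, remaining_congr fun j hj => h j (by omega), h i (by omega)]

/-- Round `i` writes only to the blocks of index `i + 1`, so the steps recorded earlier and the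
original graph and weights remain valid. -/
theorem run_forwardC (h : Input b n I s) (hD : s aDead = 0)
    (hA : (∀ p q, graphAt n (s aAA) 0 p q = graphAt n (s aAA) 0 q p) ∧
      ∀ p, graphAt n (s aAA) 0 p p = 0) : Run b forwardC s fun s' => IsTrace n s' n ∧
    graphAt n (s' aAA) 0 = graphAt n (s aAA) 0 ∧ ∀ p < n, s' aWW p = s aWW p := by
  refine Run.forC h.two_le (n := n) (fun i s' => IsTrace n s' i ∧
      graphAt n (s' aAA) 0 = graphAt n (s aAA) 0 ∧ (∀ p < n, s' aWW p = s aWW p) ∧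
      unmarked n (s' aDead) = remaining n (s' aVV) i) rfl
      h.le_cube (fun s' hs' => (h.of_eq hs').nE_eval) rfl (by decide) ?_ ?_ ?_
  · intro s' _ hs'
    rw [hs' aAA (by decide), hs' aWW (by decide), hs' aDead (by decide), hs' aVV (by decide)]
    refine ⟨fun i hi => by omega, rfl, fun _ _ => rfl, ?_⟩
    simp [hD, unmarked, remaining]
  · rintro i hi s₁ hxi hF ⟨htr, hg, hw, hrem⟩
    have h' := h.of_eq (hF 0 (by decide) rfl)
    clear hF
    have hcard := htr.card i le_rfl
    have hAi : (∀ p q, graphAt n (s₁ aAA) (i * n * n) p q = graphAt n (s₁ aAA) (i * n * n) q p) ∧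
      ∀ p, graphAt n (s₁ aAA) (i * n * n) p p = 0 := htr.symm_diag (by rw [hg]; exact hA) i le_rfl
    refine Run.seq h.two_le (run_prepareC h' hxi) fun s₂ ⟨hp, hX, hY⟩ F₂ => ?_
    have h' := h'.of_eq (F₂ 0 rfl)
    have eV₂ := F₂ aVV rfl
    rw [← F₂ xi rfl] at hxi
    clear F₂
    refine Run.seq h.two_le (run_chooseC h' hp (by rw [graphAt_congr hX]; exact hAi) ?_)
      fun s₃ ⟨v, hv, hxv, hst, hX', hY'⟩ F₃ => ?_
    · rw [hrem]; exact card_pos.1 (by omega)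
    have h' := h'.of_eq (F₃ 0 rfl)
    have eV₃ : s₃ aVV = s₁ aVV := by rw [F₃ aVV rfl, eV₂]
    have eD₃ : s₃ aDead = s₁ aDead := by rw [F₃ aDead rfl, hp.eq_dead]
    rw [← F₃ xi rfl] at hxi
    clear F₃
    refine Run.seq_assign h.two_le (Run.assign fun s₆ _ h₆ => ?_)
    simp only [Expr.eval_var, hxi, hxv, Expr.eval_one] at h₆
    have ev : (s₃.store aVV i v) xv 0 = v := by simp [hxv]
    rw [ev] at h₆
    have eA₆ : s₆ aAA = s₃ aAA := by rw [h₆ aAA (by decide)]; simp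
    have eW₆ : s₆ aWW = s₃ aWW := by rw [h₆ aWW (by decide)]; simp
    have eD₆ : s₆ aDead = Function.update (s₁ aDead) v 1 := by
      rw [h₆ aDead (by decide), ← eD₃]; simp [State.store]
    have eV₆ : s₆ aVV = Function.update (s₁ aVV) i v := by
      rw [h₆ aVV (by decide), ← eV₃]; simp [State.store]
    have hXX : ∀ k < i * n * n + n * n, s₆ aAA k = s₁ aAA k := fun k hk => by
      rw [eA₆, hX' k hk, hX k hk]
    have hYY : ∀ k < i * n + n, s₆ aWW k = s₁ aWW k := fun k hk => by
      rw [eW₆, hY' k hk, hY k hk]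
    have hVV : ∀ j < i, s₆ aVV j = s₁ aVV j := fun j hj => by
      rw [eV₆, Function.update_of_ne (by omega)]
    have hremi : remaining n (s₆ aVV) i = remaining n (s₁ aVV) i := remaining_congr hVV
    have hvi : s₆ aVV i = v := by rw [eV₆, Function.update_self]
    have hsq : ∀ j ≤ i, j * n * n ≤ i * n * n := fun j hj =>
      Nat.mul_le_mul_right n (Nat.mul_le_mul_right n hj)
    have hG : ∀ j ≤ i, graphAt n (s₆ aAA) (j * n * n) = graphAt n (s₁ aAA) (j * n * n) :=
      fun j hj => graphAt_congr fun k hk => hXX k (by have := hsq j hj; omega)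
    have hYle : ∀ j ≤ i, ∀ p < n, s₆ aWW (j * n + p) = s₁ aWW (j * n + p) := fun j hj p hp =>
      hYY _ (by have := Nat.mul_le_mul_right n hj; omega)
    -- A step depends only on the weights at the remaining vertices, whereas the stored weights are
    -- known to agree only at addresses of vertices.
    have hS_congr : ∀ {A A' : ℕ → ℕ → ℕ} {S : Finset ℕ} {w w₂ w' w₂' : ℕ → ℕ} {v : ℕ},
        S ⊆ range n → v ∈ S → Step A S w v A' w' → (∀ p < n, w₂ p = w p) →
        (∀ p < n, w₂' p = w' p) → Step A S w₂ v A' w₂' := by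
      intro A A' S w w₂ w' w₂' v hS hv hstep e1 e2
      have i1 : ∀ p ∈ S, w₂ p = w p := fun p hp => e1 p (mem_range.1 (hS hp))
      have i2 : ∀ p ∈ S.erase v, w₂' p = w' p := fun p hp =>
        e2 p (mem_range.1 (hS (mem_of_mem_erase hp)))
      cases hstep with
      | low _ g1 g2 =>
        exact .low _ g1 fun p hp => by rw [i2 p hp, g2 p hp, i1 p (mem_of_mem_erase hp)]
      | double _ o ho g1 g2 g3 =>
        exact .double _ o ho g1 (by rw [i1 v hv, i1 o ho]; exact g2) fun p hp => by
          rw [i2 p hp, g3 p hp, i1 p (mem_of_mem_erase hp), i1 v hv]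
      | link _ u y g1 g2 g3 =>
        exact .link _ u y g1 (by rw [i1 v hv, i1 u g1.mem_left]; exact g2) fun p hp => by
          rw [i2 p hp, g3 p hp, i1 p (mem_of_mem_erase hp)]
      | ratio _ g1 g2 g3 g4 g5 =>
        exact .ratio _ g1 g2 g3 (fun p hp => by rw [i1 p hp, i1 v hv]; exact g4 p hp) fun p hp => by
          rw [i2 p hp, g5 p hp, i1 p (mem_of_mem_erase hp), i1 v hv]
    refine ⟨fun j hj => ?_, ?_, fun p hp => ?_, ?_⟩
    · rcases Nat.lt_succ_iff_lt_or_eq.1 hj with hlt | rfl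
      · obtain ⟨g1, g2⟩ := htr j hlt
        have e1 : remaining n (s₆ aVV) j = remaining n (s₁ aVV) j :=
          remaining_congr fun l hl => hVV l (by omega)
        rw [e1, hVV j hlt, hG j hlt.le, hG (j + 1) hlt]
        exact ⟨g1, hS_congr (remaining_subset _ _ _) g1 g2 (hYle j hlt.le) (hYle (j + 1) hlt)⟩
      · rw [hremi, hvi, ← hrem, hG j le_rfl]
        refine ⟨hv, hS_congr (filter_subset _ _) hv (w := fun p => s₂ aWW (j * n + p))
          (w' := fun p => s₃ aWW (j * n + n + p)) ?_ (fun p hp => ?_) fun p hp => ?_⟩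
        · rw [eA₆, ← graphAt_congr hX, show (j + 1) * n * n = j * n * n + n * n by ring]
          exact hst
        · rw [hYle j le_rfl p hp, hY _ (by omega)]
        · rw [eW₆, show (j + 1) * n + p = j * n + n + p by ring]
    · have := hG 0 (Nat.zero_le _)
      simp only [zero_mul] at this
      rw [this, hg]
    · have := hYle 0 (Nat.zero_le _) p hp
      simp only [zero_mul, zero_add] at this
      rw [this, hw p hp]
    · rw [eD₆, unmarked_update_one, remaining, hremi, hvi, hrem]
  · rintro s' - ⟨g1, g2, g3, -⟩
    exact ⟨g1, g2, g3⟩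

end RAM

/-! ### Integral weights and two-colouring of the forest. -/

namespace RAM

open FVS Finset

variable {b n : ℕ} {I : ℕ → ℕ} {s : State}

/-- The weights, multiplied by the product of all denominators. -/
def scaledWeight (n : ℕ) (I : ℕ → ℕ) (v : ℕ) : ℕ :=
  I (1 + n * n + v) * (∏ u ∈ range n, I (1 + n * n + n + u)) / I (1 + n * n + n + v)

/-- Compute integer weights and copy the graph and the weights for the local ratio algorithm. -/
def weightsC : Cmd :=
  tabC aW xp 0 nE (.read 0 (1 + nE * nE + var xp)) ;;
  forC xq nE (tabC aW xp 0 nE (.read aW (var xp) * .read 0 (1 + nE * nE + nE + var xq))) ;;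
  tabC aW xp 0 nE (.read aW (var xp) / .read 0 (1 + nE * nE + nE + var xp)) ;;
  tabC aAA xj 0 (nE * nE) (.read 0 (1 + var xj)) ;;
  tabC aWW xp 0 nE (.read aW (var xp))

/-- Multiplying by one denominator at a time and finally dividing by the vertex's own denominator
involves only input entries as second factors, which keeps the computation tame. -/
theorem run_weightsC (h : Input b n I s) : Run b weightsC s fun s' =>
    (∀ v < n, s' aW v = scaledWeight n I v) ∧ (∀ v < n, s' aWW v = scaledWeight n I v) ∧
      ∀ k < n * n, s' aAA k = I (1 + k) := by
  refine Run.seq h.two_le (P := fun s' => ∀ v < n, s' aW v = I (1 + n * n + v)) ?_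
    fun s₁ h₁ F₁ => ?_
  · refine Run.tabC h.two_le (n := n) (o' := 0) (fun v => I (1 + n * n + v)) (by decide)
      (by decide) (by decide) h.le_cube (fun s' hs' => (h.of_eq hs').nE_eval) (fun _ _ => rfl)
      ?_ fun s' _ h1 _ v hv => by simpa using h1 v hv
    intro v _ s' h1 h2 _
    have hi := h.of_eq (h2 0 (by decide) (by decide))
    simp [hi.nE_eval, h1, hi.eq]
  have h' := h.of_eq (F₁ 0 rfl)
  clear F₁
  refine Run.seq h.two_le (P := fun s' => ∀ v < n, s' aW v =
      I (1 + n * n + v) * ∏ u ∈ range n, I (1 + n * n + n + u)) ?_ fun s₂ h₂ F₂ => ?_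
  · refine Run.forC h.two_le (n := n) (fun k s' => ∀ v < n, s' aW v =
      I (1 + n * n + v) * ∏ u ∈ range k, I (1 + n * n + n + u)) rfl
      h.le_cube (fun s' hs' => (h'.of_eq hs').nE_eval) rfl (by decide) ?_ ?_ fun s' _ hs' => hs'
    · intro s' _ hs' v hv
      rw [hs' aW (by decide), h₁ v hv]; simp
    · intro k hk s' hk' hF hI
      have hi := h'.of_eq (hF 0 (by decide) rfl)
      refine Run.tabC h.two_le (n := n) (o' := 0)
        (fun v => s' aW v * I (1 + n * n + n + k)) (by decide)
        (by decide) (by decide) h.le_cube (fun s' hs' => (hi.of_eq hs').nE_eval) (fun _ _ => rfl)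
        ?_ fun s'' _ h1 _ s₃ _ h3 v hv => ?_
      · intro v _ s'' h1 h2 h3
        have hi' := hi.of_eq (h2 0 (by decide) (by decide))
        have e1 := h2 xq (by decide) (by decide)
        have e2 := h3 v (by omega)
        simp [hi'.nE_eval, h1, hi'.eq, e1, e2, hk']
      · have e1 := h1 v hv
        rw [zero_add, hI v hv] at e1
        rw [h3 aW (by decide), e1, prod_range_succ, mul_assoc]
  have h' := h'.of_eq (F₂ 0 rfl)
  clear F₂
  refine Run.seq h.two_le (P := fun s' => ∀ v < n, s' aW v = scaledWeight n I v) ?_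
    fun s₃ h₃ F₃ => ?_
  · refine Run.tabC h.two_le (n := n) (o' := 0) (scaledWeight n I) (by decide)
      (by decide) (by decide) h.le_cube (fun s' hs' => (h'.of_eq hs').nE_eval) (fun _ _ => rfl)
      ?_ fun s' _ h1 _ v hv => by simpa using h1 v hv
    intro v hv s' h1 h2 h3
    have hi := h'.of_eq (h2 0 (by decide) (by decide))
    have e2 := h3 v (by omega)
    simp [hi.nE_eval, h1, hi.eq, e2, h₂ v hv, scaledWeight]
  have h' := h'.of_eq (F₃ 0 rfl)
  clear F₃
  refine Run.seq h.two_le (P := fun s' => ∀ k < n * n, s' aAA k = I (1 + k)) ?_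
    fun s₄ h₄ F₄ => ?_
  · refine Run.tabC h.two_le (n := n * n) (o' := 0) (fun k => I (1 + k)) (by decide)
      (by decide) (by decide) h.sq_le_cube (fun s' hs' => by simp [(h'.of_eq hs').nE_eval])
      (fun _ _ => rfl) ?_ fun s' _ h1 _ v hv => by simpa using h1 v hv
    intro v hv s' h1 h2 h3
    have hi := h'.of_eq (h2 0 (by decide) (by decide))
    simp [h1, hi.eq]
  have h' := h'.of_eq (F₄ 0 rfl)
  rw [← F₄ aW rfl] at h₃
  clear F₄
  refine Run.tabC h.two_le (n := n) (o' := 0) (fun v => s₄ aW v) (by decide)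
    (by decide) (by decide) h.le_cube (fun s' hs' => (h'.of_eq hs').nE_eval) (fun _ _ => rfl)
    (fun v hv s' h1 h2 _ => by simp [h1, h2]) fun s' h1 h2 _ => ?_
  rw [h1 aW (by decide) (by decide), h1 aAA (by decide) (by decide)]
  refine ⟨h₃, fun v hv => ?_, h₄⟩
  have := h2 v hv
  rw [zero_add] at this
  rw [this, h₃ v hv]

/-- `C` is a proper colouring of `U` with the colours `1` and `2`. -/
def IsTwoColoring (A : ℕ → ℕ → ℕ) (U : Finset ℕ) (C : ℕ → ℕ) : Prop :=
  ∀ p ∈ U, (C p = 1 ∨ C p = 2) ∧ ∀ q ∈ U, A p q ≠ 0 → C p ≠ C q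

/-- The vertex `p` has at most one neighbour in `U`, so avoiding the colour `1` when it occurs there
is enough. -/
theorem IsTwoColoring.insert {A : ℕ → ℕ → ℕ} {U : Finset ℕ} {C : ℕ → ℕ} {p c : ℕ}
    (h : IsTwoColoring A (U.erase p) C) (hs : ∀ p q, A p q = A q p) (hd : ∀ p, A p p = 0)
    (hp : p ∈ U) (hdeg : degIn A U p ≤ 1) (hc : c = 1 ∨ c = 2)
    (hc2 : c = 2 ↔ ∃ q ∈ U.erase p, A p q ≠ 0 ∧ C q = 1) :
    IsTwoColoring A U (Function.update C p c) := by
  have key : ∀ q ∈ U, q ≠ p → A p q ≠ 0 → c ≠ C q := by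
    intro q hq hqp hpq hcq
    have hqE := mem_erase.2 ⟨hqp, hq⟩
    rcases (h q hqE).1 with h1 | h1
    · have := hc2.2 ⟨q, hqE, hpq, h1⟩
      omega
    · obtain ⟨z, hz, hpz, hz1⟩ := hc2.1 (hcq.trans h1)
      have hzq : z ≠ q := by rintro rfl; omega
      have : A p z + A p q ≤ degIn A U p := by
        rw [← sum_pair hzq]
        refine sum_le_sum_of_subset fun x hx => ?_
        simp only [mem_insert, mem_singleton] at hx
        rcases hx with rfl | rfl
        · exact mem_of_mem_erase hz
        · exact hq
      omega
  intro x hx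
  by_cases hxp : x = p
  · subst hxp
    rw [Function.update_self]
    refine ⟨hc, fun q hq hpq => ?_⟩
    have hqx : q ≠ x := by rintro rfl; exact hpq (hd q)
    rw [Function.update_of_ne hqx]
    exact key q hq hqx hpq
  · rw [Function.update_of_ne hxp]
    refine ⟨(h x (mem_erase.2 ⟨hxp, hx⟩)).1, fun q hq hxq => ?_⟩
    by_cases hqp : q = p
    · subst hqp
      rw [Function.update_self]
      exact (key x hx hxp (by rw [hs]; exact hxq)).symm
    · rw [Function.update_of_ne hqp]
      exact (h x (mem_erase.2 ⟨hxp, hx⟩)).2 q (mem_erase.2 ⟨hqp, hq⟩) hxq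

/-- Colour the forest that is marked in `aRR`. -/
def colorC : Cmd :=
  .assign xo 0 0 ;;
  tabC aU xp 0 nE (.read aRR (var xp)) ;;
  peelC ;;
  forC xt nE (
    .assign xr 0 (.read aOrd (nE - 1 - var xt)) ;;
    .ite (var xr) (
      findC xu xj nE (.read aAA ((var xr - 1) * nE + var xj) *
        (.read aC (var xj) * (2 - .read aC (var xj)))) ;;
      .assign aC (var xr - 1) (1 + (1 - (1 - var xu)))) .skip)

/-- When the peeling is undone, a returning vertex has at most one neighbour among those already
back. Uncoloured vertices hold `0`, so the scan may range over all vertices; `x * (2 - x)` is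
nonzero exactly for `x = 1`. -/
theorem run_colorC (h : Input b n I s) (hA : (∀ p q, graphAt n (s aAA) 0 p q =
    graphAt n (s aAA) 0 q p) ∧ ∀ p, graphAt n (s aAA) 0 p p = 0)
    (hR : IsForest (graphAt n (s aAA) 0) (marked n (s aRR))) (hC : s aC = 0) :
    Run b colorC s fun s' =>
      IsTwoColoring (graphAt n (s aAA) 0) (marked n (s aRR)) (s' aC) := by
  set A := graphAt n (s aAA) 0 with hAdef
  refine Run.seq_assign h.two_le ?_
  set s₁ := s.store xo ((0 : Expr).eval s) ((0 : Expr).eval s) with hs₁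
  have F₁ : ∀ a, a ≠ xo → s₁ a = s a := fun a ha => by simp [hs₁, ha]
  have ho : s₁ xo 0 = 0 := by simp [hs₁]
  have h' := h.of_eq (F₁ 0 (by decide))
  rw [← F₁ aRR (by decide)] at hR ⊢
  rw [← F₁ aC (by decide)] at hC
  rw [← F₁ aAA (by decide)] at hAdef
  clear_value s₁
  clear hs₁ F₁
  refine Run.seq h.two_le (P := fun s' => marked n (s' aU) = marked n (s₁ aRR)) ?_
    fun s₂ h₂ F₂ => ?_
  · refine Run.tabC h.two_le (n := n) (o' := 0) (fun p => s₁ aRR p) (by decide) (by decide)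
      (by decide) h.le_cube (fun s' hs' => (h'.of_eq hs').nE_eval) (fun _ _ => rfl)
      (fun p hp s' h1 h2 _ => by simp [h1, h2]) fun s' _ h1 _ => ?_
    ext p
    simp only [mem_marked]
    refine and_congr_right fun hp => ?_
    rw [← h1 p hp, zero_add]
  have h' := h'.of_eq (F₂ 0 rfl)
  rw [← F₂ xo rfl] at ho
  rw [← F₂ aC rfl] at hC
  rw [← F₂ aAA rfl] at hAdef
  rw [← h₂] at hR ⊢
  clear F₂ h₂
  refine Run.seq h.two_le (run_peelC h' ho) fun s₃ ⟨Us, g0, gstep, _, gend⟩ F₃ => ?_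
  rw [← hAdef] at gstep gend
  have hUn : Us n = ∅ := (isForest_iff_of_peelStep hA.2 gstep gend).1 (g0 ▸ hR)
  have h' := h'.of_eq (F₃ 0 rfl)
  rw [← F₃ aC rfl] at hC
  rw [← F₃ aAA rfl] at hAdef
  rw [← g0]
  have hUsub : ∀ t ≤ n, Us t ⊆ range n := by
    intro t
    induction t with
    | zero => intro _; rw [g0]; exact filter_subset _ _
    | succ t ih =>
      intro ht
      rcases gstep t ht with ⟨-, h1⟩ | ⟨p, -, -, -, h1⟩
      · rw [h1]; exact ih (by omega)
      · rw [h1]; exact (erase_subset _ _).trans (ih (by omega))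
  clear F₃ gend
  refine Run.forC h.two_le (n := n) (fun k s' => IsTwoColoring A (Us (n - k)) (s' aC) ∧
    ∀ p, p ∉ Us (n - k) → s' aC p = 0) rfl
    h.le_cube (fun s' hs' => (h'.of_eq hs').nE_eval) rfl (by decide) ?_ ?_ ?_
  · intro s' _ hs'
    rw [hs' aC (by decide), hC]
    refine ⟨fun p hp => ?_, fun _ _ => rfl⟩
    rw [Nat.sub_zero, hUn] at hp
    simp at hp
  · rintro k hk s₄ hk₄ hF ⟨hcol, hzero⟩
    have h' := h'.of_eq (hF 0 (by decide) rfl)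
    rw [← hF aAA (by decide) rfl] at hAdef
    rw [← hF aOrd (by decide) rfl] at gstep
    clear hF
    obtain ⟨t, ht⟩ : ∃ t, n = k + 1 + t := ⟨n - (k + 1), by omega⟩
    rw [show n - (k + 1) = t by omega]
    rw [show n - k = t + 1 by omega] at hcol hzero
    refine Run.seq_assign h.two_le ?_
    simp only [Expr.eval_zero, Expr.eval_read, Expr.eval_sub, h'.nE_eval, Expr.eval_one,
      Expr.eval_var, hk₄, show n - 1 - k = t by omega]
    set s₅ := s₄.store xr 0 (s₄ aOrd t) with hs₅
    have F₅ : ∀ a, a ≠ xr → s₅ a = s₄ a := fun a ha => by simp [hs₅, ha]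
    have hr : s₅ xr 0 = s₄ aOrd t := by simp [hs₅]
    have h' := h'.of_eq (F₅ 0 (by decide))
    rw [← F₅ aAA (by decide)] at hAdef
    rw [← F₅ aC (by decide)] at hcol hzero
    have hst := gstep t (by omega)
    rw [← hr] at hst
    clear_value s₅
    clear hr hs₅ F₅ gstep
    refine Run.ite h.two_le (fun h1 => ?_) fun h1 => Run.skip fun s₆ _ h6 => ?_
    · rcases hst with ⟨h2, -⟩ | ⟨p, hp, hpr, hdeg, hU⟩
      · exact absurd h2 h1
      have hpn := mem_range.1 (hUsub t (by omega) hp)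
      rw [hU] at hcol hzero
      refine Run.seq h.two_le (P := fun s' => s' xu 0 ≠ 0 ↔
        ∃ q ∈ (Us t).erase p, A p q ≠ 0 ∧ s₅ aC q = 1) ?_ fun s₆ h₆ F₆ => ?_
      · refine Run.findC h.two_le (n := n) (fun q => A p q ≠ 0 ∧ s₅ aC q = 1) (by decide)
          (by decide) (by decide) h.le_cube (fun s' h'' => (h'.of_eq h'').nE_eval) ?_
          fun s' _ h1 => ?_
        · intro q hq s' g1 g2
          have hi := h'.of_eq (g2 0 (by decide) (by decide))
          simp only [Expr.eval_mul, Expr.eval_read, Expr.eval_add, Expr.eval_sub, Expr.eval_var,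
            Expr.eval_one, hi.nE_eval, g1, g2 xr (by decide) (by decide), hpr,
            Nat.add_sub_cancel, g2 aAA (by decide) (by decide), g2 aC (by decide) (by decide),
            Expr.eval_two, mul_ne_zero_iff, hAdef, graphAt_of_lt hpn hq, zero_add]
          omega
        · have hmem : ∀ q, s₅ aC q = 1 → q ∈ (Us t).erase p := fun q hq => by
            by_contra hcon
            have := hzero q hcon
            omega
          rcases h1 with ⟨h1, h2⟩ | ⟨q, hq, h1, h2⟩
          · refine ⟨fun h => absurd h1 h, ?_⟩
            rintro ⟨q, hq, h3⟩
            refine absurd h3 (h2 q (mem_range.1 (hUsub t (by omega) (mem_of_mem_erase hq))))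
          · exact ⟨fun _ => ⟨q, hmem q h2.2, h2⟩, fun _ => by omega⟩
      rw [← F₆ xr rfl] at hpr
      rw [← F₆ aC rfl] at h₆ hcol hzero
      refine Run.assign fun s₇ _ h7 => ?_
      rw [h7 aC (by decide)]
      simp only [Expr.eval_sub, Expr.eval_add, Expr.eval_var, Expr.eval_one, hpr,
        Nat.add_sub_cancel, State.store, Function.update_self]
      refine ⟨hcol.insert hA.1 hA.2 hp hdeg (by omega) ?_, fun q hq => ?_⟩
      · rw [← h₆]; omega
      · have hqp : q ≠ p := by rintro rfl; exact hq hp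
        rw [Function.update_of_ne hqp]
        exact hzero q fun hh => hq (mem_of_mem_erase hh)
    · rw [h6 aC (by decide)]
      rcases hst with ⟨-, h2⟩ | ⟨p, -, h2, -⟩
      · rw [h2] at hcol hzero
        exact ⟨hcol, hzero⟩
      · simp [h2] at h1
  · rintro s' - ⟨hcol, -⟩
    rwa [Nat.sub_self] at hcol

end RAM

/-! ### Rounding the half-integral cover. -/

namespace RAM

open FVS Finset DoubleCover

variable {b n : ℕ} {I : ℕ → ℕ} {s : State}

/-- Twice the value of the vertex `v` in the half-integral cover given by a cover of the double
cover. -/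
def coverCount (L R : ℕ → ℕ) (v : ℕ) : ℕ := (if L v = 0 then 1 else 0) + if R v ≠ 0 then 1 else 0

theorem coverCount_le (L R : ℕ → ℕ) (v : ℕ) : coverCount L R v ≤ 2 := by
  unfold coverCount; split_ifs <;> omega

/-- The weight of the vertices of value one half in the marked forest with colour `c`. -/
def colorWeight (n : ℕ) (W K RR C : ℕ → ℕ) (c : ℕ) : ℕ :=
  ∑ v ∈ range n, if K v = 1 ∧ RR v ≠ 0 ∧ C v = c then W v else 0

/-- Take the vertices of value one, and those of value one half outside the forest or with colour
`c`. -/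
def IsChosen (K RR C : ℕ → ℕ) (c v : ℕ) : Prop :=
  K v = 2 ∨ (K v = 1 ∧ (RR v = 0 ∨ C v = c))

instance (K RR C : ℕ → ℕ) (c v : ℕ) : Decidable (IsChosen K RR C c v) := by
  unfold IsChosen; infer_instance

/-- The rounding of the half-integral cover. -/
def outputC : Cmd :=
  tabC aK xp 0 nE ((1 - .read aL (var xp)) + (1 - (1 - .read aR (var xp)))) ;;
  sumC xs xp nE (.read aW (var xp) - .read aW (var xp) * ((.read aK (var xp) - 1) +
    (1 - .read aK (var xp)) + (1 - .read aRR (var xp)) + (.read aC (var xp) - 1) +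
    (1 - .read aC (var xp)))) ;;
  sumC xk xp nE (.read aW (var xp) - .read aW (var xp) * ((.read aK (var xp) - 1) +
    (1 - .read aK (var xp)) + (1 - .read aRR (var xp)) + (.read aC (var xp) - 2) +
    (2 - .read aC (var xp)))) ;;
  .assign xv 0 (1 + (1 - (1 - (var xs - var xk)))) ;;
  tabC aOut xp 0 nE (1 - (1 - ((.read aK (var xp) - 1) + .read aK (var xp) *
    ((1 - .read aRR (var xp)) +
      (1 - ((.read aC (var xp) - var xv) + (var xv - .read aC (var xp))))))))

/-- In the two sums the weight is multiplied by a number that vanishes exactly when all conditions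
hold, and the product is subtracted from the weight. Truncation thus turns the condition into a
selection and keeps the stored value tame. -/
theorem run_outputC (h : Input b n I s) : Run b outputC s fun s' => ∃ c c',
    ((c = 1 ∧ c' = 2) ∨ (c = 2 ∧ c' = 1)) ∧
    colorWeight n (s aW) (coverCount (s aL) (s aR)) (s aRR) (s aC) c ≤
      colorWeight n (s aW) (coverCount (s aL) (s aR)) (s aRR) (s aC) c' ∧
    (∀ v < n, s' aOut v =
      if IsChosen (coverCount (s aL) (s aR)) (s aRR) (s aC) c v then 1 else 0) ∧
    ∀ v, n ≤ v → s' aOut v = s aOut v := by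
  set K := coverCount (s aL) (s aR) with hK
  refine Run.seq h.two_le (P := fun s' => ∀ v < n, s' aK v = K v) ?_ fun s₁ h₁ F₁ => ?_
  · refine Run.tabC h.two_le (n := n) (o' := 0) K (by decide) (by decide)
      (by decide) h.le_cube (fun s' hs' => (h.of_eq hs').nE_eval) (fun _ _ => rfl)
      ?_ fun s' _ h1 _ v hv => by simpa using h1 v hv
    intro v _ s' h1 h2 _
    simp only [Expr.eval_add, Expr.eval_sub, Expr.eval_one, Expr.eval_read, Expr.eval_var, h1,
      h2 aL (by decide) (by decide), h2 aR (by decide) (by decide), hK, coverCount]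
    split_ifs <;> omega
  have h' := h.of_eq (F₁ 0 rfl)
  rw [← F₁ aW rfl, ← F₁ aRR rfl, ← F₁ aC rfl, ← F₁ aOut rfl]
  have hKle : ∀ v, K v ≤ 2 := coverCount_le _ _
  clear_value K
  clear F₁ hK
  have hsum : ∀ (c : ℕ) (e : Expr) (x : ℕ) (s₂ : State), x ≠ aW → x ≠ aK → x ≠ aRR → x ≠ aC →
      x ≠ xp → x ≠ 0 → (∀ s', e.eval s' = c) → s₂ 0 = s₁ 0 → s₂ aW = s₁ aW → s₂ aRR = s₁ aRR →
      s₂ aC = s₁ aC → s₂ aK = s₁ aK → Run b (sumC x xp nE (.read aW (var xp) - .read aW (var xp) *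
        ((.read aK (var xp) - 1) + (1 - .read aK (var xp)) + (1 - .read aRR (var xp)) +
          (.read aC (var xp) - e) + (e - .read aC (var xp))))) s₂
        fun s' => s' x 0 = colorWeight n (s₁ aW) K (s₁ aRR) (s₁ aC) c := by
    intro c e x s₂ x1 x2 x3 x4 x5 x6 he e0 e1 e2 e3 e4
    have h₂ := h'.of_eq e0
    refine Run.sumC h.two_le (n := n) _ x6 (by decide) x5 h.le_cube
      (fun s' hs' => (h₂.of_eq hs').nE_eval) ?_ fun s' _ h1 => h1
    intro v hv s' g1 g2
    simp only [Expr.eval_add, Expr.eval_sub, Expr.eval_one, Expr.eval_read, Expr.eval_var,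
      Expr.eval_mul, he, g1, g2 aW (Ne.symm x1) (by decide), g2 aK (Ne.symm x2) (by decide),
      g2 aRR (Ne.symm x3) (by decide), g2 aC (Ne.symm x4) (by decide), e1, e2, e3, e4, h₁ v hv]
    split_ifs with hc
    · obtain ⟨c1, c2, c3⟩ := hc
      rw [c1, c3, show 1 - s₁ aRR v = 0 by omega]; simp
    · refine Nat.sub_eq_zero_of_le (Nat.le_mul_of_pos_right _ ?_)
      omega
  refine Run.seq h.two_le (hsum 1 1 xs s₁ (by decide) (by decide) (by decide) (by decide)
    (by decide) (by decide) (fun _ => rfl) rfl rfl rfl rfl rfl) fun s₂ h₂ F₂ => ?_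
  refine Run.seq h.two_le (hsum 2 2 xk s₂ (by decide) (by decide) (by decide) (by decide)
    (by decide) (by decide) (fun _ => rfl) (F₂ 0 rfl) (F₂ aW rfl) (F₂ aRR rfl) (F₂ aC rfl)
    (F₂ aK rfl)) fun s₃ h₃ F₃ => ?_
  clear hsum
  rw [← F₃ xs rfl] at h₂
  have F : ∀ a, a ≠ xs → a ≠ xk → a ≠ xp → s₃ a = s₁ a := fun a a1 a2 a3 => by
    rw [F₃ a (by simp [Cmd.writes, sumC, forC, Ne.symm a2, Ne.symm a3]),
      F₂ a (by simp [Cmd.writes, sumC, forC, Ne.symm a1, Ne.symm a3])]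
  clear F₂ F₃
  refine Run.seq_assign h.two_le ?_
  simp only [Expr.eval_zero, Expr.eval_add, Expr.eval_sub, Expr.eval_one, Expr.eval_var, h₂, h₃]
  set W₁ := colorWeight n (s₁ aW) K (s₁ aRR) (s₁ aC) 1 with hW₁
  set W₂ := colorWeight n (s₁ aW) K (s₁ aRR) (s₁ aC) 2 with hW₂
  set c := 1 + (1 - (1 - (W₁ - W₂))) with hc
  -- The colour `2` is taken only if colour `1` is strictly heavier.
  have hcc : (c = 1 ∧ W₁ ≤ W₂) ∨ (c = 2 ∧ W₂ ≤ W₁) := by omega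
  set s₄ := s₃.store xv 0 c with hs₄
  have F₄ : ∀ a, a ≠ xv → a ≠ xs → a ≠ xk → a ≠ xp → s₄ a = s₁ a := fun a a0 a1 a2 a3 => by
    rw [← F a a1 a2 a3]; simp [hs₄, a0]
  have hv : s₄ xv 0 = c := by simp [hs₄]
  have h' := h'.of_eq (F₄ 0 (by decide) (by decide) (by decide) (by decide))
  clear_value s₄ c
  refine Run.tabC h.two_le (n := n) (o' := 0)
    (fun v => if IsChosen K (s₁ aRR) (s₁ aC) c v then 1 else 0) (by decide) (by decide)
    (by decide) h.le_cube (fun s' hs' => (h'.of_eq hs').nE_eval) (fun _ _ => rfl) ?_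
    fun s' _ h1 h2 => ?_
  · intro v hvn s' h1 h2 _
    simp only [Expr.eval_add, Expr.eval_sub, Expr.eval_one, Expr.eval_read, Expr.eval_var,
      Expr.eval_mul, h1, h2 aK (by decide) (by decide), h2 aRR (by decide) (by decide),
      h2 aC (by decide) (by decide), h2 xv (by decide) (by decide), hv,
      F₄ aK (by decide) (by decide) (by decide) (by decide),
      F₄ aRR (by decide) (by decide) (by decide) (by decide),
      F₄ aC (by decide) (by decide) (by decide) (by decide), h₁ v hvn, IsChosen]
    have hle : K v ≤ 2 := hKle v
    obtain h | h | h : K v = 0 ∨ K v = 1 ∨ K v = 2 := by omega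
    all_goals
      norm_num [h]
      try split_ifs
      all_goals omega
  · have e1 : ∀ v < n, s' aOut v = if IsChosen K (s₁ aRR) (s₁ aC) c v then 1 else 0 :=
      fun v hvn => by simpa using h1 v hvn
    have e2 : ∀ v, n ≤ v → s' aOut v = s₁ aOut v := fun v hvn => by
      rw [h2 v (by omega), F₄ aOut (by decide) (by decide) (by decide) (by decide)]
    rcases hcc with ⟨rfl, h5⟩ | ⟨rfl, h5⟩
    · exact ⟨1, 2, .inl ⟨rfl, rfl⟩, h5, e1, e2⟩
    · exact ⟨2, 1, .inr ⟨rfl, rfl⟩, h5, e1, e2⟩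

/-! ### The guarantee of the rounding -/

/-- An edge has two copies in the double cover, and each contributes one covered end. -/
theorem two_le_coverCount_add {L R : ℕ → ℕ} {u v : ℕ} (h1 : L u ≠ 0 → R v ≠ 0)
    (h2 : L v ≠ 0 → R u ≠ 0) : 2 ≤ coverCount L R u + coverCount L R v := by
  unfold coverCount; split_ifs <;> omega

/-- If both ends were left out, both would have value one half, lie in the forest and avoid the
colour `c`. They would then share the other colour. -/
theorem IsChosen.or {K RR C : ℕ → ℕ} {A : ℕ → ℕ → ℕ} {c u v : ℕ} (hu : u < n) (hv : v < n)
    (hle : ∀ v, K v ≤ 2) (hK : 2 ≤ K u + K v) (hc : c = 1 ∨ c = 2) (hA : A u v ≠ 0)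
    (hC : IsTwoColoring A (marked n RR) C) : IsChosen K RR C c u ∨ IsChosen K RR C c v := by
  have h1 := hle u
  have h2 := hle v
  by_contra! hcon
  simp only [IsChosen, not_or, not_and] at hcon
  obtain ⟨⟨a1, a2⟩, b1, b2⟩ := hcon
  obtain ⟨a3, a4⟩ := a2 (by omega)
  obtain ⟨b3, b4⟩ := b2 (by omega)
  have hCu := hC u (mem_marked.2 ⟨hu, a3⟩)
  have hCv := (hC v (mem_marked.2 ⟨hv, b3⟩)).1
  have := hCu.2 v (mem_marked.2 ⟨hv, b3⟩) hA
  have := hCu.1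
  omega

/-- The term with `K` pays a chosen vertex of value one twice and one of value one half once. The
second payment for the latter comes from the complement of the forest, or, inside the forest, from
the unchosen colour class, which is at least as heavy. -/
theorem two_mul_sum_isChosen_le {W K RR C : ℕ → ℕ} {c c' : ℕ} (hc : c ≠ c') (hK : ∀ v, K v ≤ 2)
    (hle : colorWeight n W K RR C c ≤ colorWeight n W K RR C c') :
    2 * ∑ v ∈ range n with IsChosen K RR C c v, W v ≤
      ∑ v ∈ range n, K v * W v + ∑ v ∈ range n \ marked n RR, W v := by
  have key : ∀ v ∈ range n, 2 * (if IsChosen K RR C c v then W v else 0) +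
      (if K v = 1 ∧ RR v ≠ 0 ∧ C v = c' then W v else 0) ≤
      K v * W v + (if v ∈ range n \ marked n RR then W v else 0) +
      (if K v = 1 ∧ RR v ≠ 0 ∧ C v = c then W v else 0) := by
    intro v hv
    have hm : v ∈ range n \ marked n RR ↔ RR v = 0 := by
      have := mem_range.1 hv
      simp [mem_marked, this]
    have hKv := hK v
    have hch : IsChosen K RR C c v ↔ K v = 2 ∨ (K v = 1 ∧ (RR v = 0 ∨ C v = c)) := Iff.rfl
    have hk : K v * W v = if K v = 2 then 2 * W v else if K v = 1 then W v else 0 := by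
      obtain h | h | h : K v = 0 ∨ K v = 1 ∨ K v = 2 := by omega
      all_goals simp [h]
    rw [hk]
    split_ifs <;> grind
  have h1 := sum_le_sum key
  rw [sum_add_distrib, sum_add_distrib, sum_add_distrib, ← mul_sum, ← sum_filter,
    ← sum_filter (s := range n) (p := fun v => v ∈ range n \ marked n RR),
    filter_mem_eq_inter, inter_eq_right.2 sdiff_subset] at h1
  unfold colorWeight at hle
  omega

theorem sum_coverCount_mul {W L R : ℕ → ℕ} :
    ∑ v ∈ range n, coverCount L R v * W v = coverWeight n W L R := by
  refine sum_congr rfl fun v _ => ?_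
  rw [coverCount, add_mul]
  congr 1 <;> split_ifs <;> simp

end RAM

/-! ### Assembling the algorithm. -/

namespace RAM

open FVS Finset DoubleCover

variable {b n : ℕ} {I : ℕ → ℕ} {s : State}

/-- Putting both copies of each vertex of `Y` into the cover of the double cover costs twice the
weight of `Y`. -/
theorem le_two_mul_of_isCover {adj : ℕ → ℕ → Prop} {W L R : ℕ → ℕ} {Y : Finset ℕ}
    (hY : Y ⊆ range n) (hc : ∀ u < n, ∀ v < n, adj u v → u ∈ Y ∨ v ∈ Y)
    (h : ∀ L' R', IsCover n adj L' R' → coverWeight n W L R ≤ coverWeight n W L' R') :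
    coverWeight n W L R ≤ 2 * ∑ v ∈ Y, W v := by
  refine (h (fun v => if v ∈ Y then 0 else 1) (fun v => if v ∈ Y then 1 else 0) ?_).trans ?_
  · intro u hu v hv huv h1
    have := hc u hu v hv huv
    simp only [ne_eq, ite_eq_left_iff, Classical.not_imp] at h1
    simp [this.resolve_left h1.1]
  · have : ∀ v ∈ range n, (if (if v ∈ Y then 0 else 1) = 0 then W v else 0) +
        (if (if v ∈ Y then 1 else 0) ≠ 0 then W v else 0) = 2 * if v ∈ Y then W v else 0 := by
      intro v _
      split_ifs <;> simp_all <;> omega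
    rw [coverWeight, sum_congr rfl this, ← mul_sum, ← sum_filter, filter_mem_eq_inter,
      inter_eq_right.2 hY]

/-- A vertex cover of weight at most the sum of the minimum weights of a vertex cover and of a
feedback vertex set. -/
def coverC : Cmd :=
  weightsC ;; flowC ;; forwardC ;; reverseC ;; colorC ;; outputC

theorem run_coverC (h : Input b n I s) (h0 : ∀ a ≠ 0, s a = 0) {m : ℕ} (hm : 0 < m)
    (hmb : m ≤ b ^ 3) (hW : ∑ v ∈ range n, scaledWeight n I v < 2 ^ m)
    (hA : (∀ p q, graphAt n I 1 p q = graphAt n I 1 q p) ∧ ∀ p, graphAt n I 1 p p = 0) :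
    Run b coverC s fun s' => ∃ X ⊆ range n, (∀ v, s' aOut v = if v ∈ X then 1 else 0) ∧
      (∀ u < n, ∀ v < n, graphAt n I 1 u v ≠ 0 → u ∈ X ∨ v ∈ X) ∧
      ∀ Y ⊆ range n, ∀ H ⊆ range n, (∀ u < n, ∀ v < n, graphAt n I 1 u v ≠ 0 → u ∈ Y ∨ v ∈ Y) →
        IsForest (graphAt n I 1) (range n \ H) →
        ∑ v ∈ X, scaledWeight n I v ≤ ∑ v ∈ Y, scaledWeight n I v + ∑ v ∈ H, scaledWeight n I v := by
  have hadj : ∀ u < n, ∀ v < n, inputAdj n I u v ↔ graphAt n I 1 u v ≠ 0 := fun u hu v hv => by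
    rw [graphAt_of_lt hu hv, inputAdj]
  refine Run.seq h.two_le (run_weightsC h) fun s₁ ⟨hW₁, hWW, hAA⟩ F₁ => ?_
  have h' := h.of_eq (F₁ 0 rfl)
  have hg : graphAt n (s₁ aAA) 0 = graphAt n I 1 := by
    funext p q
    simp only [graphAt]
    split_ifs with hpq
    · rw [zero_add]; exact hAA _ (mul_add_lt hpq.1 hpq.2)
    · rfl
  have hsum : ∀ T ⊆ range n, ∑ v ∈ T, scaledWeight n I v = ∑ v ∈ T, s₁ aW v := fun T hT =>
    sum_congr rfl fun v hv => (hW₁ v (mem_range.1 (hT hv))).symm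
  have hWW₁ : ∀ p < n, s₁ aWW p = s₁ aW p := fun p hp => by rw [hWW p hp, hW₁ p hp]
  rw [hsum _ Subset.rfl] at hW
  have z₁ : ∀ a, a ≠ 0 → weightsC.writes a = false → s₁ a = 0 := fun a ha hw => by
    rw [F₁ a hw, h0 a ha]
  clear F₁ hWW hAA
  refine Run.seq h.two_le (run_flowC h' hm hmb hW (z₁ aCap (by decide) rfl)
    (z₁ aF (by decide) rfl)) fun s₂ ⟨hcov, hmin⟩ F₂ => ?_
  have h' := h'.of_eq (F₂ 0 rfl)
  refine Run.seq h.two_le (run_forwardC h' (by rw [F₂ aDead rfl, z₁ aDead (by decide) rfl])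
    (by rw [F₂ aAA rfl, hg]; exact hA)) fun s₃ ⟨htr, hg₃, hw₃⟩ F₃ => ?_
  have h' := h'.of_eq (F₃ 0 rfl)
  rw [F₂ aAA rfl, hg] at hg₃
  rw [F₂ aWW rfl] at hw₃
  refine Run.seq h.two_le (run_reverseC h' htr (by rw [hg₃]; exact hA)
    (by rw [F₃ aRR rfl, F₂ aRR rfl, z₁ aRR (by decide) rfl])) fun s₄ hgood F₄ => ?_
  have h' := h'.of_eq (F₄ 0 rfl)
  rw [hg₃] at hgood
  have hg₄ : graphAt n (s₄ aAA) 0 = graphAt n I 1 := by rw [F₄ aAA rfl, hg₃]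
  refine Run.seq h.two_le (run_colorC h' (by rw [hg₄]; exact hA) (by rw [hg₄]; exact hgood.forest)
    (by rw [F₄ aC rfl, F₃ aC rfl, F₂ aC rfl, z₁ aC (by decide) rfl])) fun s₅ hcol F₅ => ?_
  have h' := h'.of_eq (F₅ 0 rfl)
  rw [hg₄, ← F₅ aRR rfl] at hcol
  rw [← F₅ aRR rfl] at hgood
  have eL : s₅ aL = s₂ aL := by rw [F₅ aL rfl, F₄ aL rfl, F₃ aL rfl]
  have eR : s₅ aR = s₂ aR := by rw [F₅ aR rfl, F₄ aR rfl, F₃ aR rfl]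
  have eW : s₅ aW = s₁ aW := by rw [F₅ aW rfl, F₄ aW rfl, F₃ aW rfl, F₂ aW rfl]
  have eO : s₅ aOut = 0 := by
    rw [F₅ aOut rfl, F₄ aOut rfl, F₃ aOut rfl, F₂ aOut rfl, z₁ aOut (by decide) rfl]
  rw [← eL, ← eR] at hcov hmin
  clear F₂ F₃ F₄ F₅ z₁ hg hg₄ htr eL eR
  refine (run_outputC h').conseq ?_
  rintro s' ⟨c, c', hcc, hle, hout, hout'⟩ -
  rw [eW] at hle
  rw [eO] at hout'
  refine ⟨{v ∈ range n | IsChosen (coverCount (s₅ aL) (s₅ aR)) (s₅ aRR) (s₅ aC) c v},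
    filter_subset _ _, fun v => ?_, fun u hu v hv huv => ?_, fun Y hY H hH hYc hHf => ?_⟩
  · rcases lt_or_ge v n with hv | hv
    · simp [hout v hv, hv]
    · simp [hout' v hv, hv]
  · simp only [mem_filter, mem_range, hu, hv, true_and]
    refine IsChosen.or hu hv (coverCount_le _ _) (two_le_coverCount_add ?_ ?_) (by omega) huv hcol
    · exact hcov u hu v hv ((hadj u hu v hv).2 huv)
    · exact hcov v hv u hu ((hadj v hv u hu).2 (by rw [hA.1]; exact huv))
  · rw [hsum _ (filter_subset _ _), hsum _ hY, hsum _ hH]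
    -- Twice the output weight is at most the weight of the double cover plus that of the complement
    -- of the forest; these are at most twice the weights of `Y` and of `H`.
    have h1 := two_mul_sum_isChosen_le (by omega) (coverCount_le _ _) hle
    rw [sum_coverCount_mul] at h1
    have h2 := le_two_mul_of_isCover hY (fun u hu v hv huv =>
      hYc u hu v hv ((hadj u hu v hv).1 huv)) hmin
    have h3 := hgood.le H hH hHf
    have e1 : ∀ T ⊆ range n, ∑ v ∈ T, s₃ aWW v = ∑ v ∈ T, s₁ aW v := fun T hT =>
      sum_congr rfl fun v hv => by
        have hv' := mem_range.1 (hT hv)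
        rw [hw₃ v hv', hWW₁ v hv']
    rw [e1 _ sdiff_subset, e1 _ hH] at h3
    omega

end RAM

/-! ### Acyclic graphs are forests -/

/-- Otherwise every path could be prolonged at its start by a neighbour other than its second
vertex. In an acyclic graph this neighbour is off the path, so there would be arbitrarily long
paths. -/
theorem SimpleGraph.IsAcyclic.exists_forall_adj_eq {V : Type*} [Finite V] [Nonempty V]
    {G : SimpleGraph V} (hG : G.IsAcyclic) : ∃ u, ∀ x y, G.Adj u x → G.Adj u y → x = y := by
  classical
  by_contra! hcon
  have key : ∀ k, ∃ (u v : V) (p : G.Walk u v), p.IsPath ∧ p.length = k := by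
    intro k
    induction k with
    | zero => exact ⟨Classical.arbitrary V, _, .nil, by simp, rfl⟩
    | succ k ih =>
      obtain ⟨u, v, p, hp, hk⟩ := ih
      obtain ⟨x, hx, hxs⟩ : ∃ x, G.Adj u x ∧ x ≠ p.snd := by
        obtain ⟨x, y, hx, hy, hxy⟩ := hcon u
        by_cases h : x = p.snd
        · exact ⟨y, hy, fun hh => hxy (h.trans hh.symm)⟩
        · exact ⟨x, hx, h⟩
      refine ⟨x, v, .cons hx.symm p, ?_, by simp [hk]⟩
      rw [SimpleGraph.Walk.cons_isPath_iff]
      exact ⟨hp, fun hmem => hxs (hG.eq_snd_of_adj_start hp hx hmem)⟩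
  have := Fintype.ofFinite V
  obtain ⟨u, v, p, hp, hk⟩ := key (Fintype.card V)
  exact absurd hp.length_lt (by omega)

-- A set of remaining vertices induces an acyclic graph, which has a vertex with at most one
-- neighbour. As `A` has entries at most one, that vertex has degree at most one.
open Finset in
theorem IsFeedbackVertexSet.isForest {n : ℕ} {G : SimpleGraph (Fin n)} {X : Finset (Fin n)}
    (h : IsFeedbackVertexSet G (X : Set (Fin n))) {A : ℕ → ℕ → ℕ} (hA : ∀ p q, A p q ≤ 1)
    (hG : ∀ u v : Fin n, A u v ≠ 0 → G.Adj u v) :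
    FVS.IsForest A (range n \ X.map Fin.valEmbedding) := by
  intro U hU hne
  have hUn : ∀ p ∈ U, p < n := fun p hp => mem_range.1 (mem_sdiff.1 (hU hp)).1
  set S : Set (Fin n) := {v | (v : ℕ) ∈ U} with hS
  have hSX : S ≤ (X : Set (Fin n))ᶜ := fun v hv hvX =>
    (mem_sdiff.1 (hU hv)).2 (mem_map.2 ⟨v, hvX, rfl⟩)
  have hac : (G.induce S).IsAcyclic :=
    SimpleGraph.IsAcyclic.embedding (G.induceHomOfLE hSX) h
  obtain ⟨p₀, hp₀⟩ := hne
  have : Nonempty S := ⟨⟨⟨p₀, hUn p₀ hp₀⟩, hp₀⟩⟩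
  obtain ⟨⟨u, hu⟩, huniq⟩ := hac.exists_forall_adj_eq
  refine ⟨u, hu, ?_⟩
  by_cases hz : ∃ q ∈ U, A u q ≠ 0
  · obtain ⟨q, hq, hqz⟩ := hz
    rw [FVS.degIn, sum_eq_single q ?_ fun hh => absurd hq hh]
    · exact hA _ _
    · intro r hr hrq
      by_contra hrz
      have := huniq ⟨⟨q, hUn q hq⟩, hq⟩ ⟨⟨r, hUn r hr⟩, hr⟩
        (hG u ⟨q, hUn q hq⟩ hqz) (hG u ⟨r, hUn r hr⟩ hrz)
      simp only [Subtype.mk.injEq, Fin.mk.injEq] at this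
      exact hrq this.symm
  · push Not at hz
    rw [FVS.degIn, sum_eq_zero hz]
    omega

/-! ### The input word -/

section Encode

open RAM Finset

variable {n : ℕ} (G : SimpleGraph (Fin n)) (w : Fin n → NNRat)

/-- The input word as the initial content of array `0`. -/
noncomputable def inputWord (i : ℕ) : ℕ := (encodeWeightedGraph G w).getD i 0

open Classical in
theorem encodeWeightedGraph_eq : encodeWeightedGraph G w =
    [n] ++ (List.ofFn fun k : Fin (n * n) => if G.Adj k.divNat k.modNat then 1 else 0) ++
      (List.ofFn fun v : Fin n => (w v).num) ++ (List.ofFn fun v : Fin n => (w v).den) := by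
  rw [encodeWeightedGraph, List.ofFn_mul]
  congr 4
  refine List.ofFn_inj.2 (funext fun u => List.ofFn_inj.2 (funext fun v => ?_))
  have h1 : (⟨u * n + v, mul_add_lt u.2 v.2⟩ : Fin (n * n)).divNat = u :=
    Fin.ext (add_div_and_mod v.2).1
  have h2 : (⟨u * n + v, mul_add_lt u.2 v.2⟩ : Fin (n * n)).modNat = v :=
    Fin.ext (add_div_and_mod v.2).2
  rw [h1, h2]

theorem length_encodeWeightedGraph : (encodeWeightedGraph G w).length = 1 + n * n + n + n := by
  rw [encodeWeightedGraph_eq]; simp; omega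

theorem inputWord_zero : inputWord G w 0 = n := by
  simp [inputWord, encodeWeightedGraph]

open Classical in
theorem inputWord_adj (u v : Fin n) :
    inputWord G w (1 + (u * n + v)) = if G.Adj u v then 1 else 0 := by
  have hk := mul_add_lt u.2 v.2
  rw [inputWord, encodeWeightedGraph_eq, List.getD_append _ _ _ _ (by simp; omega),
    List.getD_append _ _ _ _ (by simp; omega), List.getD_append_right _ _ _ _ (by simp),
    List.getD_eq_getElem _ _ (by simp; omega), List.getElem_ofFn]
  have h1 : (⟨1 + (u * n + v) - 1, by omega⟩ : Fin (n * n)).divNat = u :=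
    Fin.ext (by simpa [Fin.divNat] using (add_div_and_mod (u := u) v.2).1)
  have h2 : (⟨1 + (u * n + v) - 1, by omega⟩ : Fin (n * n)).modNat = v :=
    Fin.ext (by simpa [Fin.modNat] using (add_div_and_mod (u := u) v.2).2)
  simp only [List.length_singleton, h1, h2]

theorem inputWord_num (v : Fin n) : inputWord G w (1 + n * n + v) = (w v).num := by
  have := v.2
  rw [inputWord, encodeWeightedGraph_eq, List.getD_append _ _ _ _ (by simp; omega),
    List.getD_append_right _ _ _ _ (by simp; omega),
    List.getD_eq_getElem _ _ (by simp; omega), List.getElem_ofFn]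
  congr 2
  ext
  simp
  omega

theorem inputWord_den (v : Fin n) : inputWord G w (1 + n * n + n + v) = (w v).den := by
  have := v.2
  rw [inputWord, encodeWeightedGraph_eq, List.getD_append_right _ _ _ _ (by simp; omega),
    List.getD_eq_getElem _ _ (by simp; omega), List.getElem_ofFn]
  congr 2
  ext
  simp
  omega

theorem getD_lt_two_pow_bitLength (x : List ℕ) (i : ℕ) : x.getD i 0 < 2 ^ bitLength x := by
  rcases lt_or_ge i x.length with h | h
  · rw [List.getD_eq_getElem _ _ h, ← Nat.size_le]
    have : x[i].size + 1 ≤ bitLength x :=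
      List.single_le_sum (by simp) _ (List.mem_map_of_mem (List.getElem_mem h))
    omega
  · rw [List.getD_eq_default _ _ h]; positivity

theorem length_le_bitLength (x : List ℕ) : x.length ≤ bitLength x := by
  have := List.length_le_sum_of_one_le (x.map fun k => k.size + 1) (by simp)
  rwa [List.length_map] at this

/-- The product of all denominators of the weights. -/
def denProd : ℕ := ∏ u : Fin n, (w u).den

theorem denProd_pos : 0 < denProd w := prod_pos fun u _ => (w u).den_pos

theorem prod_inputWord_den : ∏ u ∈ range n, inputWord G w (1 + n * n + n + u) = denProd w := by
  rw [prod_range]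
  exact prod_congr rfl fun u _ => inputWord_den G w u

/-- Each denominator divides the product of all, so the integer division is exact. All weights are
scaled by the same factor, which cancels in the final inequality. -/
theorem scaledWeight_inputWord (v : Fin n) :
    (scaledWeight n (inputWord G w) v : NNRat) = w v * denProd w := by
  have hd : (w v).den ∣ denProd w := dvd_prod_of_mem (fun u => (w u).den) (mem_univ v)
  have h0 : ((w v).den : NNRat) ≠ 0 := by exact_mod_cast (w v).den_ne_zero
  rw [scaledWeight, prod_inputWord_den, inputWord_num, inputWord_den,
    Nat.cast_div (hd.mul_left _) h0, Nat.cast_mul]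
  conv_rhs => rw [← NNRat.num_div_den (w v)]
  rw [div_mul_eq_mul_div]

theorem sum_scaledWeight_inputWord (X : Finset (Fin n)) :
    ((∑ v ∈ X.map Fin.valEmbedding, scaledWeight n (inputWord G w) v : ℕ) : NNRat) =
      weight w X * denProd w := by
  rw [sum_map, Nat.cast_sum, weight, sum_mul]
  exact sum_congr rfl fun v _ => scaledWeight_inputWord G w v

/-- Each scaled weight is at most a product of `n + 1` input entries, each at most `2 ^ L`. The
exponent bounds the number of scaling phases. -/
theorem sum_scaledWeight_lt : ∑ v ∈ range n, scaledWeight n (inputWord G w) v <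
    2 ^ (n + bitLength (encodeWeightedGraph G w) * (n + 1)) := by
  set L := bitLength (encodeWeightedGraph G w)
  have hlt : ∀ i, inputWord G w i ≤ 2 ^ L := fun i => (getD_lt_two_pow_bitLength _ i).le
  have h1 : ∀ v ∈ range n, scaledWeight n (inputWord G w) v ≤ 2 ^ (L * (n + 1)) := by
    intro v _
    refine (Nat.div_le_self _ _).trans ?_
    rw [mul_add, mul_one, pow_add, mul_comm, pow_mul]
    refine Nat.mul_le_mul ?_ (hlt _)
    have := prod_le_prod' (s := range n) fun u _ => hlt (1 + n * n + n + u)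
    simpa using this
  have h2 := sum_le_card_nsmul _ _ _ h1
  rw [card_range, smul_eq_mul] at h2
  rw [pow_add]
  exact h2.trans_lt (Nat.mul_lt_mul_of_pos_right Nat.lt_two_pow_self (by positivity))

theorem getD_encodeVertexSet (X : Finset (Fin n)) (i : ℕ) :
    (encodeVertexSet X).getD i 0 = if i ∈ X.map Fin.valEmbedding then 1 else 0 := by
  rcases lt_or_ge i n with h | h
  · rw [encodeVertexSet, List.getD_eq_getElem _ _ (by simpa using h), List.getElem_ofFn]
    have : i ∈ X.map Fin.valEmbedding ↔ (⟨i, h⟩ : Fin n) ∈ X := by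
      simp only [mem_map, Fin.valEmbedding_apply]
      exact ⟨fun ⟨v, hv, e⟩ => by subst e; exact hv, fun hv => ⟨_, hv, rfl⟩⟩
    simp [this]
  · rw [List.getD_eq_default _ _ (by simpa [encodeVertexSet] using h), if_neg]
    simp only [mem_map, Fin.valEmbedding_apply, not_exists, not_and]
    intro v _ e
    have := v.2
    omega

end Encode

/-- The bound for the cost of a tame program of weight `W` that makes at most `(L + d) ^ k` steps
on inputs of bit length `L`. -/
noncomputable def RAM.costBound (k W d : ℕ) : Polynomial ℕ :=
  (.X + .C d) ^ k *
    (.C W * (2 + .C W * (.X + (.X + .C d) ^ k * (.C W * (.X + 1)) + 1)))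

-- The initial memory has only entries below `2 ^ L` with `L` the input length, so `Steps.exec`
-- applies with both bit bounds equal to `L`.
open RAM in
theorem RAM.Run.outputsWithin {c : Cmd} {x y : List ℕ} {d : ℕ}
    (h : Run (bitLength x + d) c (initState x) fun s => ∀ i, s 1 i = y.getD i 0)
    (hc : c.tame = true) :
    OutputsWithin c x y ((costBound c.deg c.wt d).eval (bitLength x)) := by
  obtain ⟨s', T, hT, hle, hs⟩ := h
  set L := bitLength x
  have hM : L + T * (c.wt * (L + 1)) ≤ L + (L + d) ^ c.deg * (c.wt * (L + 1)) :=
    Nat.add_le_add_left (Nat.mul_le_mul_right _ hle) _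
  have hini : ∀ a i, initState x a i < 2 ^ L := fun a i => by
    unfold initState
    split_ifs
    · exact getD_lt_two_pow_bitLength x i
    · positivity
  obtain ⟨⟨t, ht, htle⟩, -⟩ := hT.exec hini (hini 0) hc le_rfl hM
  refine ⟨s', t, ht, htle.trans ?_, hs⟩
  simp only [costBound, Polynomial.eval_mul, Polynomial.eval_pow, Polynomial.eval_add, Polynomial.eval_X,
    Polynomial.eval_C, Polynomial.eval_one, Polynomial.eval_ofNat]
  exact Nat.mul_le_mul_right _ hle

/-! ### Correctness on encoded graphs and the final statement. -/

section

open RAM Finset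

variable {n : ℕ} (G : SimpleGraph (Fin n)) (w : Fin n → NNRat)

theorem graphAt_inputWord_ne_zero (u v : Fin n) :
    graphAt n (inputWord G w) 1 u v ≠ 0 ↔ G.Adj u v := by
  rw [graphAt_of_lt u.2 v.2, inputWord_adj]; simp

theorem graphAt_inputWord_le_one (p q : ℕ) : graphAt n (inputWord G w) 1 p q ≤ 1 := by
  by_cases h : p < n ∧ q < n
  · rw [graphAt_of_lt h.1 h.2]
    have := inputWord_adj G w ⟨p, h.1⟩ ⟨q, h.2⟩
    simp only at this
    rw [this]; split_ifs <;> omega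
  · simp [graphAt, h]

theorem graphAt_inputWord_symm_diag :
    (∀ p q, graphAt n (inputWord G w) 1 p q = graphAt n (inputWord G w) 1 q p) ∧
      ∀ p, graphAt n (inputWord G w) 1 p p = 0 := by
  constructor
  · intro p q
    by_cases h : p < n ∧ q < n
    · have h1 := graphAt_inputWord_ne_zero G w ⟨p, h.1⟩ ⟨q, h.2⟩
      have h2 := graphAt_inputWord_ne_zero G w ⟨q, h.2⟩ ⟨p, h.1⟩
      rw [G.adj_comm, ← h1] at h2
      have h3 := graphAt_inputWord_le_one G w p q
      have h4 := graphAt_inputWord_le_one G w q p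
      simp only at h2
      omega
    · simp [graphAt, h, and_comm]
  · intro p
    by_cases h : p < n
    · have h1 := graphAt_inputWord_ne_zero G w ⟨p, h⟩ ⟨p, h⟩
      simpa using h1
    · simp [graphAt, h]

theorem exists_weight_eq_optWVC : ∃ Y : Finset (Fin n), G.IsVertexCover (Y : Set (Fin n)) ∧
    weight w Y = optWVC G w := by
  classical
  obtain ⟨Y, hY, h⟩ := exists_mem_eq_inf' (s := {X : Finset (Fin n) | G.IsVertexCover (X : Set _)})
    ⟨univ, by simp⟩ (weight w)
  refine ⟨Y, by simpa using hY, ?_⟩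
  rw [optWVC, ← h]

theorem exists_weight_eq_optFVS : ∃ H : Finset (Fin n),
    IsFeedbackVertexSet G (H : Set (Fin n)) ∧ weight w H = optFVS G w := by
  classical
  obtain ⟨H, hH, h⟩ := exists_mem_eq_inf'
    (s := {X : Finset (Fin n) | IsFeedbackVertexSet G (X : Set _)})
    ⟨univ, by simpa using isFeedbackVertexSet_univ G⟩ (weight w)
  refine ⟨H, by simpa using hH, ?_⟩
  rw [optFVS, ← h]

theorem run_coverC_initState : ∃ X : Finset (Fin n),
    Run (bitLength (encodeWeightedGraph G w) + 3) coverC (initState (encodeWeightedGraph G w))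
      (fun s => ∀ i, s 1 i = (encodeVertexSet X).getD i 0) ∧
    G.IsVertexCover (X : Set (Fin n)) ∧ weight w X ≤ optWVC G w + optFVS G w := by
  set L := bitLength (encodeWeightedGraph G w) with hL
  have hn : n ≤ L := by
    have := length_le_bitLength (encodeWeightedGraph G w)
    rw [length_encodeWeightedGraph] at this
    omega
  have hI : Input (L + 3) n (inputWord G w) (initState (encodeWeightedGraph G w)) :=
    ⟨by omega, by omega, inputWord_zero G w, rfl⟩
  -- The number of scaling phases fits the cubic loop bound; the summand `1` only makes the exponent
  -- positive.
  have hm : n + L * (n + 1) + 1 ≤ (L + 3) ^ 3 := by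
    have := Nat.mul_le_mul_left L hn
    nlinarith
  have hW : ∑ v ∈ range n, scaledWeight n (inputWord G w) v < 2 ^ (n + L * (n + 1) + 1) :=
    (sum_scaledWeight_lt G w).trans_le (Nat.pow_le_pow_right (by omega) (Nat.le_succ _))
  obtain ⟨s', T, hT, hle, X', hX', hout, hcov, hmin⟩ := run_coverC hI
    (fun a ha => by funext i; simp [initState, ha]) (Nat.succ_pos _) hm hW
    (graphAt_inputWord_symm_diag G w)
  set X : Finset (Fin n) := {v | (v : ℕ) ∈ X'} with hX
  have hmap : X.map Fin.valEmbedding = X' := by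
    ext i
    simp only [mem_map, hX, mem_filter, mem_univ, true_and, Fin.valEmbedding_apply]
    exact ⟨fun ⟨v, hv, e⟩ => e ▸ hv, fun hi => ⟨⟨i, mem_range.1 (hX' hi)⟩, hi, rfl⟩⟩
  refine ⟨X, ⟨s', T, hT, hle, fun i => ?_⟩, ?_, ?_⟩
  · rw [getD_encodeVertexSet, hmap]; exact hout i
  · intro u v huv
    have := hcov u u.2 v v.2 ((graphAt_inputWord_ne_zero G w u v).2 huv)
    simpa [hX] using this
  · obtain ⟨Y, hY, eY⟩ := exists_weight_eq_optWVC G w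
    obtain ⟨H, hH, eH⟩ := exists_weight_eq_optFVS G w
    have hsub : ∀ Z : Finset (Fin n), Z.map Fin.valEmbedding ⊆ range n := fun Z i hi => by
      obtain ⟨v, -, rfl⟩ := mem_map.1 hi
      exact mem_range.2 v.2
    have key := hmin (Y.map Fin.valEmbedding) (hsub Y) (H.map Fin.valEmbedding) (hsub H) ?_
      (hH.isForest (graphAt_inputWord_le_one G w)
        fun u v huv => (graphAt_inputWord_ne_zero G w u v).1 huv)
    · rw [← hmap, ← Nat.cast_le (α := NNRat), Nat.cast_add, sum_scaledWeight_inputWord,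
        sum_scaledWeight_inputWord, sum_scaledWeight_inputWord, ← add_mul] at key
      rw [← eY, ← eH]
      exact le_of_mul_le_mul_right key (by exact_mod_cast denProd_pos w)
    · intro u hu v hv huv
      have := hY ((graphAt_inputWord_ne_zero G w ⟨u, hu⟩ ⟨v, hv⟩).1 huv)
      exact this.imp (fun h => mem_map.2 ⟨_, h, rfl⟩) fun h => mem_map.2 ⟨_, h, rfl⟩

end

theorem mainTheorem2 :
    ∃ (c : RAM.Cmd) (p : Polynomial ℕ),
      ∀ (n : ℕ) (G : SimpleGraph (Fin n)) (w : Fin n → NNRat),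
        ∃ X : Finset (Fin n),
          RAM.OutputsWithin c (encodeWeightedGraph G w) (encodeVertexSet X)
            (p.eval (RAM.bitLength (encodeWeightedGraph G w))) ∧
          G.IsVertexCover (X : Set (Fin n)) ∧
          weight w X ≤ optWVC G w + optFVS G w := by
  refine ⟨RAM.coverC, RAM.costBound RAM.coverC.deg RAM.coverC.wt 3, fun n G w => ?_⟩
  obtain ⟨X, hrun, hX⟩ := run_coverC_initState G w
  -- `rfl` evaluates the syntactic tameness test on the complete program.
  exact ⟨X, hrun.outputsWithin rfl, hX⟩
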